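/- Let $M$ be a smooth connected manifold of dimension $n$, let $D\subset TM$ be a smooth distribution of constant rank $k\ge 1$ satisfying Hörmander's condition, and let $g$ be a smooth scalar product on $D$ (the Riemannian case $D=TM$ is allowed; no equiregularity is assumed). Let $H:T^*M\to\mathbb R$ be the Hamiltonian, $H(\lambda)=\tfrac12\sum_{i=1}^k\langle\lambda,X_i\rangle^2$ for any local orthonormal frame $X_1,\dots,X_k$ of $D$. For $\lambda\in T_q^*M$ let $\exp_q(t,\lambda)$ be the projection to $M$ of the integral curve, starting at $\lambda$, of the Hamiltonian vector field $\vec H$ ($dH=\sigma(\cdot,\vec H)$, $\sigma$ the canonical symplectic form of $T^*M$), and let $C_q=\{\lambda\in T^*_qM: 2H(\lambda)=1\}$. Let $V$ be a complement of $D$, i.e. a smooth sub-bundle of $TM$ with $TM=D\oplus V$, and let $\mathbf h_q=V_q^\perp$ and $\mathbf v_q=D_q^\perp$ be the annihilators in $T_q^*M$, so that $C_q=(C_q\cap\mathbf h_q)\times\mathbf v_q$, where $C_q\cap\mathbf h_q$ is the unit sphere of the Euclidean space $(\mathbf h_q,2H)$. A family $\mu=\{\mu_q\}_{q\in M}$ of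 probability measures on the fibres $C_q$ is called adapted if, for every $q$, $\mu_q$ is the product of the uniform probability measure on $C_q\cap\mathbf h_q$ and of a Borel probability measure on $\mathbf v_q$ for which all linear functions on $\mathbf v_q$ are square integrable, and if $q\mapsto\int_{C_q}f^2\,d\mu_q$ is continuous for every continuous, fibrewise linear $f:T^*M\to\mathbb R$. For an adapted family $\mu$ and $\phi\in C^\infty(M)$, the microscopic Laplacian is $$(L_\mu\phi)(q)=\lim_{t\to0^+}\frac{2k}{t^2}\int_{C_q}\bigl(\phi(\exp_q(t,\lambda))-\phi(q)\bigr)\,d\mu_q(\lambda).$$ Theorem. Let $\mu$ be any adapted family. For every compact $K\subset M$ there is $\varepsilon>0$ such that, for all $q\in K$, the geodesics $\exp_q(\cdot,\lambda)$ with $\lambda\in C_q$ are defined on $[0,\varepsilon)$ and the integrals above exist for $0<t<\varepsilon$ and every $\phi\in C^\infty(M)$. For every $\phi\in C^\infty(M)$ the limit that defines $L_\mu\phi$ exists and is uniform on compact sets. The operator $L_\mu$ depends only on the complement $V$ (given the sub-Riemannian structure), and not on the choice of the adapted family $\mu$. Moreover, if $X_1,\dots,X_k$ is a local orthonormal frame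 of $D$ and $X_{k+1},\dots,X_n$ is a local frame of $V$ on an open set $U$, with structural functions $c_{ij}^\ell$ defined by $[X_i,X_j]=\sum_{\ell=1}^n c_{ij}^\ell X_\ell$, then on $U$ $$L_\mu=\sum_{i=1}^k X_i^2+\sum_{i,j=1}^k c_{ji}^j\,X_i .$$ -/

import Mathlib

open Set Filter Topology MeasureTheory Bundle
open scoped Manifold ContDiff ENNReal

noncomputable section

namespace SubRiemannian

/-! ### Distributions, sub-Riemannian structures and complements -/

section Structures

variable {n : ℕ} {M : Type*} [TopologicalSpace M]
  [ChartedSpace (EuclideanSpace ℝ (Fin n)) M] [IsManifold (𝓡 n) ∞ M]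

/-- The vector field `X` is smooth on the set `U`. -/
def SmoothFieldOn (X : Π q : M, TangentSpace (𝓡 n) q) (U : Set M) : Prop :=
  ContMDiffOn (𝓡 n) (𝓡 n).tangent ∞
    (fun q => (⟨q, X q⟩ : TangentBundle (𝓡 n) M)) U

/-- A family `D` of linear subspaces of the tangent spaces is a smooth sub-bundle of `TM` of
constant rank `r`: locally it is spanned by `r` smooth, pointwise linearly independent fields. -/
def IsSmoothSubbundle (D : Π q : M, Submodule ℝ (TangentSpace (𝓡 n) q)) (r : ℕ) : Prop :=
  ∀ q₀ : M, ∃ U : Set M, IsOpen U ∧ q₀ ∈ U ∧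
    ∃ X : Fin r → Π q : M, TangentSpace (𝓡 n) q,
      (∀ i, SmoothFieldOn (X i) U) ∧
      ∀ q ∈ U, LinearIndependent ℝ (fun i => X i q) ∧
        Submodule.span ℝ (range fun i => X i q) = D q

/-- The vector fields obtained from the smooth sections of `D` by finitely many sums and Lie
brackets with smooth sections of `D`; these are the sections in the union of the flag
`D¹ = Γ(D)`, `Dⁱ⁺¹ = Dⁱ + [Dⁱ, D]`. -/
inductive IsBracketField (D : Π q : M, Submodule ℝ (TangentSpace (𝓡 n) q)) :
    (Π q : M, TangentSpace (𝓡 n) q) → Prop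
  | of_section (X : Π q : M, TangentSpace (𝓡 n) q) (hX : SmoothFieldOn X univ)
      (hD : ∀ q, X q ∈ D q) : IsBracketField D X
  | add (X Y : Π q : M, TangentSpace (𝓡 n) q) (hX : IsBracketField D X)
      (hY : IsBracketField D Y) : IsBracketField D (fun q => X q + Y q)
  | bracket (X Y : Π q : M, TangentSpace (𝓡 n) q) (hX : IsBracketField D X)
      (hY : SmoothFieldOn Y univ) (hD : ∀ q, Y q ∈ D q) :
      IsBracketField D (fun q => VectorField.mlieBracket (𝓡 n) X Y q)

/-- Hörmander's condition: the iterated brackets of sections of `D` span every tangent space. -/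
def BracketGenerating (D : Π q : M, Submodule ℝ (TangentSpace (𝓡 n) q)) : Prop :=
  ∀ q : M, Submodule.span ℝ {v : TangentSpace (𝓡 n) q | ∃ X, IsBracketField D X ∧ X q = v} = ⊤

end Structures

/-- A (sub-)Riemannian structure of rank `k` on the `n`-dimensional manifold `M`: a smooth
bracket generating distribution of rank `k` with a smooth scalar product on it. The Riemannian
case `k = n` is included. -/
structure Structure (n k : ℕ) (M : Type*) [TopologicalSpace M]
    [ChartedSpace (EuclideanSpace ℝ (Fin n)) M] [IsManifold (𝓡 n) ∞ M] where
  /-- the distribution -/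
  distr : Π q : M, Submodule ℝ (TangentSpace (𝓡 n) q)
  /-- it is a smooth sub-bundle of rank `k` -/
  smooth_distr : IsSmoothSubbundle distr k
  /-- it satisfies Hörmander's condition -/
  bracketGenerating : BracketGenerating distr
  /-- the scalar product on the distribution -/
  metric : Π q : M, distr q →ₗ[ℝ] distr q →ₗ[ℝ] ℝ
  metric_symm : ∀ (q : M) (v w : distr q), metric q v w = metric q w v
  metric_pos : ∀ (q : M) (v : distr q), v ≠ 0 → 0 < metric q v v
  /-- the scalar product of two local smooth sections of the distribution is smooth -/
  metric_smooth : ∀ (U : Set M), IsOpen U → ∀ X Y : Π q : M, distr q,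
    SmoothFieldOn (fun q => (X q : TangentSpace (𝓡 n) q)) U →
    SmoothFieldOn (fun q => (Y q : TangentSpace (𝓡 n) q)) U →
    ContMDiffOn (𝓡 n) 𝓘(ℝ, ℝ) ∞ (fun q => metric q (X q) (Y q)) U

/-! ### The cotangent bundle and its symplectic form -/

section Cotangent

variable {n : ℕ} {M : Type*} [TopologicalSpace M]
  [ChartedSpace (EuclideanSpace ℝ (Fin n)) M] [IsManifold (𝓡 n) ∞ M]

/-- The cotangent space at `q`. -/
abbrev CotSpace (n : ℕ) {M : Type*} [TopologicalSpace M]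
    [ChartedSpace (EuclideanSpace ℝ (Fin n)) M] (q : M) : Type :=
  TangentSpace (𝓡 n) q →L[ℝ] Bundle.Trivial M ℝ q

/-- The cotangent bundle, with Mathlib's topology and smooth structure of a bundle of continuous
linear maps. -/
abbrev CotBundle (n : ℕ) (M : Type*) [TopologicalSpace M]
    [ChartedSpace (EuclideanSpace ℝ (Fin n)) M] : Type _ :=
  TotalSpace (EuclideanSpace ℝ (Fin n) →L[ℝ] ℝ) (fun q : M => CotSpace n q)

/-- The model with corners of the cotangent bundle. -/
abbrev cotModel (n : ℕ) :
    ModelWithCorners ℝ (EuclideanSpace ℝ (Fin n) × (EuclideanSpace ℝ (Fin n) →L[ℝ] ℝ))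
      (ModelProd (EuclideanSpace ℝ (Fin n)) (EuclideanSpace ℝ (Fin n) →L[ℝ] ℝ)) :=
  (𝓡 n).prod 𝓘(ℝ, EuclideanSpace ℝ (Fin n) →L[ℝ] ℝ)

/-- The Borel σ-algebra on a cotangent space. -/
instance (q : M) : MeasurableSpace (CotSpace n q) := borel _

/-- The position coordinates `x` on `T*M` induced by the chart of `M` at `q₀`. -/
def coordX (q₀ : M) (z : CotBundle n M) : EuclideanSpace ℝ (Fin n) :=
  extChartAt (𝓡 n) q₀ z.proj

/-- The momentum coordinates `p` on `T*M` induced by the chart of `M` at `q₀`: the components of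
a covector with respect to the coordinate vectors of the chart. -/
def coordP (q₀ : M) (z : CotBundle n M) : EuclideanSpace ℝ (Fin n) →L[ℝ] ℝ :=
  z.2.comp (mfderiv (𝓡 n) 𝓘(ℝ, EuclideanSpace ℝ (Fin n)) (extChartAt (𝓡 n) q₀) z.proj).inverse

/-- The differential `dx` of the position coordinates at `z` (for the chart at the foot point). -/
def dX (z : CotBundle n M) :
    TangentSpace (cotModel n) z →L[ℝ] EuclideanSpace ℝ (Fin n) :=
  mfderiv (cotModel n) 𝓘(ℝ, EuclideanSpace ℝ (Fin n)) (coordX z.proj) z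

/-- The differential `dp` of the momentum coordinates at `z` (for the chart at the foot point). -/
def dP (z : CotBundle n M) :
    TangentSpace (cotModel n) z →L[ℝ] (EuclideanSpace ℝ (Fin n) →L[ℝ] ℝ) :=
  mfderiv (cotModel n) 𝓘(ℝ, EuclideanSpace ℝ (Fin n) →L[ℝ] ℝ) (coordP z.proj) z

/-- The canonical symplectic form `σ = ∑ dpᵢ ∧ dxᵢ` (the differential of the tautological one-form
`∑ pᵢ dxᵢ`) of the cotangent bundle. -/
def sympl (z : CotBundle n M) (ξ η : TangentSpace (cotModel n) z) : ℝ :=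
  dP z ξ (dX z η) - dP z η (dX z ξ)

/-- `v` is the Hamiltonian vector field of `h`, that is `dh = σ(·, v)`. -/
def IsHamiltonianField (h : CotBundle n M → ℝ)
    (v : Π z : CotBundle n M, TangentSpace (cotModel n) z) : Prop :=
  ∀ (z : CotBundle n M) (ξ : TangentSpace (cotModel n) z),
    mfderiv (cotModel n) 𝓘(ℝ, ℝ) h z ξ = sympl z ξ (v z)

/-- The annihilator of a subspace of `T_qM` in `T*_qM`. -/
def annihilator {q : M} (W : Submodule ℝ (TangentSpace (𝓡 n) q)) :
    Submodule ℝ (CotSpace n q) where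
  carrier := {l | ∀ v ∈ W, l v = 0}
  zero_mem' := fun v _ => by simp
  add_mem' := fun {a b} ha hb v hv => by simp [ha v hv, hb v hv]
  smul_mem' := fun c a ha v hv => by simp [ha v hv]

end Cotangent

/-! ### Hamiltonian, exponential map, adapted measures, microscopic Laplacian -/

namespace Structure

variable {n k : ℕ} {M : Type*} [TopologicalSpace M]
  [ChartedSpace (EuclideanSpace ℝ (Fin n)) M] [IsManifold (𝓡 n) ∞ M]

/-- `b` is an orthonormal basis of the distribution at `q` (for a structure of rank `k`). -/
def IsOrthonormal (S : Structure n k M) (q : M) (b : Fin k → S.distr q) : Prop :=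
  ∀ i j, S.metric q (b i) (b j) = if i = j then 1 else 0

open scoped Classical in
/-- The Hamiltonian `H(λ) = ½ ∑ᵢ ⟨λ, Xᵢ⟩²`, with `X₁, …, X_k` any orthonormal basis of the
distribution at the foot point of `λ` (one always exists; `H` does not depend on it). -/
def hamiltonian (S : Structure n k M) (z : CotBundle n M) : ℝ :=
  if h : ∃ b : Fin k → S.distr z.proj, S.IsOrthonormal z.proj b then
    (1 / 2) * ∑ i, (z.2 (h.choose i : TangentSpace (𝓡 n) z.proj)) ^ 2
  else 0

/-- The fibre `C_q = {λ ∈ T*_qM | 2 H(λ) = 1}` of the unit cotangent bundle. -/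
def cylinder (S : Structure n k M) (q : M) : Set (CotSpace n q) :=
  {l | 2 * S.hamiltonian ⟨q, l⟩ = 1}

/-- `Λ` is an integral curve, with initial covector `l ∈ T*_qM`, of the Hamiltonian vector field
of `H` on an open interval that contains `0` and `t`. -/
def IsExtremalTo (S : Structure n k M) (q : M) (l : CotSpace n q) (t : ℝ)
    (Λ : ℝ → CotBundle n M) : Prop :=
  Λ 0 = ⟨q, l⟩ ∧ ∃ v : Π z : CotBundle n M, TangentSpace (cotModel n) z,
    IsHamiltonianField S.hamiltonian v ∧
    ∃ δ > 0, IsMIntegralCurveOn Λ v (Ioo (-δ) (t + δ))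

/-- The domain `D_q` of the exponential map: the pairs `(t, λ)` with `t ≥ 0` such that the normal
geodesic with initial covector `λ` is defined up to time `t`. -/
def expDomain (S : Structure n k M) (q : M) : Set (ℝ × CotSpace n q) :=
  {p | 0 ≤ p.1 ∧ ∃ Λ, S.IsExtremalTo q p.2 p.1 Λ}

open scoped Classical in
/-- The exponential map `exp_q(t, λ) = γ_λ(t) = π(λ(t))` (with value `q` outside its domain). -/
def exp (S : Structure n k M) (q : M) (t : ℝ) (l : CotSpace n q) : M :=
  if h : ∃ Λ, S.IsExtremalTo q l t Λ then (h.choose t).proj else q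

/-- `V` is a complement of the distribution: a smooth sub-bundle with `TM = D ⊕ V`. -/
def IsComplement (S : Structure n k M) (V : Π q : M, Submodule ℝ (TangentSpace (𝓡 n) q)) :
    Prop :=
  (∃ m, IsSmoothSubbundle V m) ∧ ∀ q, IsCompl (S.distr q) (V q)

end Structure

/-- The uniform probability measure on the unit sphere of the Euclidean space `ℝᵏ`. -/
def unitSphereMeasure (k : ℕ) :
    Measure (Metric.sphere (0 : EuclideanSpace ℝ (Fin k)) 1) :=
  ((volume : Measure (EuclideanSpace ℝ (Fin k))).toSphere univ)⁻¹ •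
    (volume : Measure (EuclideanSpace ℝ (Fin k))).toSphere

namespace Structure

variable {n k : ℕ} {M : Type*} [TopologicalSpace M]
  [ChartedSpace (EuclideanSpace ℝ (Fin n)) M] [IsManifold (𝓡 n) ∞ M]

/-- `s` is the uniform probability measure on the sphere `C_q ∩ h_q`, where `h_q` is the
annihilator of `V_q`: the image of the uniform measure on the unit sphere of `ℝᵏ` by a linear
isometry of `ℝᵏ` onto the Euclidean space `(h_q, 2H)`. (The image is the same for all such
isometries; onto is automatic, since `h_q` has dimension `k`.) -/
def IsSphereMeasure (S : Structure n k M) (V : Π q : M, Submodule ℝ (TangentSpace (𝓡 n) q))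
    (q : M) (s : Measure (CotSpace n q)) : Prop :=
  ∃ e : EuclideanSpace ℝ (Fin k) →ₗ[ℝ] CotSpace n q,
    (∀ x, e x ∈ annihilator (V q)) ∧
    (∀ x, 2 * S.hamiltonian ⟨q, e x⟩ = ‖x‖ ^ 2) ∧
    s = (unitSphereMeasure k).map
      (fun x : Metric.sphere (0 : EuclideanSpace ℝ (Fin k)) 1 => e (x : EuclideanSpace ℝ (Fin k)))

/-- A family `μ_q` of measures on the cotangent spaces is adapted to the splitting
`TM = D ⊕ V`. In the decomposition `C_q = (C_q ∩ h_q) × v_q`, `(a, b) ↦ a + b`, the measure `μ_q`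
(carried by `C_q`) is the product of the uniform probability measure on the sphere `C_q ∩ h_q` and
of a 2-decreasing probability measure on `v_q`, the annihilator of `D_q`; and the integral of
`f²` depends continuously on `q` for every continuous, fibrewise linear `f : T*M → ℝ`. -/
structure IsAdapted (S : Structure n k M) (V : Π q : M, Submodule ℝ (TangentSpace (𝓡 n) q))
    (μ : Π q : M, Measure (CotSpace n q)) : Prop where
  product : ∀ q : M, ∃ (s : Measure (CotSpace n q)) (ν : Measure (annihilator (S.distr q))),
    S.IsSphereMeasure V q s ∧ IsProbabilityMeasure ν ∧
    (∀ f : annihilator (S.distr q) →ₗ[ℝ] ℝ, MemLp f 2 ν) ∧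
    μ q = (s.prod ν).map (fun p => p.1 + (p.2 : CotSpace n q))
  continuous_sq : ∀ f : CotBundle n M → ℝ, Continuous f →
    (∀ q : M, IsLinearMap ℝ (fun l : CotSpace n q => f ⟨q, l⟩)) →
    Continuous (fun q : M => ∫ l, (f ⟨q, l⟩) ^ 2 ∂(μ q))

/-- The average `(2k / t²) ∫ (φ(exp_q(t, λ)) - φ(q)) dμ_q(λ)` over the geodesics of length `t`. -/
def geodesicAverage (S : Structure n k M) (μ : Π q : M, Measure (CotSpace n q)) (φ : M → ℝ)
    (t : ℝ) (q : M) : ℝ :=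
  (2 * k / t ^ 2) * ∫ l, (φ (S.exp q t l) - φ q) ∂(μ q)

/-- The microscopic Laplacian: the limit of the averages as `t → 0⁺`. -/
def microLaplacian (S : Structure n k M) (μ : Π q : M, Measure (CotSpace n q)) (φ : M → ℝ)
    (q : M) : ℝ :=
  limUnder (𝓝[>] (0 : ℝ)) (fun t => S.geodesicAverage μ φ t q)

/-- `X₁, …, X_k` is a smooth orthonormal frame of the distribution and `Y₁, …, Y_m` a smooth frame
of `V` on the open set `U`. -/
structure IsAdaptedFrame (S : Structure n k M)
    (V : Π q : M, Submodule ℝ (TangentSpace (𝓡 n) q)) {m : ℕ} (U : Set M)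
    (X : Fin k → Π q : M, TangentSpace (𝓡 n) q)
    (Y : Fin m → Π q : M, TangentSpace (𝓡 n) q) : Prop where
  isOpen : IsOpen U
  isLocalFrame : IsLocalFrameOn (𝓡 n) (EuclideanSpace ℝ (Fin n)) ∞ (Sum.elim X Y) U
  mem_distr : ∀ i, ∀ q ∈ U, X i q ∈ S.distr q
  mem_compl : ∀ j, ∀ q ∈ U, Y j q ∈ V q
  orthonormal : ∀ q (hq : q ∈ U), S.IsOrthonormal q (fun i => ⟨X i q, mem_distr i q hq⟩)

end Structure

section Frames

variable {n : ℕ} {M : Type*} [TopologicalSpace M]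
  [ChartedSpace (EuclideanSpace ℝ (Fin n)) M] [IsManifold (𝓡 n) ∞ M]

/-- The derivative `X f` of the function `f` along the vector field `X`. -/
def fieldDeriv (X : Π q : M, TangentSpace (𝓡 n) q) (f : M → ℝ) (q : M) : ℝ :=
  mfderiv (𝓡 n) 𝓘(ℝ, ℝ) f q (X q)

/-- The structural functions `c_{ij}^l` of a local frame `Z` on `U`, defined on `U` by
`[Z_i, Z_j] = ∑_l c_{ij}^l Z_l`. -/
def structFun {ι : Type*} {Z : ι → Π q : M, TangentSpace (𝓡 n) q} {U : Set M}
    (hZ : IsLocalFrameOn (𝓡 n) (EuclideanSpace ℝ (Fin n)) ∞ Z U) (i j l : ι) (q : M) : ℝ :=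
  hZ.coeff l q (VectorField.mlieBracket (𝓡 n) (Z i) (Z j) q)

end Frames

end SubRiemannian

end

noncomputable section

namespace SubRiemannian

/-! ### Hamiltonian curves of a compactly supported frame of a vector space -/

section VectorSpace

variable {E : Type*} [NormedAddCommGroup E] [NormedSpace ℝ E] {k : ℕ}

/-! Put `h_i = ⟨λ, X_i⟩` for a local orthonormal frame of `D`. Along the Hamiltonian flow a function
of the position has derivative `∑ h_j X_j f`, and a momentum `⟨λ, W⟩` has derivative `∑ h_j ⟨λ,
[X_j, W]⟩`. Hence `φ(exp_q(t, λ))` equals `φ(q) + t ∑ h_i X_i φ + t²/2 ∑ (h_j ⟨λ, [X_j, X_i]⟩ X_i φ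
+ h_i h_j X_j X_i φ) + O(t³)`. The fibre `C_q` is unbounded in general, but energy conservation
gives `|h_i| ≤ 1` on it, so the third derivative grows at most quadratically in `λ` and the
remainder is at most `B (1 + |λ|²) t³` (`hamCurve_taylor`). The second moments of an adapted family
are locally bounded (`Structure.IsAdapted.exists_secondMoment_le`), so after averaging and
multiplication by `2k/t²` the remainder is `O(t)`, locally uniformly in `q`.

It remains to compute moments of `λ = a + b`, with `a` uniform on the sphere in the annihilator of
`V` and `b` in the annihilator of `D`. Only `a` enters `h_i`, so `h_i` has mean zero and `h_i h_j`
has mean `δ_ij / k`. If `[X_j, X_i] = ∑ c_a X_a` modulo `V`, then `⟨λ, [X_j, X_i]⟩ = ∑ c_a h_a + ⟨b,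
[X_j, X_i]⟩`. By the product structure the last term, multiplied by `h_j`, has mean zero
(`FibreData.integral_eval_mul_eval`). The vertical measure thus disappears and only the traces `∑_j
c_{ji}^j` remain; these depend on `V` but not on `μ`.

To reach these computations from the intrinsic definitions, the symplectic form is shown to have its
standard expression in every canonical chart (`sympl_eq`), which identifies the Hamiltonian field
there (`isHamiltonian_iff`). Uniqueness of integral curves then identifies `exp` with the curves
found in coordinates (`Structure.exp_eq_of_isExtremalTo`). These live for a uniform time: the speed
of the position is bounded at unit energy, and Grönwall's inequality prevents blow-up of the
momentum. -/

theorem abs_sub_taylor_two_le {g g₁ g₂ g₃ : ℝ → ℝ} {B : ℝ}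
    (hg : ∀ s ∈ Ico (0 : ℝ) 1, HasDerivAt g (g₁ s) s)
    (hg₁ : ∀ s ∈ Ico (0 : ℝ) 1, HasDerivAt g₁ (g₂ s) s)
    (hg₂ : ∀ s ∈ Ico (0 : ℝ) 1, HasDerivAt g₂ (g₃ s) s)
    (hB : ∀ s ∈ Ico (0 : ℝ) 1, |g₃ s| ≤ B) {t : ℝ} (ht : t ∈ Ico (0 : ℝ) 1) :
    |g t - g 0 - t * g₁ 0 - t ^ 2 / 2 * g₂ 0| ≤ B * t ^ 3 := by
  have ht0 := ht.1
  have hB0 : 0 ≤ B := (abs_nonneg _).trans (hB t ht)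
  have hsub : ∀ s ∈ Icc (0 : ℝ) t, s ∈ Ico (0 : ℝ) 1 := fun s hs => ⟨hs.1, hs.2.trans_lt ht.2⟩
  -- The mean value inequality, applied three times on `[0, t]`. The factor gained by integrating
  -- powers of `s` is dropped, so the constant is `B` and not `B / 6`.
  have key : ∀ {f f' : ℝ → ℝ} {C : ℝ}, (∀ s ∈ Ico (0 : ℝ) 1, HasDerivAt f (f' s) s) →
      (∀ s ∈ Icc (0 : ℝ) t, |f' s| ≤ C) → ∀ s ∈ Icc (0 : ℝ) t, |f s - f 0| ≤ C * s := by
    intro f f' C hf hC s hs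
    have := norm_image_sub_le_of_norm_deriv_le_segment' (f := f) (f' := f') (a := 0) (b := t)
      (C := C) (fun x hx => (hf x (hsub x hx)).hasDerivWithinAt)
      (fun x hx => hC x ⟨hx.1, hx.2.le⟩) s hs
    simpa using this
  have h2 : ∀ s ∈ Icc (0 : ℝ) t, |g₂ s - g₂ 0| ≤ B * t := fun s hs =>
    (key hg₂ (fun x hx => hB x (hsub x hx)) s hs).trans (mul_le_mul_of_nonneg_left hs.2 hB0)
  have h1 : ∀ s ∈ Icc (0 : ℝ) t, |g₁ s - g₁ 0 - s * g₂ 0| ≤ B * t * t := fun s hs => by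
    have := key (f := fun s => g₁ s - s * g₂ 0) (f' := fun s => g₂ s - g₂ 0) (C := B * t)
      (fun x hx => ((hg₁ x hx).fun_sub ((hasDerivAt_id' x).mul_const (g₂ 0))).congr_deriv
        (by ring)) h2 s hs
    have e : g₁ s - g₁ 0 - s * g₂ 0 = g₁ s - s * g₂ 0 - (g₁ 0 - 0 * g₂ 0) := by ring
    rw [e]
    exact this.trans (mul_le_mul_of_nonneg_left hs.2 (by positivity))
  have h0 := key (f := fun s => g s - s * g₁ 0 - s ^ 2 / 2 * g₂ 0)
      (f' := fun s => g₁ s - g₁ 0 - s * g₂ 0) (C := B * t * t)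
      (fun x hx => (((hg x hx).fun_sub ((hasDerivAt_id' x).mul_const (g₁ 0))).fun_sub
          ((((hasDerivAt_id' x).fun_pow 2).div_const 2).mul_const (g₂ 0))).congr_deriv
        (by push_cast; ring)) h1 t ⟨ht0, le_rfl⟩
  have e : g t - g 0 - t * g₁ 0 - t ^ 2 / 2 * g₂ 0 =
    g t - t * g₁ 0 - t ^ 2 / 2 * g₂ 0 - (g 0 - 0 * g₁ 0 - 0 ^ 2 / 2 * g₂ 0) := by ring
  rw [e]
  exact h0.trans (le_of_eq (by ring))

/-- The fibrewise linear function `(x, p) ↦ ⟨p, W x⟩` defined by a vector field `W`. -/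
def momentum (W : E → E) (z : E × (E →L[ℝ] ℝ)) : ℝ := z.2 (W z.1)

/-- Twice the Hamiltonian of the frame `X`. -/
def energy (X : Fin k → E → E) (z : E × (E →L[ℝ] ℝ)) : ℝ := ∑ i, momentum (X i) z ^ 2

/-- The Hamiltonian vector field of `½ ∑ ⟨p, X_i x⟩²`. -/
def hamField (X : Fin k → E → E) (z : E × (E →L[ℝ] ℝ)) : E × (E →L[ℝ] ℝ) :=
  (∑ i, momentum (X i) z • X i z.1,
    -∑ i, momentum (X i) z • z.2.comp (fderiv ℝ (X i) z.1))

/-- The derivative of a function along the `i`-th field of a frame. -/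
def frameDeriv (X : Fin k → E → E) (i : Fin k) (u : E → ℝ) (x : E) : ℝ := fderiv ℝ u x (X i x)

variable {X : Fin k → E → E}

/-- The momentum equation contributes `-⟨p, DX_j W⟩` and the position equation `⟨p, DW X_j⟩`;
together they form the bracket. The factor `r` makes the formula apply to the truncated field as
well. -/
theorem hasDerivAt_momentum {z : ℝ → E × (E →L[ℝ] ℝ)} {r t : ℝ}
    (hz : HasDerivAt z (r • hamField X (z t)) t) {W : E → E} (hW : Differentiable ℝ W) :
    HasDerivAt (fun s => momentum W (z s)) (r * ∑ j, momentum (X j) (z t) *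
      momentum (VectorField.lieBracket ℝ (X j) W) (z t)) t := by
  have h1 : HasDerivAt (fun s => (z s).1) (r • hamField X (z t)).1 t := hz.fst
  have h2 : HasDerivAt (fun s => (z s).2) (r • hamField X (z t)).2 t := hz.snd
  have h3 := (hW (z t).1).hasFDerivAt.comp_hasDerivAt t h1
  have h4 := h2.clm_apply h3
  refine h4.congr_deriv ?_
  simp only [hamField, Prod.smul_fst, Prod.smul_snd, Function.comp, momentum,
    VectorField.lieBracket, smul_apply, neg_apply,
    sum_apply, ContinuousLinearMap.comp_apply, map_smul, map_sum, map_sub,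
    smul_eq_mul, mul_sub, Finset.sum_sub_distrib]
  ring

theorem hasDerivAt_comp_fst {z : ℝ → E × (E →L[ℝ] ℝ)} {t : ℝ}
    (hz : HasDerivAt z (hamField X (z t)) t) {u : E → ℝ} (hu : Differentiable ℝ u) :
    HasDerivAt (fun s => u (z s).1) (∑ j, momentum (X j) (z t) * frameDeriv X j u (z t).1) t := by
  have h1 : HasDerivAt (fun s => (z s).1) (hamField X (z t)).1 t := hz.fst
  refine ((hu (z t).1).hasFDerivAt.comp_hasDerivAt t h1).congr_deriv ?_
  simp [hamField, frameDeriv]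

/-- The derivative is a double sum of terms antisymmetric in the two frame indices. A scalar factor
`r` does not affect this, so truncation preserves conservation of energy. -/
theorem hasDerivAt_energy {z : ℝ → E × (E →L[ℝ] ℝ)} {r t : ℝ}
    (hz : HasDerivAt z (r • hamField X (z t)) t) (hX : ∀ i, Differentiable ℝ (X i)) :
    HasDerivAt (fun s => energy X (z s)) 0 t := by
  have h := HasDerivAt.fun_sum (u := Finset.univ) (A := fun i s => momentum (X i) (z s) ^ 2)
    (fun i _ => (hasDerivAt_momentum hz (hX i)).pow 2)
  refine h.congr_deriv ?_
  set m := fun i j => momentum (X i) (z t) * momentum (X j) (z t) *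
    momentum (VectorField.lieBracket ℝ (X j) (X i)) (z t) with hm
  have hanti : ∀ i j, m i j = -m j i := by
    intro i j
    simp only [hm, momentum]
    rw [VectorField.lieBracket_swap]
    simp [mul_comm]
  have hs : ∑ i, ∑ j, m i j = 0 := by
    have : ∑ i, ∑ j, m i j = -∑ i, ∑ j, m i j := by
      conv_lhs => rw [Finset.sum_comm]
      rw [← Finset.sum_neg_distrib]
      refine Finset.sum_congr rfl fun i _ => ?_
      rw [← Finset.sum_neg_distrib]
      exact Finset.sum_congr rfl fun j _ => hanti j i
    linarith
  rw [← mul_zero (2 * r), ← hs]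
  simp only [Finset.mul_sum, hm]
  refine Finset.sum_congr rfl fun i _ => Finset.sum_congr rfl fun j _ => ?_
  push_cast
  ring

theorem abs_momentum_frame_le_one {z : E × (E →L[ℝ] ℝ)} (h : energy X z = 1) (i : Fin k) :
    |momentum (X i) z| ≤ 1 := by
  have : momentum (X i) z ^ 2 ≤ energy X z :=
    Finset.single_le_sum (f := fun i => momentum (X i) z ^ 2) (fun _ _ => sq_nonneg _)
      (Finset.mem_univ i)
  rw [h] at this
  exact (sq_le_one_iff_abs_le_one _).1 this

/-- Bounds of the fields of a frame and of their derivatives. -/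
structure FrameBound (X : Fin k → E → E) (C : ℝ) : Prop where
  nonneg : 0 ≤ C
  norm_le : ∀ x, ∑ i, ‖X i x‖ ≤ C
  norm_fderiv_le : ∀ x, ∑ i, ‖fderiv ℝ (X i) x‖ ≤ C

theorem exists_frameBound (hX : ∀ i, ContDiff ℝ ∞ (X i)) (hc : ∀ i, HasCompactSupport (X i)) :
    ∃ C, FrameBound X C := by
  choose A hA using fun i => (hX i).continuous.bounded_above_of_compact_support (hc i)
  choose B hB using fun i => ((hX i).continuous_fderiv (by simp)).bounded_above_of_compact_support
    ((hc i).fderiv ℝ)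
  refine ⟨max 0 (max (∑ i, A i) (∑ i, B i)), by positivity, fun x => ?_, fun x => ?_⟩
  · exact (Finset.sum_le_sum fun i _ => hA i x).trans (by simp)
  · exact (Finset.sum_le_sum fun i _ => hB i x).trans (by simp)

theorem norm_hamField_fst_le {C : ℝ} (hC : FrameBound X C) {z : E × (E →L[ℝ] ℝ)}
    (h : energy X z = 1) : ‖(hamField X z).1‖ ≤ C := by
  refine (norm_sum_le _ _).trans ((Finset.sum_le_sum fun i _ => ?_).trans (hC.norm_le z.1))
  rw [norm_smul, Real.norm_eq_abs]
  exact mul_le_of_le_one_left (norm_nonneg _) (abs_momentum_frame_le_one h i)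

/-- The momentum equation is quadratic in `p`, but at unit energy one of the two factors is at most
one. The growth is therefore linear, as Grönwall's inequality requires. -/
theorem norm_hamField_snd_le {C : ℝ} (hC : FrameBound X C) {z : E × (E →L[ℝ] ℝ)}
    (h : energy X z = 1) : ‖(hamField X z).2‖ ≤ C * ‖z.2‖ := by
  have h1 : ∀ i, ‖momentum (X i) z • z.2.comp (fderiv ℝ (X i) z.1)‖ ≤
      ‖fderiv ℝ (X i) z.1‖ * ‖z.2‖ := fun i => by
    rw [norm_smul, Real.norm_eq_abs]
    refine (mul_le_of_le_one_left (norm_nonneg _) (abs_momentum_frame_le_one h i)).trans ?_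
    rw [mul_comm]
    exact ContinuousLinearMap.opNorm_comp_le _ _
  simp only [hamField, norm_neg]
  refine (norm_sum_le _ _).trans ((Finset.sum_le_sum fun i _ => h1 i).trans ?_)
  rw [← Finset.sum_mul]
  exact mul_le_mul_of_nonneg_right (hC.norm_fderiv_le _) (norm_nonneg _)

/-- Here `r` is the value of a cut-off factor along the curve. The bounds use only `0 ≤ r ≤ 1`, so
the radius of the cut-off can be chosen afterwards in terms of them. -/
theorem hamCurve_apriori (hX : ∀ i, Differentiable ℝ (X i)) {C : ℝ} (hC : FrameBound X C)
    {z : ℝ → E × (E →L[ℝ] ℝ)} {r : ℝ → ℝ} (hr : ∀ t, 0 ≤ r t ∧ r t ≤ 1)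
    (hz : ∀ t ∈ Icc (0 : ℝ) 1, HasDerivAt z (r t • hamField X (z t)) t)
    (h0 : energy X (z 0) = 1) {t : ℝ} (ht : t ∈ Icc (0 : ℝ) 1) :
    energy X (z t) = 1 ∧ ‖(z t).2‖ ≤ Real.exp C * ‖(z 0).2‖ ∧ ‖(z t).1 - (z 0).1‖ ≤ C * t := by
  have hz1 : ∀ s ∈ Icc (0 : ℝ) 1, HasDerivAt (fun s => (z s).1) (r s • hamField X (z s)).1 s :=
    fun s hs => (hz s hs).fst
  have hz2 : ∀ s ∈ Icc (0 : ℝ) 1, HasDerivAt (fun s => (z s).2) (r s • hamField X (z s)).2 s :=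
    fun s hs => (hz s hs).snd
  have hcont : ContinuousOn z (Icc 0 1) := fun s hs => (hz s hs).continuousAt.continuousWithinAt
  have hen : ∀ s ∈ Icc (0 : ℝ) 1, energy X (z s) = 1 := by
    intro s hs
    have := norm_image_sub_le_of_norm_deriv_le_segment' (f := fun s => energy X (z s))
      (f' := fun _ => 0) (a := 0) (b := 1) (C := 0)
      (fun x hx => (hasDerivAt_energy (hz x hx) hX).hasDerivWithinAt) (fun x _ => by simp) s hs
    simp only [zero_mul] at this
    rw [← h0, ← sub_eq_zero]
    exact norm_le_zero_iff.1 this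
  refine ⟨hen t ht, ?_, ?_⟩
  · have := norm_le_gronwallBound_of_norm_deriv_right_le (f := fun s => (z s).2)
      (f' := fun s => (r s • hamField X (z s)).2) (δ := ‖(z 0).2‖) (K := C) (ε := 0) (a := 0)
      (b := 1) hcont.snd
      (fun x hx => (hz2 x ⟨hx.1, hx.2.le⟩).hasDerivWithinAt) le_rfl
      (fun x hx => by
        rw [Prod.smul_snd, norm_smul, Real.norm_of_nonneg (hr x).1, add_zero]
        exact (mul_le_of_le_one_left (norm_nonneg _) (hr x).2).trans
          (norm_hamField_snd_le hC (hen x ⟨hx.1, hx.2.le⟩))) t ht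
    rw [gronwallBound_ε0, mul_comm] at this
    refine this.trans (mul_le_mul_of_nonneg_right ?_ (norm_nonneg _))
    rw [Real.exp_le_exp, sub_zero]
    exact mul_le_of_le_one_right hC.nonneg ht.2
  · have := norm_image_sub_le_of_norm_deriv_le_segment' (f := fun s => (z s).1)
      (f' := fun s => (r s • hamField X (z s)).1) (a := 0) (b := 1) (C := C)
      (fun x hx => (hz1 x hx).hasDerivWithinAt)
      (fun x hx => by
        rw [Prod.smul_fst, norm_smul, Real.norm_of_nonneg (hr x).1]
        exact (mul_le_of_le_one_left (norm_nonneg _) (hr x).2).trans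
          (norm_hamField_fst_le hC (hen x ⟨hx.1, hx.2.le⟩))) t ht
    simpa using this

theorem contDiff_hamField (hX : ∀ i, ContDiff ℝ ∞ (X i)) : ContDiff ℝ ∞ (hamField X) := by
  have hm : ∀ i, ContDiff ℝ ∞ (momentum (X i)) := fun i =>
    contDiff_snd.clm_apply ((hX i).comp contDiff_fst)
  refine ContDiff.prodMk (ContDiff.sum fun i _ => (hm i).smul ((hX i).comp contDiff_fst))
    (ContDiff.neg (ContDiff.sum fun i _ => (hm i).smul (contDiff_snd.clm_comp ?_)))
  exact ((hX i).fderiv_right (m := ∞) (by simp)).comp contDiff_fst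

/-- The Hamiltonian field multiplied by a cut-off function of the momentum agrees with the
Hamiltonian field for bounded momenta, and is bounded and Lipschitz. -/
theorem exists_truncation [FiniteDimensional ℝ E] (hX : ∀ i, ContDiff ℝ ∞ (X i)) (hc : ∀ i, HasCompactSupport (X i))
    (R : ℝ) (hR : 0 < R) :
    ∃ ρ : (E →L[ℝ] ℝ) → ℝ, (∀ p, 0 ≤ ρ p ∧ ρ p ≤ 1) ∧ (∀ p, ‖p‖ ≤ R → ρ p = 1) ∧
      (∃ L : NNReal, ∀ z, ‖ρ z.2 • hamField X z‖ ≤ L) ∧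
      ∃ K : NNReal, LipschitzWith K (fun z => ρ z.2 • hamField X z) := by
  let ρ : ContDiffBump (0 : E →L[ℝ] ℝ) := ⟨R, R + 1, hR, by linarith⟩
  have hsm : ContDiff ℝ 1 (fun z => ρ z.2 • hamField X z) :=
    (ρ.contDiff.comp contDiff_snd).smul ((contDiff_hamField hX).of_le (by simp))
  -- The frame bounds the support in the position, the cut-off bounds it in the momentum.
  have hcs : HasCompactSupport (fun z : E × (E →L[ℝ] ℝ) => ρ z.2 • hamField X z) := by
    refine HasCompactSupport.intro
      ((isCompact_iUnion fun i => (hc i).isCompact).prod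
        (isCompact_closedBall (0 : E →L[ℝ] ℝ) (R + 1))) (fun z hz => ?_)
    by_cases h2 : z.2 ∈ Metric.closedBall (0 : E →L[ℝ] ℝ) (R + 1)
    · have h1 : ∀ i, X i z.1 = 0 := fun i => by
        by_contra hne
        exact hz ⟨mem_iUnion.2 ⟨i, subset_tsupport _ hne⟩, h2⟩
      simp [hamField, momentum, h1]
    · have : ρ z.2 = 0 := ρ.zero_of_le_dist (by
        rw [Metric.mem_closedBall, not_le] at h2
        exact h2.le)
      simp [this]
  refine ⟨ρ, fun p => ⟨ρ.nonneg, ρ.le_one⟩, fun p hp => ρ.one_of_mem_closedBall (by simpa using hp),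
    ?_, hsm.lipschitzWith_of_hasCompactSupport hcs one_ne_zero⟩
  obtain ⟨L, hL⟩ := hsm.continuous.bounded_above_of_compact_support hcs
  exact ⟨L.toNNReal, fun z => (hL z).trans (Real.le_coe_toNNReal L)⟩

/-- `z` is a unit speed Hamiltonian curve with initial point `z₀`, with the bounds given by the
constant `C`. -/
structure IsHamCurve (X : Fin k → E → E) (C : ℝ) (z₀ : E × (E →L[ℝ] ℝ))
    (z : ℝ → E × (E →L[ℝ] ℝ)) : Prop where
  init : z 0 = z₀
  hasDerivAt : ∃ δ > 0, ∀ t ∈ Ioo (-δ) 1, HasDerivAt z (hamField X (z t)) t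
  energy_eq : ∀ t ∈ Ico (0 : ℝ) 1, energy X (z t) = 1
  norm_snd_le : ∀ t ∈ Ico (0 : ℝ) 1, ‖(z t).2‖ ≤ C * ‖z₀.2‖
  norm_fst_le : ∀ t ∈ Ico (0 : ℝ) 1, ‖(z t).1 - z₀.1‖ ≤ C * t

theorem IsHamCurve.hasDerivAt_of_mem {C : ℝ} {z₀ : E × (E →L[ℝ] ℝ)} {z : ℝ → E × (E →L[ℝ] ℝ)}
    (h : IsHamCurve X C z₀ z) {t : ℝ} (ht : t ∈ Ico (0 : ℝ) 1) :
    HasDerivAt z (hamField X (z t)) t := by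
  obtain ⟨δ, hδ, hd⟩ := h.hasDerivAt
  exact hd t ⟨by linarith [ht.1], ht.2⟩

/-- The truncated field is bounded and Lipschitz, so it has a solution on a fixed interval. By the a
priori bounds the cut-off is equal to one along this solution on `[0, 1]`. -/
theorem exists_isHamCurve [FiniteDimensional ℝ E] (hX : ∀ i, ContDiff ℝ ∞ (X i)) (hc : ∀ i, HasCompactSupport (X i))
    {C : ℝ} (hC : FrameBound X C) {z₀ : E × (E →L[ℝ] ℝ)} (h₀ : energy X z₀ = 1) :
    ∃ z, IsHamCurve X (max C (Real.exp C)) z₀ z := by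
  -- The first summand is the Grönwall bound on `[0, 1]`; the others put the initial momentum
  -- strictly inside the ball, which leaves room for small negative times.
  set R := Real.exp C * ‖z₀.2‖ + ‖z₀.2‖ + 1 with hRdef
  have hR : 0 < R := by positivity
  obtain ⟨ρ, hρ, hρ1, ⟨L, hL⟩, K, hK⟩ := exists_truncation hX hc R hR
  -- The radius `L * 2` is the speed bound times the half-length of the interval, so the length of
  -- the interval is no restriction.
  have hPL : IsPicardLindelof (fun _ : ℝ => fun z => ρ z.2 • hamField X z)
      (tmin := -2) (tmax := 2) ⟨0, by norm_num⟩ z₀ (L * 2) 0 L K := by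
    refine ⟨fun t _ => hK.lipschitzOnWith, fun z _ => continuousOn_const, fun t _ z _ => hL z, ?_⟩
    simp
  obtain ⟨z, hz0, hz⟩ := hPL.exists_eq_forall_mem_Icc_hasDerivWithinAt₀
  have hz' : ∀ t ∈ Ioo (-2 : ℝ) 2, HasDerivAt z (ρ (z t).2 • hamField X (z t)) t := fun t ht =>
    (hz t (Ioo_subset_Icc_self ht)).hasDerivAt (Icc_mem_nhds ht.1 ht.2)
  replace hz0 : z 0 = z₀ := hz0
  have hap := fun t (ht : t ∈ Icc (0 : ℝ) 1) => hamCurve_apriori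
    (fun i => (hX i).differentiable (by simp)) hC (r := fun t => ρ (z t).2) (fun t => hρ _)
    (fun t ht => hz' t ⟨by linarith [ht.1], by linarith [ht.2]⟩) (hz0 ▸ h₀) ht
  rw [hz0] at hap
  have hcont : ContinuousAt z 0 := (hz' 0 (by norm_num)).continuousAt
  -- The a priori bounds concern `t ≥ 0`. For small negative times continuity keeps the momentum
  -- below `R`; an open interval around `0` is needed for integral curves.
  have hnear : ∀ᶠ t in 𝓝 (0 : ℝ), ‖(z t).2‖ < R := by
    refine (hcont.snd.norm.eventually_lt_const (u := R) ?_)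
    have : 0 ≤ Real.exp C * ‖z₀.2‖ := by positivity
    simp only [hz0]
    linarith
  obtain ⟨δ, hδ, hδR⟩ := Metric.eventually_nhds_iff.1 hnear
  refine ⟨z, hz0, ⟨min δ 1, by positivity, fun t ht => ?_⟩, fun t ht => (hap t ⟨ht.1, ht.2.le⟩).1,
    fun t ht => ((hap t ⟨ht.1, ht.2.le⟩).2.1).trans ?_,
    fun t ht => ((hap t ⟨ht.1, ht.2.le⟩).2.2).trans ?_⟩
  · have ht1 : -1 < t := lt_of_le_of_lt (by simp) ht.1
    have hd := hz' t ⟨by linarith, by linarith [ht.2]⟩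
    have : ‖(z t).2‖ ≤ R := by
      rcases lt_or_ge t 0 with hneg | hpos
      · refine (hδR ?_).le
        rw [Real.dist_eq, sub_zero, abs_of_neg hneg]
        linarith [ht.1, min_le_left δ 1]
      · have := (hap t ⟨hpos, ht.2.le⟩).2.1
        have h2 := norm_nonneg z₀.2
        linarith
    rwa [hρ1 _ this, one_smul] at hd
  · exact mul_le_mul_of_nonneg_right (le_max_right _ _) (norm_nonneg _)
  · exact mul_le_mul_of_nonneg_right (le_max_left _ _) ht.1

/-- Curves with nearby initial points have their momenta in one common ball, where the field
coincides with a globally Lipschitz one. Grönwall's inequality then bounds their distance. -/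
theorem continuousOn_hamCurve [FiniteDimensional ℝ E] (hX : ∀ i, ContDiff ℝ ∞ (X i)) (hc : ∀ i, HasCompactSupport (X i))
    {C : ℝ} (hC0 : 0 ≤ C) {Z : E × (E →L[ℝ] ℝ) → ℝ → E × (E →L[ℝ] ℝ)}
    {A : Set (E × (E →L[ℝ] ℝ))} (hZ : ∀ z₀ ∈ A, IsHamCurve X C z₀ (Z z₀)) {t : ℝ}
    (ht : t ∈ Ico (0 : ℝ) 1) : ContinuousOn (fun z₀ => Z z₀ t) A := by
  intro z₀ hz₀
  set R := C * (‖z₀.2‖ + 1) + 1 with hRdef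
  have hR : 0 < R := by positivity
  obtain ⟨ρ, hρ, hρ1, -, K, hK⟩ := exists_truncation hX hc R hR
  have hLip : LipschitzOnWith K (hamField X) {z | ‖z.2‖ ≤ R} := by
    intro z hz w hw
    have := hK z w
    simpa only [hρ1 _ hz, hρ1 _ hw, one_smul] using this
  have hmem : ∀ w ∈ A, ‖w.2‖ ≤ ‖z₀.2‖ + 1 → ∀ s ∈ Ico (0 : ℝ) t, ‖(Z w s).2‖ ≤ R := by
    intro w hw hwn s hs
    refine ((hZ w hw).norm_snd_le s ⟨hs.1, hs.2.trans ht.2⟩).trans ?_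
    have := mul_le_mul_of_nonneg_left hwn hC0
    linarith
  have hder : ∀ w ∈ A, ∀ s ∈ Icc (0 : ℝ) t, HasDerivAt (Z w) (hamField X (Z w s)) s :=
    fun w hw s hs => (hZ w hw).hasDerivAt_of_mem ⟨hs.1, hs.2.trans_lt ht.2⟩
  have hdist : ∀ᶠ w in 𝓝[A] z₀, dist (Z w t) (Z z₀ t) ≤ dist w z₀ * Real.exp (K * (t - 0)) := by
    have hev : ∀ᶠ w : E × (E →L[ℝ] ℝ) in 𝓝[A] z₀, ‖w.2‖ < ‖z₀.2‖ + 1 :=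
      (continuous_snd.norm.tendsto z₀).eventually_lt_const (by simp) |>.filter_mono inf_le_left
    filter_upwards [hev, self_mem_nhdsWithin] with w hw hwA
    refine dist_le_of_trajectories_ODE_of_mem (v := fun _ => hamField X) (s := fun _ => {z | ‖z.2‖ ≤ R})
      (fun _ _ => hLip)
      (fun s hs => (hder w hwA s hs).continuousAt.continuousWithinAt)
      (fun s hs => (hder w hwA s ⟨hs.1, hs.2.le⟩).hasDerivWithinAt) (hmem w hwA hw.le)
      (fun s hs => (hder z₀ hz₀ s hs).continuousAt.continuousWithinAt)
      (fun s hs => (hder z₀ hz₀ s ⟨hs.1, hs.2.le⟩).hasDerivWithinAt) (hmem z₀ hz₀ (by simp))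
      ?_ t ⟨ht.1, le_rfl⟩
    rw [(hZ w hwA).init, (hZ z₀ hz₀).init]
  rw [ContinuousWithinAt, tendsto_iff_dist_tendsto_zero]
  refine squeeze_zero' (Eventually.of_forall fun _ => dist_nonneg) hdist ?_
  have : Tendsto (fun w => dist w z₀ * Real.exp (K * (t - 0))) (𝓝[A] z₀)
      (𝓝 (dist z₀ z₀ * Real.exp (K * (t - 0)))) :=
    ((continuous_id.dist continuous_const).mul continuous_const).continuousWithinAt
  simpa using this

/-! ### Second order Taylor expansion along Hamiltonian curves -/

/-- The first derivative of a function along Hamiltonian curves. -/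
def firstDeriv (X : Fin k → E → E) (f : E → ℝ) (z : E × (E →L[ℝ] ℝ)) : ℝ :=
  ∑ i, momentum (X i) z * frameDeriv X i f z.1

/-- The second derivative of a function along Hamiltonian curves. -/
def secondDeriv (X : Fin k → E → E) (f : E → ℝ) (z : E × (E →L[ℝ] ℝ)) : ℝ :=
  ∑ i, ∑ j, (momentum (X j) z * momentum (VectorField.lieBracket ℝ (X j) (X i)) z *
      frameDeriv X i f z.1 +
    momentum (X j) z * momentum (X i) z * frameDeriv X j (frameDeriv X i f) z.1)

theorem exists_abs_momentum_le (W : E → E) (hW : Continuous W) (hc : HasCompactSupport W) :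
    ∃ K, 0 ≤ K ∧ ∀ z, |momentum W z| ≤ K * ‖z.2‖ := by
  obtain ⟨K, hK⟩ := hW.bounded_above_of_compact_support hc
  refine ⟨K, (norm_nonneg _).trans (hK 0), fun z => ?_⟩
  rw [mul_comm]
  exact (z.2.le_opNorm _).trans (mul_le_mul_of_nonneg_left (hK _) (norm_nonneg _))

theorem contDiff_frameDeriv (hX : ∀ i, ContDiff ℝ ∞ (X i)) {u : E → ℝ} (hu : ContDiff ℝ ∞ u)
    (i : Fin k) : ContDiff ℝ ∞ (frameDeriv X i u) :=
  (hu.fderiv_right (m := ∞) (by simp)).clm_apply (hX i)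

theorem hasCompactSupport_frameDeriv {u : E → ℝ} (hu : HasCompactSupport u)
    (i : Fin k) : HasCompactSupport (frameDeriv X i u) :=
  (hu.fderiv ℝ).mono' fun x hx => subset_tsupport _ fun h => hx (by simp [frameDeriv, h])

theorem contDiff_lieBracket {V W : E → E} (hV : ContDiff ℝ ∞ V) (hW : ContDiff ℝ ∞ W) :
    ContDiff ℝ ∞ (VectorField.lieBracket ℝ V W) :=
  ((hW.fderiv_right (m := ∞) (by simp)).clm_apply hV).sub
    ((hV.fderiv_right (m := ∞) (by simp)).clm_apply hW)

theorem hasCompactSupport_lieBracket {V W : E → E} (hV : HasCompactSupport V) :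
    HasCompactSupport (VectorField.lieBracket ℝ V W) := by
  refine hV.mono' fun x hx => ?_
  by_contra h
  refine hx ?_
  have h0 : V x = 0 := image_eq_zero_of_notMem_tsupport h
  have h1 : fderiv ℝ V x = 0 := by
    refine image_eq_zero_of_notMem_tsupport fun hx => h (tsupport_fderiv_subset ℝ hx)
  simp [VectorField.lieBracket, h0, h1]

/-- The products considered are the summands of `secondDeriv`. Differentiating `momentum (X j)` or
`momentum W` yields at most one more factor linear in `p`, since the coefficients `momentum (X i)`
are bounded by one. The outcome is at most quadratic in the momentum, which is why square
integrability of the measures is enough. -/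
theorem exists_deriv_momentum_mul_le (hX : ∀ i, ContDiff ℝ ∞ (X i))
    (hc : ∀ i, HasCompactSupport (X i)) (C : ℝ) (hC : 0 ≤ C) (j : Fin k) {W : E → E}
    (hW : ContDiff ℝ ∞ W) (hWc : HasCompactSupport W) {a : E → ℝ} (ha : ContDiff ℝ ∞ a)
    (hac : HasCompactSupport a) :
    ∃ B, ∀ z₀ z, IsHamCurve X C z₀ z → ∀ t ∈ Ico (0 : ℝ) 1, ∃ d,
      HasDerivAt (fun s => momentum (X j) (z s) * momentum W (z s) * a (z s).1) d t ∧
      |d| ≤ B * (1 + ‖z₀.2‖ ^ 2) := by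
  obtain ⟨A, hA⟩ := ha.continuous.bounded_above_of_compact_support hac
  obtain ⟨K, hK0, hK⟩ := exists_abs_momentum_le W hW.continuous hWc
  choose A' hA' using fun i => (contDiff_frameDeriv hX ha i).continuous.bounded_above_of_compact_support
    (hasCompactSupport_frameDeriv hac i)
  choose K₁ hK₁0 hK₁ using fun i => exists_abs_momentum_le (VectorField.lieBracket ℝ (X i) (X j))
    (contDiff_lieBracket (hX i) (hX j)).continuous (hasCompactSupport_lieBracket (hc i))
  choose K₂ hK₂0 hK₂ using fun i => exists_abs_momentum_le (VectorField.lieBracket ℝ (X i) W)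
    (contDiff_lieBracket (hX i) hW).continuous (hasCompactSupport_lieBracket (hc i))
  have hA0 : 0 ≤ A := (norm_nonneg _).trans (hA 0)
  have hA'0 : ∀ i, 0 ≤ A' i := fun i => (norm_nonneg _).trans (hA' i 0)
  set S₁ := ∑ i, K₁ i with hS₁
  set S₂ := ∑ i, K₂ i with hS₂
  set S₃ := ∑ i, A' i with hS₃
  have hS₁0 : 0 ≤ S₁ := Finset.sum_nonneg fun i _ => hK₁0 i
  have hS₂0 : 0 ≤ S₂ := Finset.sum_nonneg fun i _ => hK₂0 i
  have hS₃0 : 0 ≤ S₃ := Finset.sum_nonneg fun i _ => hA'0 i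
  -- One summand for each term of the product rule: only the derivative of `momentum (X j)` produces
  -- a quadratic term.
  refine ⟨S₁ * C * (K * C) * A + S₂ * C * A + K * C * S₃, fun z₀ z hz t ht => ?_⟩
  have hd := hz.hasDerivAt_of_mem ht
  have hd' : HasDerivAt z ((1 : ℝ) • hamField X (z t)) t := by rwa [one_smul]
  have h1 := hasDerivAt_momentum hd' ((hX j).differentiable (by simp))
  have h2 := hasDerivAt_momentum hd' (hW.differentiable (by simp))
  have h3 := hasDerivAt_comp_fst hd (ha.differentiable (by simp))
  refine ⟨_, (h1.mul h2).mul h3, ?_⟩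
  have hen := hz.energy_eq t ht
  have hp := hz.norm_snd_le t ht
  set P := ‖z₀.2‖ with hP
  have hP0 : 0 ≤ P := norm_nonneg _
  have hsum : ∀ (g : Fin k → ℝ) (b : Fin k → ℝ), (∀ i, |g i| ≤ b i) →
      |∑ i, momentum (X i) (z t) * g i| ≤ ∑ i, b i := fun g b hg =>
    (Finset.abs_sum_le_sum_abs _ _).trans (Finset.sum_le_sum fun i _ => by
      rw [abs_mul]
      exact (mul_le_of_le_one_left (abs_nonneg _) (abs_momentum_frame_le_one hen i)).trans (hg i))
  have b1 := hsum _ (fun i => K₁ i * (C * P)) fun i =>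
    (hK₁ i (z t)).trans (mul_le_mul_of_nonneg_left hp (hK₁0 i))
  have b2 := hsum _ (fun i => K₂ i * (C * P)) fun i =>
    (hK₂ i (z t)).trans (mul_le_mul_of_nonneg_left hp (hK₂0 i))
  have b3 := hsum _ A' fun i => (hA' i (z t).1)
  rw [← Finset.sum_mul] at b1 b2
  have b4 := abs_momentum_frame_le_one hen j
  have b5 := (hK (z t)).trans (mul_le_mul_of_nonneg_left hp hK0)
  have b6 : |a (z t).1| ≤ A := hA _
  simp only [one_mul, Pi.mul_apply]
  set d1 := ∑ i, momentum (X i) (z t) * momentum (VectorField.lieBracket ℝ (X i) (X j)) (z t)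
  set d2 := ∑ i, momentum (X i) (z t) * momentum (VectorField.lieBracket ℝ (X i) W) (z t)
  set d3 := ∑ i, momentum (X i) (z t) * frameDeriv X i a (z t).1
  set m := momentum (X j) (z t)
  set w := momentum W (z t)
  have e1 : |d1 * w * a (z t).1| ≤ S₁ * (C * P) * (K * (C * P)) * A := by
    rw [abs_mul, abs_mul]; gcongr
  have e2 : |m * d2 * a (z t).1| ≤ 1 * (S₂ * (C * P)) * A := by
    rw [abs_mul, abs_mul]; gcongr
  have e3 : |m * w * d3| ≤ 1 * (K * (C * P)) * S₃ := by
    rw [abs_mul, abs_mul]; gcongr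
  have hPle : P ≤ 1 + P ^ 2 := by nlinarith [sq_nonneg (P - 1)]
  have hP2 : P ^ 2 ≤ 1 + P ^ 2 := by linarith
  calc |(d1 * w + m * d2) * a (z t).1 + m * w * d3|
      = |d1 * w * a (z t).1 + m * d2 * a (z t).1 + m * w * d3| := by ring_nf
    _ ≤ S₁ * (C * P) * (K * (C * P)) * A + 1 * (S₂ * (C * P)) * A + 1 * (K * (C * P)) * S₃ :=
        (abs_add_le _ _).trans (add_le_add ((abs_add_le _ _).trans (add_le_add e1 e2)) e3)
    _ = S₁ * C * (K * C) * A * P ^ 2 + S₂ * C * A * P + K * C * S₃ * P := by ring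
    _ ≤ S₁ * C * (K * C) * A * (1 + P ^ 2) + S₂ * C * A * (1 + P ^ 2) +
          K * C * S₃ * (1 + P ^ 2) := by gcongr
    _ = _ := by ring

theorem hamCurve_taylor (hX : ∀ i, ContDiff ℝ ∞ (X i))
    (hc : ∀ i, HasCompactSupport (X i)) (C : ℝ) (hC : 0 ≤ C) {f : E → ℝ}
    (hf : ContDiff ℝ ∞ f) (hfc : HasCompactSupport f) :
    ∃ B, ∀ z₀ z, IsHamCurve X C z₀ z → ∀ t ∈ Ico (0 : ℝ) 1,
      |f (z t).1 - f z₀.1 - t * firstDeriv X f z₀ - t ^ 2 / 2 * secondDeriv X f z₀| ≤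
        B * (1 + ‖z₀.2‖ ^ 2) * t ^ 3 := by
  have hdf := fun i => contDiff_frameDeriv hX hf i
  have hdfc := fun i => hasCompactSupport_frameDeriv (X := X) hfc i
  -- The two kinds of summands of `secondDeriv`: `W = [X_j, X_i]` with `a = X_i f`, and `W = X_i`
  -- with `a = X_j X_i f`.
  choose B₁ hB₁ using fun i j => exists_deriv_momentum_mul_le hX hc C hC j
    (contDiff_lieBracket (hX j) (hX i)) (hasCompactSupport_lieBracket (hc j)) (hdf i) (hdfc i)
  choose B₂ hB₂ using fun i j => exists_deriv_momentum_mul_le hX hc C hC j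
    (hX i) (hc i) (contDiff_frameDeriv hX (hdf i) j) (hasCompactSupport_frameDeriv (X := X) (hdfc i) j)
  refine ⟨∑ i, ∑ j, (B₁ i j + B₂ i j), fun z₀ z hz t ht => ?_⟩
  choose! d₁ hd₁ hb₁ using fun i j => hB₁ i j z₀ z hz
  choose! d₂ hd₂ hb₂ using fun i j => hB₂ i j z₀ z hz
  have hmain := abs_sub_taylor_two_le (g := fun s => f (z s).1) (g₁ := fun s => firstDeriv X f (z s))
    (g₂ := fun s => secondDeriv X f (z s)) (g₃ := fun s => ∑ i, ∑ j, (d₁ i j s + d₂ i j s))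
    (B := (∑ i, ∑ j, (B₁ i j + B₂ i j)) * (1 + ‖z₀.2‖ ^ 2))
    (fun s hs => hasDerivAt_comp_fst (hz.hasDerivAt_of_mem hs) (hf.differentiable (by simp)))
    (fun s hs => ?_)
    (fun s hs => HasDerivAt.fun_sum fun i _ => HasDerivAt.fun_sum fun j _ =>
      (hd₁ i j s hs).add (hd₂ i j s hs))
    (fun s hs => ?_) ht
  · simpa only [hz.init] using hmain
  · have hd := hz.hasDerivAt_of_mem hs
    have hd' : HasDerivAt z ((1 : ℝ) • hamField X (z s)) s := by rwa [one_smul]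
    have := HasDerivAt.fun_sum (u := Finset.univ)
      (A := fun i s => momentum (X i) (z s) * frameDeriv X i f (z s).1)
      fun i _ => (hasDerivAt_momentum hd' ((hX i).differentiable (by simp))).mul
        (hasDerivAt_comp_fst hd ((hdf i).differentiable (by simp)))
    refine this.congr_deriv (Finset.sum_congr rfl fun i _ => ?_)
    rw [one_mul, Finset.sum_mul, Finset.mul_sum, ← Finset.sum_add_distrib]
    exact Finset.sum_congr rfl fun j _ => by ring
  · refine (Finset.abs_sum_le_sum_abs _ _).trans ?_
    rw [Finset.sum_mul]
    refine Finset.sum_le_sum fun i _ => (Finset.abs_sum_le_sum_abs _ _).trans ?_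
    rw [Finset.sum_mul]
    refine Finset.sum_le_sum fun j _ => (abs_add_le _ _).trans ?_
    rw [add_mul]
    exact add_le_add (hb₁ i j s hs) (hb₂ i j s hs)

end VectorSpace

/-! ### Canonical coordinates of the cotangent bundle -/

section CotangentCoordinates

variable {n : ℕ} {M : Type*} [TopologicalSpace M]
  [ChartedSpace (EuclideanSpace ℝ (Fin n)) M] [IsManifold (𝓡 n) ∞ M]

/-- The canonical chart of the cotangent bundle induced by the chart of `M` at `q₀`. -/
def cotChart (q₀ : M) : PartialEquiv (CotBundle n M)
    (EuclideanSpace ℝ (Fin n) × (EuclideanSpace ℝ (Fin n) →L[ℝ] ℝ)) :=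
  extChartAt (cotModel n) (⟨q₀, 0⟩ : CotBundle n M)

theorem mfderivWithin_extChartAt_symm_eq_inverse {q₀ q : M}
    (hq : q ∈ (extChartAt (𝓡 n) q₀).source) :
    mfderivWithin 𝓘(ℝ, EuclideanSpace ℝ (Fin n)) (𝓡 n) (extChartAt (𝓡 n) q₀).symm
      (range (𝓡 n)) (extChartAt (𝓡 n) q₀ q) =
    (mfderiv (𝓡 n) 𝓘(ℝ, EuclideanSpace ℝ (Fin n)) (extChartAt (𝓡 n) q₀) q).inverse :=
  (ContinuousLinearMap.inverse_eq (mfderiv_extChartAt_comp_mfderivWithin_extChartAt_symm' hq)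
    (mfderivWithin_extChartAt_symm_comp_mfderiv_extChartAt' hq)).symm

theorem inverse_mfderiv_extChartAt_apply {q₀ q : M} (hq : q ∈ (extChartAt (𝓡 n) q₀).source)
    (v : TangentSpace (𝓡 n) q) :
    (mfderiv (𝓡 n) 𝓘(ℝ, EuclideanSpace ℝ (Fin n)) (extChartAt (𝓡 n) q₀) q).inverse
      (mfderiv (𝓡 n) 𝓘(ℝ, EuclideanSpace ℝ (Fin n)) (extChartAt (𝓡 n) q₀) q v) = v := by
  obtain ⟨e, he⟩ := isInvertible_mfderiv_extChartAt (I := 𝓡 n) hq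
  rw [← he, ContinuousLinearMap.inverse_equiv]
  exact e.symm_apply_apply v

theorem cotChart_source (q₀ : M) :
    (cotChart q₀ : PartialEquiv (CotBundle n M) _).source =
      {z | z.proj ∈ (extChartAt (𝓡 n) q₀).source} := by
  ext z
  simp only [cotChart, extChartAt_source, FiberBundle.chartedSpace_chartAt,
    OpenPartialHomeomorph.trans_source, mem_inter_iff, mem_preimage, mem_ofPred_eq]
  constructor
  · rintro ⟨h1, h2⟩
    rw [OpenPartialHomeomorph.prod_source] at h2
    have h3 := h2.1
    rwa [Trivialization.coe_coe, Trivialization.coe_fst _ h1] at h3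
  · intro h
    have h1 : z ∈ (trivializationAt (EuclideanSpace ℝ (Fin n) →L[ℝ] ℝ)
        (fun q : M => CotSpace n q) q₀).source := by
      rw [Trivialization.mem_source]
      simpa using h
    refine ⟨h1, ?_⟩
    rw [OpenPartialHomeomorph.prod_source]
    refine ⟨?_, mem_univ _⟩
    rwa [Trivialization.coe_coe, Trivialization.coe_fst _ h1]

theorem cotChart_target (q₀ : M) :
    (cotChart q₀ : PartialEquiv (CotBundle n M) _).target = (extChartAt (𝓡 n) q₀).target ×ˢ univ := by
  rw [cotChart, FiberBundle.extChartAt_target]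
  congr 1
  rw [inter_eq_left]
  intro y hy
  have := (extChartAt (𝓡 n) q₀).map_target hy
  rw [extChartAt_source] at this
  simpa using this

/-- The trivialization of the bundle of linear maps composes a covector with the inverse of the
tangent trivialization, which is the inverse derivative of the chart. So the bundle chart gives the
classical coordinates `(x, p)`. -/
theorem cotChart_apply {q₀ : M} {z : CotBundle n M}
    (hz : z.proj ∈ (extChartAt (𝓡 n) q₀).source) :
    cotChart q₀ z = (coordX q₀ z, coordP q₀ z) := by
  have hz' : z.proj ∈ (chartAt (EuclideanSpace ℝ (Fin n)) q₀).source := by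
    rwa [extChartAt_source] at hz
  simp only [cotChart, extChartAt, OpenPartialHomeomorph.extend, PartialEquiv.coe_trans,
    Function.comp, OpenPartialHomeomorph.coe_toPartialEquiv, hom_chart]
  refine Prod.ext rfl ?_
  simp only [coordP, ← mfderivWithin_extChartAt_symm_eq_inverse hz]
  rw [← TangentBundle.symmL_trivializationAt hz']
  change ContinuousLinearMap.inCoordinates _ _ _ _ _ _ _ _ _ = _
  simp only [ContinuousLinearMap.inCoordinates]
  ext v
  simp

theorem proj_cotChart_symm {q₀ : M} {w : EuclideanSpace ℝ (Fin n) × (EuclideanSpace ℝ (Fin n) →L[ℝ] ℝ)}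
    (hw : w.1 ∈ (extChartAt (𝓡 n) q₀).target) :
    ((cotChart q₀ : PartialEquiv (CotBundle n M) _).symm w).proj = (extChartAt (𝓡 n) q₀).symm w.1 := by
  have hw' : w ∈ (cotChart q₀ : PartialEquiv (CotBundle n M) _).target := by
    rw [cotChart_target]; exact ⟨hw, mem_univ _⟩
  have h1 := (cotChart q₀ : PartialEquiv (CotBundle n M) _).map_target hw'
  rw [cotChart_source] at h1
  have h2 := (cotChart q₀ : PartialEquiv (CotBundle n M) _).right_inv hw'
  rw [cotChart_apply h1] at h2
  have h3 : extChartAt (𝓡 n) q₀ ((cotChart q₀ : PartialEquiv (CotBundle n M) _).symm w).proj = w.1 :=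
    congrArg Prod.fst h2
  rw [← h3]
  exact ((extChartAt (𝓡 n) q₀).left_inv h1).symm

/-- The local coordinate expression of a vector field in the chart at `q₀`. -/
def localField (q₀ : M) (X : Π q : M, TangentSpace (𝓡 n) q) :
    EuclideanSpace ℝ (Fin n) → EuclideanSpace ℝ (Fin n) :=
  VectorField.mpullbackWithin 𝓘(ℝ, EuclideanSpace ℝ (Fin n)) (𝓡 n) (extChartAt (𝓡 n) q₀).symm X
    (range (𝓡 n))

theorem localField_apply {q₀ q : M} (hq : q ∈ (extChartAt (𝓡 n) q₀).source)
    (X : Π q : M, TangentSpace (𝓡 n) q) :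
    localField q₀ X (extChartAt (𝓡 n) q₀ q) =
      mfderiv (𝓡 n) 𝓘(ℝ, EuclideanSpace ℝ (Fin n)) (extChartAt (𝓡 n) q₀) q (X q) := by
  have h := ContinuousLinearMap.inverse_eq
    (mfderivWithin_extChartAt_symm_comp_mfderiv_extChartAt' hq)
    (mfderiv_extChartAt_comp_mfderivWithin_extChartAt_symm' hq)
  have h2 : ∀ A : EuclideanSpace ℝ (Fin n) →L[ℝ] EuclideanSpace ℝ (Fin n), ∀ q', q' = q →
      A (X q') = A (X q) := by
    rintro A q' rfl
    rfl
  exact (h2 _ _ ((extChartAt (𝓡 n) q₀).left_inv hq)).trans (DFunLike.congr_fun h _)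

/-- The fibre component of `X` in the tangent trivialization at `q₀` is the derivative of the chart
applied to `X`, that is the coordinate expression. -/
theorem contDiffOn_localField {q₀ : M} {U : Set M} (hU : IsOpen U)
    {X : Π q : M, TangentSpace (𝓡 n) q} (hX : SmoothFieldOn X U) :
    ContDiffOn ℝ ∞ (localField q₀ X)
      ((extChartAt (𝓡 n) q₀).target ∩ (extChartAt (𝓡 n) q₀).symm ⁻¹' U) := by
  set e := trivializationAt (EuclideanSpace ℝ (Fin n)) (TangentSpace (𝓡 n) : M → Type _) q₀
  have hbase : e.baseSet = (extChartAt (𝓡 n) q₀).source := by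
    rw [extChartAt_source]; rfl
  have hV : IsOpen (U ∩ (extChartAt (𝓡 n) q₀).source) := hU.inter (isOpen_extChartAt_source q₀)
  have h1 : ContMDiffOn (𝓡 n) 𝓘(ℝ, EuclideanSpace ℝ (Fin n)) ∞ (fun q => (e ⟨q, X q⟩).2)
      (U ∩ (extChartAt (𝓡 n) q₀).source) :=
    (e.contMDiffOn_section_iff hV (hbase ▸ inter_subset_right)).1 (hX.mono inter_subset_left)
  have h2 := h1.comp ((contMDiffOn_extChartAt_symm (I := 𝓡 n) (n := ∞) q₀).mono
    (inter_subset_left (t := (extChartAt (𝓡 n) q₀).symm ⁻¹' U)))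
    (fun y hy => ⟨hy.2, (extChartAt (𝓡 n) q₀).map_target hy.1⟩)
  refine (contMDiffOn_iff_contDiffOn.1 h2).congr fun y hy => ?_
  have hs := (extChartAt (𝓡 n) q₀).map_target hy.1
  have h3 := localField_apply hs X
  rw [(extChartAt (𝓡 n) q₀).right_inv hy.1] at h3
  rw [h3, Function.comp]
  have hs' : (extChartAt (𝓡 n) q₀).symm y ∈ (chartAt (EuclideanSpace ℝ (Fin n)) q₀).source := by
    rwa [extChartAt_source] at hs
  rw [← TangentBundle.continuousLinearMapAt_trivializationAt hs']
  exact congrFun (e.coe_linearMapAt_of_mem (R := ℝ) (hbase ▸ hs)) _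

/-- The derivative of the chart and its inverse cancel in the pairing. This turns the Hamiltonian on
the manifold into the energy of the coordinate frame. -/
theorem momentum_localField {q₀ : M} {z : CotBundle n M}
    (hz : z.proj ∈ (extChartAt (𝓡 n) q₀).source) (X : Π q : M, TangentSpace (𝓡 n) q) :
    momentum (localField q₀ X) (cotChart q₀ z) = z.2 (X z.proj) := by
  rw [cotChart_apply hz]
  simp only [momentum, coordX, coordP]
  rw [localField_apply hz]
  exact congrArg z.2 (inverse_mfderiv_extChartAt_apply hz (X z.proj))

theorem contMDiffAt_cotChart {q₀ : M} {z : CotBundle n M}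
    (hz : z.proj ∈ (extChartAt (𝓡 n) q₀).source) :
    ContMDiffAt (cotModel n)
      𝓘(ℝ, EuclideanSpace ℝ (Fin n) × (EuclideanSpace ℝ (Fin n) →L[ℝ] ℝ)) ∞ (cotChart q₀) z := by
  refine contMDiffAt_extChartAt' ?_
  have : z ∈ (cotChart q₀ : PartialEquiv (CotBundle n M) _).source := by
    rw [cotChart_source]; exact hz
  rwa [cotChart, extChartAt_source] at this

/-- The differential of the canonical coordinates of the chart at `q₀`. -/
def cotDeriv (q₀ : M) (z : CotBundle n M) : TangentSpace (cotModel n) z →L[ℝ]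
    (EuclideanSpace ℝ (Fin n) × (EuclideanSpace ℝ (Fin n) →L[ℝ] ℝ)) :=
  mfderiv (cotModel n) 𝓘(ℝ, EuclideanSpace ℝ (Fin n) × (EuclideanSpace ℝ (Fin n) →L[ℝ] ℝ))
    (cotChart q₀) z

theorem hasMFDerivAt_cotChart {q₀ : M} {z : CotBundle n M}
    (hz : z.proj ∈ (extChartAt (𝓡 n) q₀).source) :
    HasMFDerivAt (cotModel n)
      𝓘(ℝ, EuclideanSpace ℝ (Fin n) × (EuclideanSpace ℝ (Fin n) →L[ℝ] ℝ)) (cotChart q₀) z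
      (cotDeriv q₀ z) :=
  ((contMDiffAt_cotChart hz).mdifferentiableAt (by simp)).hasMFDerivAt

theorem eventually_proj_mem {z : CotBundle n M} {s : Set M} (hs : IsOpen s) (hz : z.proj ∈ s) :
    ∀ᶠ z' in 𝓝 z, z'.proj ∈ s :=
  (FiberBundle.continuous_proj (EuclideanSpace ℝ (Fin n) →L[ℝ] ℝ)
    (fun q : M => CotSpace n q)).continuousAt.eventually (hs.mem_nhds hz)

theorem cotDeriv_surjective {q₀ : M} {z : CotBundle n M}
    (hz : z.proj ∈ (extChartAt (𝓡 n) q₀).source) : Function.Surjective (cotDeriv q₀ z) := by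
  have : z ∈ (cotChart q₀ : PartialEquiv (CotBundle n M) _).source := by
    rw [cotChart_source]; exact hz
  obtain ⟨e, he⟩ := isInvertible_mfderiv_extChartAt (I := cotModel n) this
  intro w
  refine ⟨e.symm w, ?_⟩
  change (mfderiv (cotModel n) _ _ z) _ = w
  rw [cotChart, ← he]
  exact e.apply_symm_apply w

theorem cotDeriv_injective {q₀ : M} {z : CotBundle n M}
    (hz : z.proj ∈ (extChartAt (𝓡 n) q₀).source) : Function.Injective (cotDeriv q₀ z) := by
  have : z ∈ (cotChart q₀ : PartialEquiv (CotBundle n M) _).source := by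
    rw [cotChart_source]; exact hz
  obtain ⟨e, he⟩ := isInvertible_mfderiv_extChartAt (I := cotModel n) this
  change Function.Injective (mfderiv (cotModel n) _ _ z)
  rw [cotChart, ← he]
  exact e.injective

theorem dX_eq (z : CotBundle n M) (ξ : TangentSpace (cotModel n) z) :
    dX z ξ = (cotDeriv z.proj z ξ).1 := by
  have hz := mem_extChartAt_source (I := 𝓡 n) z.proj
  have h := ((contDiff_fst (𝕜 := ℝ) (n := 1)).differentiable one_ne_zero _).hasFDerivAt.hasMFDerivAt.comp z
    (hasMFDerivAt_cotChart hz)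
  have h2 : HasMFDerivAt (cotModel n) 𝓘(ℝ, EuclideanSpace ℝ (Fin n)) (coordX z.proj) z _ :=
    h.congr_of_eventuallyEq (by
      filter_upwards [eventually_proj_mem (isOpen_extChartAt_source z.proj) hz] with z' hz'
      simp [cotChart_apply hz'])
  rw [dX, h2.mfderiv]
  simp only [fderiv_fst]
  rfl

theorem dP_eq (z : CotBundle n M) (ξ : TangentSpace (cotModel n) z) :
    dP z ξ = (cotDeriv z.proj z ξ).2 := by
  have hz := mem_extChartAt_source (I := 𝓡 n) z.proj
  have h := ((contDiff_snd (𝕜 := ℝ) (n := 1)).differentiable one_ne_zero _).hasFDerivAt.hasMFDerivAt.comp z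
    (hasMFDerivAt_cotChart hz)
  have h2 : HasMFDerivAt (cotModel n) 𝓘(ℝ, EuclideanSpace ℝ (Fin n) →L[ℝ] ℝ) (coordP z.proj) z _ :=
    h.congr_of_eventuallyEq (by
      filter_upwards [eventually_proj_mem (isOpen_extChartAt_source z.proj) hz] with z' hz'
      simp [cotChart_apply hz'])
  rw [dP, h2.mfderiv]
  simp only [fderiv_snd]
  rfl

/-- The canonical symplectic form of `E × E*`. -/
def stdSympl {E : Type*} [NormedAddCommGroup E] [NormedSpace ℝ E] (ξ η : E × (E →L[ℝ] ℝ)) : ℝ :=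
  ξ.2 η.1 - η.2 ξ.1

/-- A cotangent lift is symplectic. Its momentum part is described by `p' ∘ Dτ = p`, which avoids
differentiating an inverse. -/
theorem stdSympl_fderiv_of_cotangent_lift {E : Type*} [NormedAddCommGroup E] [NormedSpace ℝ E]
    {κ : E × (E →L[ℝ] ℝ) → E × (E →L[ℝ] ℝ)} {τ : E → E} {w : E × (E →L[ℝ] ℝ)}
    (hτ : ContDiffAt ℝ 2 τ w.1) (hκ : DifferentiableAt ℝ κ w)
    (h1 : ∀ᶠ y in 𝓝 w, (κ y).1 = τ y.1)
    (h2 : ∀ᶠ y in 𝓝 w, (κ y).2.comp (fderiv ℝ τ y.1) = y.2) (ξ η : E × (E →L[ℝ] ℝ)) :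
    stdSympl (fderiv ℝ κ w ξ) (fderiv ℝ κ w η) = stdSympl ξ η := by
  have hdτ : HasFDerivAt τ (fderiv ℝ τ w.1) w.1 :=
    (hτ.differentiableAt (by simp)).hasFDerivAt
  have hddτ : HasFDerivAt (fderiv ℝ τ) (fderiv ℝ (fderiv ℝ τ) w.1) w.1 :=
    ((hτ.fderiv_right (m := 1) (by norm_num)).differentiableAt one_ne_zero).hasFDerivAt
  have e1 : ∀ ζ, (fderiv ℝ κ w ζ).1 = fderiv ℝ τ w.1 ζ.1 := fun ζ => by
    have a := hκ.hasFDerivAt.fst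
    have b : HasFDerivAt (fun y : E × (E →L[ℝ] ℝ) => τ y.1) _ w := hdτ.comp w hasFDerivAt_fst
    have c := (b.congr_of_eventuallyEq h1).unique a
    exact (DFunLike.congr_fun c ζ).symm
  -- The derivative of `p' ∘ Dτ = p`. The term with the second derivative of `τ` is symmetric and
  -- cancels in the antisymmetric form.
  have e2 : ∀ ζ u, (fderiv ℝ κ w ζ).2 (fderiv ℝ τ w.1 u) +
      (κ w).2 (fderiv ℝ (fderiv ℝ τ) w.1 ζ.1 u) = ζ.2 u := fun ζ u => by
    have a := hκ.hasFDerivAt.snd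
    have b : HasFDerivAt (fun y : E × (E →L[ℝ] ℝ) => fderiv ℝ τ y.1) _ w :=
      hddτ.comp w hasFDerivAt_fst
    have d := a.clm_comp b
    have c := (d.congr_of_eventuallyEq (h2.mono fun y hy => hy.symm)).unique hasFDerivAt_snd
    have := DFunLike.congr_fun (DFunLike.congr_fun c ζ) u
    simp at this
    rw [← this]
    ring
  have hsymm : fderiv ℝ (fderiv ℝ τ) w.1 ξ.1 η.1 = fderiv ℝ (fderiv ℝ τ) w.1 η.1 ξ.1 :=
    (hτ.isSymmSndFDerivAt (by simp)).eq _ _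
  have e3 := e2 ξ η.1
  have e4 := e2 η ξ.1
  rw [stdSympl, stdSympl, e1, e1, ← e3, ← e4, hsymm]
  ring

/-- The symplectic form in the canonical coordinates of an arbitrary chart. -/
theorem sympl_eq {q₀ : M} {z : CotBundle n M} (hz : z.proj ∈ (extChartAt (𝓡 n) q₀).source)
    (ξ η : TangentSpace (cotModel n) z) :
    sympl z ξ η = stdSympl (cotDeriv q₀ z ξ) (cotDeriv q₀ z η) := by
  set q := z.proj with hq
  have hzq : z.proj ∈ (extChartAt (𝓡 n) q).source := mem_extChartAt_source _
  set w := cotChart q₀ z with hw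
  -- `κ` and `τ` are the coordinate changes, upstairs and on the base, from the chart at `q₀` to the
  -- chart at the foot point, for which `sympl` is defined.
  set κ : EuclideanSpace ℝ (Fin n) × (EuclideanSpace ℝ (Fin n) →L[ℝ] ℝ) →
    EuclideanSpace ℝ (Fin n) × (EuclideanSpace ℝ (Fin n) →L[ℝ] ℝ) :=
    fun y => cotChart q ((cotChart q₀ : PartialEquiv (CotBundle n M) _).symm y)
  set τ : EuclideanSpace ℝ (Fin n) → EuclideanSpace ℝ (Fin n) :=
    fun x => extChartAt (𝓡 n) q ((extChartAt (𝓡 n) q₀).symm x)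
  have hzs : z ∈ (cotChart q₀ : PartialEquiv (CotBundle n M) _).source := by
    rw [cotChart_source]; exact hz
  have hwt : w ∈ (cotChart q₀ : PartialEquiv (CotBundle n M) _).target :=
    (cotChart q₀ : PartialEquiv (CotBundle n M) _).map_source hzs
  have hwz : (cotChart q₀ : PartialEquiv (CotBundle n M) _).symm w = z :=
    (cotChart q₀ : PartialEquiv (CotBundle n M) _).left_inv hzs
  have htn : (cotChart q₀ : PartialEquiv (CotBundle n M) _).target ∈ 𝓝 w :=
    (isOpen_extChartAt_target (I := cotModel n) _).mem_nhds hwt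
  have hΨ : ContMDiffAt 𝓘(ℝ, EuclideanSpace ℝ (Fin n) × (EuclideanSpace ℝ (Fin n) →L[ℝ] ℝ))
      (cotModel n) ∞ (cotChart q₀ : PartialEquiv (CotBundle n M) _).symm w :=
    (contMDiffOn_extChartAt_symm (I := cotModel n) (n := ∞) _).contMDiffAt htn
  have hκ : ContDiffAt ℝ ∞ κ w := by
    refine contMDiffAt_iff_contDiffAt.1 (ContMDiffAt.comp w ?_ hΨ)
    rw [hwz]
    exact contMDiffAt_cotChart hzq
  have hmem : ∀ᶠ y in 𝓝 w, y ∈ (cotChart q₀ : PartialEquiv (CotBundle n M) _).target ∧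
      ((cotChart q₀ : PartialEquiv (CotBundle n M) _).symm y).proj ∈ (extChartAt (𝓡 n) q).source := by
    have hev := eventually_proj_mem (isOpen_extChartAt_source (I := 𝓡 n) q) hzq
    rw [← hwz] at hev
    exact Filter.Eventually.and htn (hΨ.continuousAt.eventually hev)
  have hx : w.1 = extChartAt (𝓡 n) q₀ q := by rw [hw, cotChart_apply hz]; rfl
  have hτ : ContDiffAt ℝ ∞ τ w.1 := by
    have hx1 : w.1 ∈ (extChartAt (𝓡 n) q₀).target := by
      rw [hx]; exact (extChartAt (𝓡 n) q₀).map_source hz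
    have hx2 : (extChartAt (𝓡 n) q₀).symm w.1 = q := by
      rw [hx]; exact (extChartAt (𝓡 n) q₀).left_inv hz
    refine contMDiffAt_iff_contDiffAt.1 (ContMDiffAt.comp (I' := 𝓡 n) w.1 ?_
      ((contMDiffOn_extChartAt_symm (I := 𝓡 n) (n := ∞) q₀).contMDiffAt
        ((isOpen_extChartAt_target (I := 𝓡 n) q₀).mem_nhds hx1)))
    rw [hx2]
    exact contMDiffAt_extChartAt
  have hchain : ∀ ζ, cotDeriv q z ζ = fderiv ℝ κ w (cotDeriv q₀ z ζ) := by
    intro ζ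
    have h := (hκ.differentiableAt (by simp)).hasFDerivAt.hasMFDerivAt.comp z
      (hasMFDerivAt_cotChart hz)
    have h2 : HasMFDerivAt (cotModel n) 𝓘(ℝ, EuclideanSpace ℝ (Fin n) ×
        (EuclideanSpace ℝ (Fin n) →L[ℝ] ℝ)) (cotChart q) z _ :=
      h.congr_of_eventuallyEq (by
        filter_upwards [eventually_proj_mem (isOpen_extChartAt_source q₀) hz] with z' hz'
        have : z' ∈ (cotChart q₀ : PartialEquiv (CotBundle n M) _).source := by
          rw [cotChart_source]; exact hz'
        simp only [κ, Function.comp, (cotChart q₀).left_inv this])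
    rw [cotDeriv, h2.mfderiv]
    rfl
  rw [sympl, dX_eq, dX_eq, dP_eq, dP_eq]
  change stdSympl (cotDeriv q z ξ) (cotDeriv q z η) = _
  rw [hchain, hchain]
  refine stdSympl_fderiv_of_cotangent_lift (τ := τ) (hτ.of_le (WithTop.coe_le_coe.2 le_top)) (hκ.differentiableAt (by simp)) ?_ ?_ _ _
  · filter_upwards [hmem] with y hy
    have hy1 : y.1 ∈ (extChartAt (𝓡 n) q₀).target := by
      have := hy.1
      rw [cotChart_target] at this
      exact this.1
    simp only [κ, τ]
    rw [cotChart_apply hy.2, ← proj_cotChart_symm hy1]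
    rfl
  · filter_upwards [hmem] with y hy
    have hy1 : y.1 ∈ (extChartAt (𝓡 n) q₀).target := by
      have := hy.1
      rw [cotChart_target] at this
      exact this.1
    have hpr := proj_cotChart_symm (M := M) hy1
    have hz1 := (cotChart q₀ : PartialEquiv (CotBundle n M) _).map_target hy.1
    rw [cotChart_source] at hz1
    have hr := (cotChart q₀ : PartialEquiv (CotBundle n M) _).right_inv hy.1
    rw [cotChart_apply hz1] at hr
    set z' := (cotChart q₀ : PartialEquiv (CotBundle n M) _).symm y
    have hr1 : y.1 = extChartAt (𝓡 n) q₀ z'.proj := congrArg Prod.fst hr.symm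
    have hr2 : y.2 = coordP q₀ z' := congrArg Prod.snd hr.symm
    -- The derivatives are named as endomorphisms of the model space, so that they can be carried
    -- along equalities of base points.
    obtain ⟨A, hA⟩ : ∃ A : EuclideanSpace ℝ (Fin n) →L[ℝ] EuclideanSpace ℝ (Fin n),
      mfderiv (𝓡 n) 𝓘(ℝ, EuclideanSpace ℝ (Fin n)) (extChartAt (𝓡 n) q) z'.proj = A := ⟨_, rfl⟩
    obtain ⟨B, hB⟩ : ∃ B : EuclideanSpace ℝ (Fin n) →L[ℝ] EuclideanSpace ℝ (Fin n),
      (mfderiv (𝓡 n) 𝓘(ℝ, EuclideanSpace ℝ (Fin n)) (extChartAt (𝓡 n) q₀) z'.proj).inverse = B :=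
      ⟨_, rfl⟩
    have hB' : HasMFDerivAt 𝓘(ℝ, EuclideanSpace ℝ (Fin n)) (𝓡 n) (extChartAt (𝓡 n) q₀).symm
        y.1 B := by
      have h := (mdifferentiableWithinAt_extChartAt_symm
        ((extChartAt (𝓡 n) q₀).map_source hz1)).hasMFDerivWithinAt
      have e := (mfderivWithin_extChartAt_symm_eq_inverse hz1).trans hB
      rw [ModelWithCorners.range_eq_univ] at h e
      rw [hr1]
      exact (hasMFDerivWithinAt_univ.1 h).congr_mfderiv e
    have hA' : HasMFDerivAt (𝓡 n) 𝓘(ℝ, EuclideanSpace ℝ (Fin n)) (extChartAt (𝓡 n) q)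
        ((extChartAt (𝓡 n) q₀).symm y.1) A := by
      have h : HasMFDerivAt (𝓡 n) 𝓘(ℝ, EuclideanSpace ℝ (Fin n)) (extChartAt (𝓡 n) q) z'.proj A := by
        rw [← hA]
        refine (mdifferentiableAt_extChartAt ?_).hasMFDerivAt
        rw [← extChartAt_source (𝓡 n)]
        exact hy.2
      have hl : (extChartAt (𝓡 n) q₀).symm y.1 = z'.proj := hpr.symm
      rw [hl]
      exact h
    have hcomp : HasMFDerivAt 𝓘(ℝ, EuclideanSpace ℝ (Fin n)) 𝓘(ℝ, EuclideanSpace ℝ (Fin n)) τ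
        y.1 (A.comp B) := HasMFDerivAt.comp (I' := 𝓡 n) y.1 hA' hB'
    have hcomp' : HasFDerivAt τ (A.comp B) y.1 := hcomp.hasFDerivAt
    have hτ' : fderiv ℝ τ y.1 = A.comp B := hcomp'.fderiv
    have hc : (κ y).2 = coordP q z' := congrArg Prod.snd (cotChart_apply hy.2)
    rw [hτ', hc, hr2]
    refine ContinuousLinearMap.ext fun u => ?_
    change z'.2 (_) = z'.2 (_)
    subst hA hB
    exact congrArg z'.2 (inverse_mfderiv_extChartAt_apply hy.2 _)

end CotangentCoordinates

/-! ### Hamiltonian vector fields and their integral curves -/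

section HamiltonianField

variable {n k : ℕ} {M : Type*} [TopologicalSpace M]
  [ChartedSpace (EuclideanSpace ℝ (Fin n)) M] [IsManifold (𝓡 n) ∞ M]

theorem fderiv_half_energy {E : Type*} [NormedAddCommGroup E] [NormedSpace ℝ E]
    {X : Fin k → E → E} {w : E × (E →L[ℝ] ℝ)} (hX : ∀ i, DifferentiableAt ℝ (X i) w.1) :
    ∃ L : E × (E →L[ℝ] ℝ) →L[ℝ] ℝ, HasFDerivAt (fun y => 1 / 2 * energy X y) L w ∧
      ∀ ξ, L ξ = stdSympl ξ (hamField X w) := by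
  have h1 : ∀ i, HasFDerivAt (fun y : E × (E →L[ℝ] ℝ) => X i y.1) _ w := fun i =>
    (hX i).hasFDerivAt.comp w hasFDerivAt_fst
  have h2 : ∀ i, HasFDerivAt (momentum (X i)) _ w := fun i =>
    (hasFDerivAt_snd (𝕜 := ℝ) (p := w)).clm_apply (h1 i)
  have h3 := (HasFDerivAt.fun_sum (u := Finset.univ) (A := fun i y => momentum (X i) y ^ 2)
    fun i _ => (h2 i).pow 2).const_mul (1 / 2)
  refine ⟨_, h3, fun ξ => ?_⟩
  simp only [stdSympl, hamField, map_sum, map_smul, smul_apply, sum_apply, neg_apply,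
    sub_neg_eq_add, smul_eq_mul, ← Finset.sum_add_distrib, Finset.mul_sum, momentum]
  refine Finset.sum_congr rfl fun i _ => ?_
  simp
  ring

/-- A smooth frame `X` on `U` that represents the function `h` on the cotangent bundle as
`½ ∑ ⟨λ, X_i⟩²`. -/
structure IsHamiltonianFrame (h : CotBundle n M → ℝ) (U : Set M)
    (X : Fin k → Π q : M, TangentSpace (𝓡 n) q) : Prop where
  isOpen : IsOpen U
  smooth : ∀ i, SmoothFieldOn (X i) U
  eq_half_sum : ∀ z : CotBundle n M, z.proj ∈ U → h z = 1 / 2 * ∑ i, (z.2 (X i z.proj)) ^ 2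

variable {h : CotBundle n M → ℝ} {U : Set M} {X : Fin k → Π q : M, TangentSpace (𝓡 n) q}

theorem IsHamiltonianFrame.eq_half_energy (hX : IsHamiltonianFrame h U X) {q₀ : M}
    {z : CotBundle n M} (hz : z.proj ∈ (extChartAt (𝓡 n) q₀).source) (hzU : z.proj ∈ U) :
    h z = 1 / 2 * energy (fun i => localField q₀ (X i)) (cotChart q₀ z) := by
  rw [hX.eq_half_sum z hzU, energy]
  simp only [momentum_localField hz]

theorem IsHamiltonianFrame.contDiffAt (hX : IsHamiltonianFrame h U X) {q₀ q : M}
    (hq : q ∈ (extChartAt (𝓡 n) q₀).source) (hqU : q ∈ U) (i : Fin k) :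
    ContDiffAt ℝ ∞ (localField q₀ (X i)) (extChartAt (𝓡 n) q₀ q) := by
  refine (contDiffOn_localField hX.isOpen (hX.smooth i)).contDiffAt
    (((continuousOn_extChartAt_symm q₀).isOpen_inter_preimage (isOpen_extChartAt_target q₀)
      hX.isOpen).mem_nhds ⟨(extChartAt (𝓡 n) q₀).map_source hq, ?_⟩)
  rwa [mem_preimage, (extChartAt (𝓡 n) q₀).left_inv hq]

/-- In canonical coordinates `dh` is the standard form paired with `hamField`, and the standard form
is nondegenerate. Existence, uniqueness and smoothness of the Hamiltonian field all follow from this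
criterion. -/
theorem isHamiltonian_iff (hX : IsHamiltonianFrame h U X) {q₀ : M} {z : CotBundle n M}
    (hz : z.proj ∈ (extChartAt (𝓡 n) q₀).source) (hzU : z.proj ∈ U)
    (v : TangentSpace (cotModel n) z) :
    (∀ ξ, mfderiv (cotModel n) 𝓘(ℝ, ℝ) h z ξ = sympl z ξ v) ↔
      cotDeriv q₀ z v = hamField (fun i => localField q₀ (X i)) (cotChart q₀ z) := by
  have hx : (cotChart q₀ z).1 = extChartAt (𝓡 n) q₀ z.proj := by rw [cotChart_apply hz]; rfl
  obtain ⟨L, hL, hL'⟩ := fderiv_half_energy (X := fun i => localField q₀ (X i))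
    (w := cotChart q₀ z) fun i => by
      rw [hx]; exact (hX.contDiffAt hz hzU i).differentiableAt (by simp)
  have hd : HasMFDerivAt (cotModel n) 𝓘(ℝ, ℝ) h z _ :=
    (hL.hasMFDerivAt.comp z (hasMFDerivAt_cotChart hz)).congr_of_eventuallyEq (by
      filter_upwards [eventually_proj_mem (isOpen_extChartAt_source q₀) hz,
        eventually_proj_mem hX.isOpen hzU] with z' h1 h2
      exact hX.eq_half_energy h1 h2)
  have hd' : ∀ ξ, mfderiv (cotModel n) 𝓘(ℝ, ℝ) h z ξ =
      stdSympl (cotDeriv q₀ z ξ) (hamField (fun i => localField q₀ (X i)) (cotChart q₀ z)) := by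
    intro ξ
    rw [hd.mfderiv]
    exact hL' _
  simp only [hd', sympl_eq hz]
  refine ⟨fun H => ?_, fun H ξ => by rw [H]⟩
  set F := hamField (fun i => localField q₀ (X i)) (cotChart q₀ z)
  set G := cotDeriv q₀ z v
  have H' : ∀ ζ, stdSympl ζ F = stdSympl ζ G := fun ζ => by
    obtain ⟨ξ, rfl⟩ := cotDeriv_surjective hz ζ
    exact H ξ
  -- Vertical test vectors `(0, f)` detect the position component, horizontal ones `(x, 0)` the
  -- momentum component.
  refine Prod.ext ?_ ?_
  · by_contra hne
    obtain ⟨f, hf⟩ := SeparatingDual.exists_separating_of_ne (R := ℝ) hne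
    have := H' (0, f)
    simp [stdSympl] at this
    exact hf this.symm
  · ext x
    have := H' (x, 0)
    simp [stdSympl] at this
    exact this.symm

/-- Every point of the base lies in the domain of a frame that represents `h`. -/
def HasHamiltonianFrames (k : ℕ) (h : CotBundle n M → ℝ) : Prop :=
  ∀ q : M, ∃ (U : Set M) (X : Fin k → Π q : M, TangentSpace (𝓡 n) q),
    q ∈ U ∧ IsHamiltonianFrame h U X

theorem exists_isHamiltonianField (hh : HasHamiltonianFrames k h) :
    ∃ v, IsHamiltonianField h v := by
  have : ∀ z : CotBundle n M, ∃ v : TangentSpace (cotModel n) z,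
      ∀ ξ, mfderiv (cotModel n) 𝓘(ℝ, ℝ) h z ξ = sympl z ξ v := by
    intro z
    obtain ⟨U, X, hq, hX⟩ := hh z.proj
    have hz := mem_extChartAt_source (I := 𝓡 n) z.proj
    obtain ⟨v, hv⟩ := cotDeriv_surjective hz
      (hamField (fun i => localField z.proj (X i)) (cotChart z.proj z))
    exact ⟨v, (isHamiltonian_iff hX hz hq v).2 hv⟩
  choose v hv using this
  exact ⟨v, hv⟩

theorem IsHamiltonianField.unique (hh : HasHamiltonianFrames k h)
    {v v' : Π z : CotBundle n M, TangentSpace (cotModel n) z} (hv : IsHamiltonianField h v)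
    (hv' : IsHamiltonianField h v') : v = v' := by
  funext z
  obtain ⟨U, X, hq, hX⟩ := hh z.proj
  have hz := mem_extChartAt_source (I := 𝓡 n) z.proj
  exact cotDeriv_injective hz (((isHamiltonian_iff hX hz hq _).1 (hv z)).trans
    ((isHamiltonian_iff hX hz hq _).1 (hv' z)).symm)

theorem contDiffAt_hamField {E : Type*} [NormedAddCommGroup E] [NormedSpace ℝ E]
    {X : Fin k → E → E} {w : E × (E →L[ℝ] ℝ)} (hX : ∀ i, ContDiffAt ℝ ∞ (X i) w.1) :
    ContDiffAt ℝ ∞ (hamField X) w := by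
  have h1 : ∀ i, ContDiffAt ℝ ∞ (fun y : E × (E →L[ℝ] ℝ) => X i y.1) w := fun i =>
    ContDiffAt.comp w (hX i) contDiffAt_fst
  have hm : ∀ i, ContDiffAt ℝ ∞ (momentum (X i)) w := fun i => contDiffAt_snd.clm_apply (h1 i)
  refine ContDiffAt.prodMk (ContDiffAt.sum fun i _ => (hm i).smul (h1 i))
    (ContDiffAt.neg (ContDiffAt.sum fun i _ => (hm i).smul (contDiffAt_snd.clm_comp ?_)))
  exact ContDiffAt.comp w ((hX i).fderiv_right (m := ∞) (by simp)) contDiffAt_fst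

/-- Class `C¹` is what the uniqueness of integral curves requires. -/
theorem IsHamiltonianField.contMDiff (hh : HasHamiltonianFrames k h)
    {v : Π z : CotBundle n M, TangentSpace (cotModel n) z} (hv : IsHamiltonianField h v) :
    ContMDiff (cotModel n) (cotModel n).tangent 1
      (fun z => (⟨z, v z⟩ : TangentBundle (cotModel n) (CotBundle n M))) := by
  intro z
  obtain ⟨U, X, hq, hX⟩ := hh z.proj
  have hz := mem_extChartAt_source (I := 𝓡 n) z.proj
  refine (contMDiffAt_section z).2 ?_
  have hx : (cotChart z.proj z).1 = extChartAt (𝓡 n) z.proj z.proj := by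
    rw [cotChart_apply hz]; rfl
  have h1 : ContMDiffAt (cotModel n)
      𝓘(ℝ, EuclideanSpace ℝ (Fin n) × (EuclideanSpace ℝ (Fin n) →L[ℝ] ℝ)) 1
      (fun z' => hamField (fun i => localField z.proj (X i)) (cotChart z.proj z')) z := by
    have h0 : ContDiffAt ℝ ∞ (hamField (fun i => localField z.proj (X i))) (cotChart z.proj z) :=
      contDiffAt_hamField fun i => by rw [hx]; exact hX.contDiffAt hz hq i
    exact (ContMDiffAt.comp z (contMDiffAt_iff_contDiffAt.2 h0) (contMDiffAt_cotChart hz)).of_le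
      (WithTop.coe_le_coe.2 le_top)
  refine h1.congr_of_eventuallyEq ?_
  filter_upwards [eventually_proj_mem (isOpen_extChartAt_source z.proj) hz,
    eventually_proj_mem hX.isOpen hq] with z' h2 h3
  rw [← (isHamiltonian_iff hX h2 h3 _).1 (hv z')]
  have hs : z' ∈ (cotChart z.proj : PartialEquiv (CotBundle n M) _).source := by
    rw [cotChart_source]; exact h2
  have he : extChartAt (cotModel n) z = cotChart z.proj := by
    simp only [cotChart, extChartAt, FiberBundle.chartedSpace_chartAt]
  have hs' : z' ∈ (chartAt (ModelProd (EuclideanSpace ℝ (Fin n))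
      (EuclideanSpace ℝ (Fin n) →L[ℝ] ℝ)) z).source := by
    rwa [← he, extChartAt_source] at hs
  have h4 := TangentBundle.continuousLinearMapAt_trivializationAt (I := cotModel n) hs'
  set e := trivializationAt (EuclideanSpace ℝ (Fin n) × (EuclideanSpace ℝ (Fin n) →L[ℝ] ℝ))
    (TangentSpace (cotModel n) : CotBundle n M → Type _) z
  have h5 := congrFun (e.coe_linearMapAt_of_mem (R := ℝ) (b := z') hs') (v z')
  refine h5.symm.trans ?_
  rw [he] at h4
  exact DFunLike.congr_fun h4 (v z')

/-- Covectors at one point are separated in a chart, covectors at different points by their feet.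
The Hausdorff property enters the global uniqueness of integral curves. -/
theorem t2Space_cotBundle [T2Space M] : T2Space (CotBundle n M) := by
  refine ⟨fun z z' hne => ?_⟩
  by_cases hp : z.proj = z'.proj
  · have hz : z ∈ (cotChart z.proj : PartialEquiv (CotBundle n M) _).source := by
      rw [cotChart_source]; exact mem_extChartAt_source z.proj
    have hz' : z' ∈ (cotChart z.proj : PartialEquiv (CotBundle n M) _).source := by
      rw [cotChart_source, mem_ofPred_eq, ← hp]; exact mem_extChartAt_source z.proj
    have hd : cotChart z.proj z ≠ cotChart z.proj z' := fun he =>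
      hne ((cotChart z.proj).injOn hz hz' he)
    obtain ⟨u, v, hu, hv, hzu, hzv, huv⟩ := t2_separation hd
    have ho : IsOpen (cotChart z.proj : PartialEquiv (CotBundle n M) _).source :=
      isOpen_extChartAt_source (I := cotModel n) _
    have hc : ContinuousOn (cotChart z.proj) (cotChart z.proj : PartialEquiv (CotBundle n M) _).source :=
      continuousOn_extChartAt (I := cotModel n) _
    exact ⟨_, _, hc.isOpen_inter_preimage ho hu, hc.isOpen_inter_preimage ho hv, ⟨hz, hzu⟩,
      ⟨hz', hzv⟩, (huv.preimage _).mono inter_subset_right inter_subset_right⟩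
  · exact separated_by_continuous (FiberBundle.continuous_proj (EuclideanSpace ℝ (Fin n) →L[ℝ] ℝ)
      (fun q : M => CotSpace n q)) hp

theorem isMIntegralCurveOn_cotChart_symm (hX : IsHamiltonianFrame h U X)
    {v : Π z : CotBundle n M, TangentSpace (cotModel n) z} (hv : IsHamiltonianField h v) {q₀ : M}
    {s : Set ℝ} {z : ℝ → EuclideanSpace ℝ (Fin n) × (EuclideanSpace ℝ (Fin n) →L[ℝ] ℝ)}
    (hzt : ∀ t ∈ s, (z t).1 ∈ (extChartAt (𝓡 n) q₀).target)
    (hzU : ∀ t ∈ s, (extChartAt (𝓡 n) q₀).symm (z t).1 ∈ U)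
    (hz : ∀ t ∈ s, HasDerivAt z (hamField (fun i => localField q₀ (X i)) (z t)) t) :
    IsMIntegralCurveOn (fun t => (cotChart q₀ : PartialEquiv (CotBundle n M) _).symm (z t)) v s := by
  intro t ht
  have hwt : z t ∈ (cotChart q₀ : PartialEquiv (CotBundle n M) _).target := by
    rw [cotChart_target]; exact ⟨hzt t ht, mem_univ _⟩
  have htn := (isOpen_extChartAt_target (I := cotModel n) (⟨q₀, 0⟩ : CotBundle n M)).mem_nhds hwt
  have hΨ : HasMFDerivAt 𝓘(ℝ, EuclideanSpace ℝ (Fin n) × (EuclideanSpace ℝ (Fin n) →L[ℝ] ℝ))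
      (cotModel n) (cotChart q₀ : PartialEquiv (CotBundle n M) _).symm (z t) _ :=
    (((contMDiffOn_extChartAt_symm (I := cotModel n) (n := ∞) _).contMDiffAt htn).mdifferentiableAt
      (by simp)).hasMFDerivAt
  set Λ := (cotChart q₀ : PartialEquiv (CotBundle n M) _).symm (z t) with hΛ
  have hpr : Λ.proj = (extChartAt (𝓡 n) q₀).symm (z t).1 := proj_cotChart_symm (hzt t ht)
  have hs : Λ.proj ∈ (extChartAt (𝓡 n) q₀).source := by
    rw [hpr]; exact (extChartAt (𝓡 n) q₀).map_target (hzt t ht)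
  have hU : Λ.proj ∈ U := by rw [hpr]; exact hzU t ht
  have hr : cotChart q₀ Λ = z t := (cotChart q₀ : PartialEquiv (CotBundle n M) _).right_inv hwt
  have hv' := (isHamiltonian_iff hX hs hU _).1 (hv Λ)
  rw [hr] at hv'
  have hd := (hΨ.comp t (hz t ht).hasFDerivAt.hasMFDerivAt)
  refine (hd.congr_mfderiv ?_).hasMFDerivWithinAt
  -- Differentiating `cotChart ∘ cotChart.symm = id` shows that the derivative of the inverse chart
  -- is a right inverse of `cotDeriv`. As `cotDeriv` is injective, velocities may be compared in
  -- coordinates.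
  have hid : HasMFDerivAt 𝓘(ℝ, EuclideanSpace ℝ (Fin n) × (EuclideanSpace ℝ (Fin n) →L[ℝ] ℝ))
      𝓘(ℝ, EuclideanSpace ℝ (Fin n) × (EuclideanSpace ℝ (Fin n) →L[ℝ] ℝ)) id (z t) _ :=
    (HasMFDerivAt.comp (z t) (hasMFDerivAt_cotChart hs) hΨ).congr_of_eventuallyEq
      (by filter_upwards [htn] with y hy using
        ((cotChart q₀ : PartialEquiv (CotBundle n M) _).right_inv hy).symm)
  have hid' := hasMFDerivAt_unique hid (hasMFDerivAt_id (z t))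
  refine ContinuousLinearMap.ext fun (c : ℝ) => cotDeriv_injective hs ?_
  have e1 := DFunLike.congr_fun hid' (c • hamField (fun i => localField q₀ (X i)) (z t))
  have e2 : cotDeriv q₀ Λ (c • v Λ) = c • hamField (fun i => localField q₀ (X i)) (z t) := by
    rw [(cotDeriv q₀ Λ).map_smul, hv']
  exact e1.trans e2.symm

end HamiltonianField

/-! ### Orthonormal frames -/

section LinearAlgebra

variable {k : ℕ} {W : Type*} [AddCommGroup W] [Module ℝ W]
  {B : W →ₗ[ℝ] W →ₗ[ℝ] ℝ} {b b' : Fin k → W}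

theorem linearIndependent_of_orthonormal (hb : ∀ i j, B (b i) (b j) = if i = j then 1 else 0) :
    LinearIndependent ℝ b := by
  rw [Fintype.linearIndependent_iff]
  intro c hc j
  have := congrArg (fun w => B w (b j)) hc
  simpa [hb] using this

theorem eq_sum_of_orthonormal [FiniteDimensional ℝ W] (hk : Module.finrank ℝ W = k)
    (hb : ∀ i j, B (b i) (b j) = if i = j then 1 else 0) (w : W) : w = ∑ j, B w (b j) • b j := by
  have hspan := (linearIndependent_of_orthonormal hb).span_eq_top_of_card_eq_finrank'
    (by simp [hk])
  have hw : w ∈ Submodule.span ℝ (range b) := hspan ▸ Submodule.mem_top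
  obtain ⟨c, rfl⟩ := (Submodule.mem_span_range_iff_exists_fun ℝ).1 hw
  simp [hb]

/-- The matrix between two orthonormal bases is orthogonal. This makes the Hamiltonian independent
of the basis chosen in its definition. -/
theorem sum_sq_eq_of_orthonormal [FiniteDimensional ℝ W] (hk : Module.finrank ℝ W = k)
    (hb : ∀ i j, B (b i) (b j) = if i = j then 1 else 0)
    (hb' : ∀ i j, B (b' i) (b' j) = if i = j then 1 else 0) (l : W →ₗ[ℝ] ℝ) :
    ∑ i, l (b' i) ^ 2 = ∑ i, l (b i) ^ 2 := by
  set O : Matrix (Fin k) (Fin k) ℝ := fun i j => B (b' i) (b j) with hO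
  have h1 : O * O.transpose = 1 := by
    ext i j
    rw [Matrix.mul_apply, Matrix.one_apply, ← hb' i j]
    conv_rhs => rw [eq_sum_of_orthonormal hk hb (b' j)]
    simp [hO, mul_comm]
    rfl
  have h2 : O.transpose * O = 1 := mul_eq_one_comm.1 h1
  have h3 : (fun i => l (b' i)) = O.mulVec (fun j => l (b j)) := by
    funext i
    conv_lhs => rw [eq_sum_of_orthonormal hk hb (b' i)]
    simp [Matrix.mulVec, dotProduct, hO]
  have h4 : ∑ i, l (b' i) ^ 2 = dotProduct (fun i => l (b' i)) (fun i => l (b' i)) := by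
    simp [dotProduct, sq]
  rw [h4, h3, Matrix.dotProduct_mulVec, Matrix.vecMul_mulVec, h2, Matrix.vecMul_one]
  simp [dotProduct, sq]

end LinearAlgebra

namespace Structure

variable {n k : ℕ} {M : Type*} [TopologicalSpace M]
  [ChartedSpace (EuclideanSpace ℝ (Fin n)) M] [IsManifold (𝓡 n) ∞ M]

theorem finiteDimensional_tangentSpace (q : M) : FiniteDimensional ℝ (TangentSpace (𝓡 n) q) :=
  inferInstanceAs (FiniteDimensional ℝ (EuclideanSpace ℝ (Fin n)))

attribute [local instance] finiteDimensional_tangentSpace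

theorem finrank_distr (S : Structure n k M) (q : M) : Module.finrank ℝ (S.distr q) = k := by
  obtain ⟨U, -, hq, X, -, hX⟩ := S.smooth_distr q
  obtain ⟨h1, h2⟩ := hX q hq
  rw [← h2, finrank_span_eq_card h1, Fintype.card_fin]

theorem hamiltonian_eq (S : Structure n k M) (z : CotBundle n M) {b : Fin k → S.distr z.proj}
    (hb : S.IsOrthonormal z.proj b) :
    S.hamiltonian z = 1 / 2 * ∑ i, (z.2 (b i : TangentSpace (𝓡 n) z.proj)) ^ 2 := by
  have h : ∃ b : Fin k → S.distr z.proj, S.IsOrthonormal z.proj b := ⟨b, hb⟩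
  rw [hamiltonian, dif_pos h]
  congr 1
  exact sum_sq_eq_of_orthonormal (S.finrank_distr z.proj) hb h.choose_spec
    ((z.2 : TangentSpace (𝓡 n) z.proj →ₗ[ℝ] ℝ).comp (S.distr z.proj).subtype)

/-- `X` is a smooth orthonormal frame of the distribution on the open set `U`. -/
structure IsOrthonormalFrame (S : Structure n k M) (U : Set M)
    (X : Fin k → Π q : M, TangentSpace (𝓡 n) q) : Prop where
  isOpen : IsOpen U
  smooth : ∀ i, SmoothFieldOn (X i) U
  mem_distr : ∀ i, ∀ q ∈ U, X i q ∈ S.distr q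
  orthonormal : ∀ q (hq : q ∈ U), S.IsOrthonormal q (fun i => ⟨X i q, mem_distr i q hq⟩)

theorem IsAdaptedFrame.isOrthonormalFrame {S : Structure n k M}
    {V : Π q : M, Submodule ℝ (TangentSpace (𝓡 n) q)} {m : ℕ} {U : Set M}
    {X : Fin k → Π q : M, TangentSpace (𝓡 n) q} {Y : Fin m → Π q : M, TangentSpace (𝓡 n) q}
    (h : S.IsAdaptedFrame V U X Y) : S.IsOrthonormalFrame U X :=
  ⟨h.isOpen, fun i => h.isLocalFrame.contMDiffOn (Sum.inl i), h.mem_distr, h.orthonormal⟩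

theorem IsOrthonormalFrame.isHamiltonianFrame {S : Structure n k M} {U : Set M}
    {X : Fin k → Π q : M, TangentSpace (𝓡 n) q} (h : S.IsOrthonormalFrame U X) :
    IsHamiltonianFrame S.hamiltonian U X :=
  ⟨h.isOpen, h.smooth, fun z hz => S.hamiltonian_eq z (h.orthonormal z.proj hz)⟩

theorem smoothFieldOn_sum_smul {U : Set M} {ι : Type*} (s : Finset ι) {f : ι → M → ℝ}
    {X : ι → Π q : M, TangentSpace (𝓡 n) q}
    (hf : ∀ i ∈ s, ContMDiffOn (𝓡 n) 𝓘(ℝ, ℝ) ∞ (f i) U) (hX : ∀ i ∈ s, SmoothFieldOn (X i) U) :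
    SmoothFieldOn (fun q => ∑ i ∈ s, f i q • X i q) U :=
  ContMDiffOn.sum_section fun i hi => (hf i hi).smul_section (hX i hi)

/-- Gram–Schmidt with smooth coefficients, by induction on the number `r` of vectors treated; values
of `e` at indices from `r` on are irrelevant. The span condition is carried along to show that the
next vector does not vanish. -/
theorem exists_orthonormal_family (S : Structure n k M) {U : Set M} (hU : IsOpen U)
    {Z : Fin k → Π q : M, S.distr q}
    (hZ : ∀ i, SmoothFieldOn (fun q => (Z i q : TangentSpace (𝓡 n) q)) U)
    (hli : ∀ q ∈ U, LinearIndependent ℝ (fun i => Z i q)) (r : ℕ) (hr : r ≤ k) :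
    ∃ e : ℕ → Π q : M, S.distr q,
      (∀ i < r, SmoothFieldOn (fun q => (e i q : TangentSpace (𝓡 n) q)) U) ∧
      (∀ q ∈ U, ∀ i < r, ∀ j < r, S.metric q (e i q) (e j q) = if i = j then 1 else 0) ∧
      ∀ q ∈ U, ∀ i < r, e i q ∈ Submodule.span ℝ ((fun j : Fin k => Z j q) '' {j | j.val < r}) := by
  induction r with
  | zero => exact ⟨fun _ _ => 0, by simp, by simp, by simp⟩
  | succ r ih =>
    obtain ⟨e, he, hon, hsp⟩ := ih (by omega)
    set z := Z ⟨r, hr⟩ with hz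
    set w : Π q : M, S.distr q :=
      fun q => z q - ∑ i ∈ Finset.range r, S.metric q (z q) (e i q) • e i q with hw
    have hwsm : SmoothFieldOn (fun q => (w q : TangentSpace (𝓡 n) q)) U := by
      have h1 : SmoothFieldOn (fun q => ∑ i ∈ Finset.range r, S.metric q (z q) (e i q) •
          (e i q : TangentSpace (𝓡 n) q)) U :=
        smoothFieldOn_sum_smul _
          (fun i hi => S.metric_smooth U hU z (e i) (hZ _) (he i (Finset.mem_range.1 hi)))
          fun i hi => he i (Finset.mem_range.1 hi)
      have h2 := ContMDiffOn.sub_section (hZ ⟨r, hr⟩) h1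
      refine h2.congr fun q _ => ?_
      simp [hw, hz]
    -- If `w` vanished, `Z r` would lie in the span of the earlier `Z j`.
    have hwne : ∀ q ∈ U, w q ≠ 0 := by
      intro q hq h0
      have hmem : z q ∈ Submodule.span ℝ ((fun j : Fin k => Z j q) '' {j | j.val < r}) := by
        rw [sub_eq_zero.1 h0]
        exact Submodule.sum_mem _ fun i hi =>
          Submodule.smul_mem _ _ (hsp q hq i (Finset.mem_range.1 hi))
      exact (hli q hq).notMem_span_image (s := {j | j.val < r}) (x := ⟨r, hr⟩) (by simp) hmem
    have hN : ∀ q ∈ U, 0 < S.metric q (w q) (w q) := fun q hq => S.metric_pos q _ (hwne q hq)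
    have hworth : ∀ q ∈ U, ∀ i < r, S.metric q (w q) (e i q) = 0 := by
      intro q hq i hi
      simp only [hw, map_sub, LinearMap.sub_apply, map_sum, LinearMap.sum_apply, map_smul,
        LinearMap.smul_apply, smul_eq_mul]
      rw [Finset.sum_congr rfl fun j hj => by
        rw [hon q hq j (Finset.mem_range.1 hj) i hi]]
      simp [hi]
    have hNsm : ContMDiffOn (𝓡 n) 𝓘(ℝ, ℝ) ∞ (fun q => (√(S.metric q (w q) (w q)))⁻¹) U := by
      intro q hq
      have h1 := S.metric_smooth U hU w w hwsm hwsm q hq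
      have h2 : ContDiffAt ℝ ∞ (fun x : ℝ => (√x)⁻¹) (S.metric q (w q) (w q)) :=
        (Real.contDiffAt_sqrt (hN q hq).ne').inv (Real.sqrt_pos.2 (hN q hq)).ne'
      exact ContMDiffAt.comp_contMDiffWithinAt (g := fun x : ℝ => (√x)⁻¹) q h2.contMDiffAt h1
    set u : Π q : M, S.distr q := fun q => (√(S.metric q (w q) (w q)))⁻¹ • w q with hu
    have hworth' : ∀ q ∈ U, ∀ i < r, S.metric q (u q) (e i q) = 0 := fun q hq i hi => by
      simp [hu, hworth q hq i hi]
    refine ⟨Function.update e r u, fun i hi => ?_, fun q hq i hi j hj => ?_, fun q hq i hi => ?_⟩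
    · rcases Nat.lt_succ_iff_lt_or_eq.1 hi with hi | rfl
      · simpa [Function.update_of_ne hi.ne] using he i hi
      · simp only [Function.update_self]
        exact hNsm.smul_section hwsm
    · rcases Nat.lt_succ_iff_lt_or_eq.1 hi with hi | rfl <;>
      rcases Nat.lt_succ_iff_lt_or_eq.1 hj with hj | rfl
      · simpa [Function.update_of_ne hi.ne, Function.update_of_ne hj.ne] using hon q hq i hi j hj
      · rw [Function.update_of_ne hi.ne, Function.update_self, S.metric_symm, hworth' q hq i hi,
          if_neg hi.ne]
      · rw [Function.update_of_ne hj.ne, Function.update_self, hworth' q hq j hj,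
          if_neg hj.ne']
      · have h1 := Real.mul_self_sqrt (hN q hq).le
        have h2 := (Real.sqrt_pos.2 (hN q hq)).ne'
        simp only [Function.update_self, hu, map_smul, LinearMap.smul_apply, smul_eq_mul, if_true]
        field_simp
        rw [sq, h1]
    · have hmono : Submodule.span ℝ ((fun j : Fin k => Z j q) '' {j | j.val < r}) ≤
          Submodule.span ℝ ((fun j : Fin k => Z j q) '' {j | j.val < r + 1}) :=
        Submodule.span_mono (image_mono fun j (hj : j.val < r) => Nat.lt_succ_of_lt hj)
      rcases Nat.lt_succ_iff_lt_or_eq.1 hi with hi | rfl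
      · rw [Function.update_of_ne hi.ne]
        exact hmono (hsp q hq i hi)
      · rw [Function.update_self]
        refine Submodule.smul_mem _ _ (Submodule.sub_mem _ (Submodule.subset_span
          ⟨⟨i, hr⟩, by simp, rfl⟩) (Submodule.sum_mem _ fun j hj => Submodule.smul_mem _ _
            (hmono (hsp q hq j (Finset.mem_range.1 hj)))))

theorem exists_isOrthonormalFrame (S : Structure n k M) (q₀ : M) :
    ∃ (U : Set M) (X : Fin k → Π q : M, TangentSpace (𝓡 n) q),
      q₀ ∈ U ∧ S.IsOrthonormalFrame U X := by
  classical
  obtain ⟨U, hU, hq₀, Z, hZ, hsp⟩ := S.smooth_distr q₀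
  have hmem : ∀ i, ∀ q ∈ U, Z i q ∈ S.distr q := fun i q hq => by
    rw [← (hsp q hq).2]
    exact Submodule.subset_span ⟨i, rfl⟩
  -- Extension by zero outside `U`, since `metric_smooth` takes sections of `D` defined on all of
  -- `M`.
  set Z' : Fin k → Π q : M, S.distr q := fun i q => if h : q ∈ U then ⟨Z i q, hmem i q h⟩ else 0
    with hZ'
  have hval : ∀ i, ∀ q ∈ U, (Z' i q : TangentSpace (𝓡 n) q) = Z i q := fun i q hq => by
    simp [hZ', hq]
  obtain ⟨e, he, hon, -⟩ := S.exists_orthonormal_family hU (Z := Z')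
    (fun i => (hZ i).congr fun q hq => by
      show (⟨q, (Z' i q : TangentSpace (𝓡 n) q)⟩ : TangentBundle (𝓡 n) M) = _
      rw [hval i q hq])
    (fun q hq => by
      refine LinearIndependent.of_comp (S.distr q).subtype ?_
      have : (S.distr q).subtype ∘ (fun i => Z' i q) = fun i => Z i q :=
        funext fun i => hval i q hq
      rw [this]
      exact (hsp q hq).1) k le_rfl
  exact ⟨U, fun i q => e i q, hq₀, hU, fun i => he i i.2, fun i q _ => (e i q).2,
    fun q hq i j => by
      simpa [Fin.ext_iff] using hon q hq i i.2 j j.2⟩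

theorem hasHamiltonianFrames (S : Structure n k M) : HasHamiltonianFrames k S.hamiltonian := by
  intro q
  obtain ⟨U, X, hq, hX⟩ := S.exists_isOrthonormalFrame q
  exact ⟨U, X, hq, hX.isHamiltonianFrame⟩

end Structure

/-! ### Moments of the uniform measure on the unit sphere -/

section Sphere

variable {k : ℕ}

open scoped Pointwise in
-- The sphere measure of a set is a multiple of the volume of the cone over it, and a linear
-- isometry preserves the volume and commutes with forming cones.
theorem measurePreserving_sphere_toSphere
    (A : EuclideanSpace ℝ (Fin k) ≃ₗᵢ[ℝ] EuclideanSpace ℝ (Fin k))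
    (T : Metric.sphere (0 : EuclideanSpace ℝ (Fin k)) 1 →
      Metric.sphere (0 : EuclideanSpace ℝ (Fin k)) 1)
    (hT : ∀ x, (T x : EuclideanSpace ℝ (Fin k)) = A x) :
    MeasurePreserving T (volume : Measure (EuclideanSpace ℝ (Fin k))).toSphere
      (volume : Measure (EuclideanSpace ℝ (Fin k))).toSphere := by
  have hTc : Continuous T := by
    refine continuous_induced_rng.2 ?_
    have : Subtype.val ∘ T = fun x : Metric.sphere (0 : EuclideanSpace ℝ (Fin k)) 1 => A x := funext hT
    rw [this]
    exact A.continuous.comp continuous_subtype_val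
  refine ⟨hTc.measurable, Measure.ext fun s hs => ?_⟩
  rw [Measure.map_apply hTc.measurable hs, Measure.toSphere_apply' _ (hTc.measurable hs),
    Measure.toSphere_apply' _ hs, ← A.measurePreserving.measure_preimage_equiv (f := A.toMeasurableEquiv)
      (Ioo (0 : ℝ) 1 • (Subtype.val '' s))]
  congr 2
  ext x
  simp only [Set.mem_smul, mem_image, mem_preimage]
  constructor
  · rintro ⟨r, hr, _, ⟨y, hy, rfl⟩, rfl⟩
    exact ⟨r, hr, _, ⟨T y, hy, rfl⟩, by rw [hT]; exact (A.map_smul r _).symm⟩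
  · rintro ⟨r, hr, _, ⟨y, hy, rfl⟩, h⟩
    have hmem : A.symm y ∈ Metric.sphere (0 : EuclideanSpace ℝ (Fin k)) 1 := by simp
    have hTy : T ⟨A.symm y, hmem⟩ = y := Subtype.ext (by rw [hT]; simp)
    refine ⟨r, hr, _, ⟨⟨A.symm y, hmem⟩, by simpa [hTy] using hy, rfl⟩, ?_⟩
    apply A.injective
    change A (r • A.symm (y : EuclideanSpace ℝ (Fin k))) = A x
    rw [A.map_smul, A.apply_symm_apply]
    exact h

theorem measurePreserving_sphere
    (A : EuclideanSpace ℝ (Fin k) ≃ₗᵢ[ℝ] EuclideanSpace ℝ (Fin k))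
    (T : Metric.sphere (0 : EuclideanSpace ℝ (Fin k)) 1 →
      Metric.sphere (0 : EuclideanSpace ℝ (Fin k)) 1)
    (hT : ∀ x, (T x : EuclideanSpace ℝ (Fin k)) = A x) :
    MeasurePreserving T (unitSphereMeasure k) (unitSphereMeasure k) :=
  (measurePreserving_sphere_toSphere A T hT).smul_measure _

/-- This includes `k = 0`, where the unnormalised measure is zero and its infinite normalising
factor does no harm. -/
instance isFiniteMeasure_unitSphereMeasure : IsFiniteMeasure (unitSphereMeasure k) := by
  rcases eq_or_ne ((volume : Measure (EuclideanSpace ℝ (Fin k))).toSphere) 0 with h | h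
  · rw [unitSphereMeasure, h, smul_zero]
    infer_instance
  · constructor
    rw [unitSphereMeasure, Measure.smul_apply, smul_eq_mul,
      ENNReal.inv_mul_cancel (Measure.measure_univ_ne_zero.2 h) (measure_ne_top _ _)]
    exact ENNReal.one_lt_top

theorem isProbabilityMeasure_unitSphereMeasure (hk : 0 < k) :
    IsProbabilityMeasure (unitSphereMeasure k) := by
  constructor
  have : Nontrivial (EuclideanSpace ℝ (Fin k)) := by
    have : Nonempty (Fin k) := ⟨⟨0, hk⟩⟩
    infer_instance
  rw [unitSphereMeasure, Measure.smul_apply, smul_eq_mul,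
    ENNReal.inv_mul_cancel (Measure.measure_univ_ne_zero.2 (Measure.toSphere_ne_zero _)) (measure_ne_top _ _)]

theorem integral_sphere_isometry
    (A : EuclideanSpace ℝ (Fin k) ≃ₗᵢ[ℝ] EuclideanSpace ℝ (Fin k))
    {f : EuclideanSpace ℝ (Fin k) → ℝ} (hf : Continuous f) :
    ∫ x, f (A (x : EuclideanSpace ℝ (Fin k))) ∂unitSphereMeasure k =
      ∫ x, f (x : EuclideanSpace ℝ (Fin k)) ∂unitSphereMeasure k := by
  have hT := measurePreserving_sphere A
    (fun x => ⟨A x, by rw [mem_sphere_zero_iff_norm, A.norm_map]; simp⟩) fun x => rfl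
  have h := integral_map (μ := unitSphereMeasure k) (f := fun x : Metric.sphere (0 : EuclideanSpace ℝ (Fin k)) 1 => f x)
    hT.measurable.aemeasurable (hf.comp continuous_subtype_val).aestronglyMeasurable
  rw [hT.map_eq] at h
  exact h.symm

theorem integral_sphere_apply (i : Fin k) :
    ∫ x, (x : EuclideanSpace ℝ (Fin k)) i ∂unitSphereMeasure k = 0 := by
  have h := integral_sphere_isometry (LinearIsometryEquiv.neg ℝ)
    (f := fun x : EuclideanSpace ℝ (Fin k) => x i) (by fun_prop)
  simp only [LinearIsometryEquiv.coe_neg, PiLp.neg_apply, integral_neg] at h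
  linarith

theorem integrable_sphere {f : EuclideanSpace ℝ (Fin k) → ℝ} (hf : Continuous f) :
    Integrable (fun x : Metric.sphere (0 : EuclideanSpace ℝ (Fin k)) 1 => f x)
      (unitSphereMeasure k) :=
  (hf.comp continuous_subtype_val).integrable_of_hasCompactSupport
    (HasCompactSupport.of_compactSpace _)

/-- Swapping two coordinates shows that all the diagonal moments agree, and they add up to one. The
off-diagonal moments change sign under `x_i ↦ -x_i`. -/
theorem integral_sphere_mul (i j : Fin k) :
    ∫ x, (x : EuclideanSpace ℝ (Fin k)) i * (x : EuclideanSpace ℝ (Fin k)) j ∂unitSphereMeasure k =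
      if i = j then (k : ℝ)⁻¹ else 0 := by
  have hk : 0 < k := i.pos
  have hdiag : ∀ i' : Fin k, ∫ x, (x : EuclideanSpace ℝ (Fin k)) i' *
      (x : EuclideanSpace ℝ (Fin k)) i' ∂unitSphereMeasure k =
      ∫ x, (x : EuclideanSpace ℝ (Fin k)) i * (x : EuclideanSpace ℝ (Fin k)) i
        ∂unitSphereMeasure k := by
    intro i'
    have h := integral_sphere_isometry
      (LinearIsometryEquiv.piLpCongrLeft 2 ℝ ℝ (Equiv.swap i i'))
      (f := fun x : EuclideanSpace ℝ (Fin k) => x i * x i) (by fun_prop)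
    simpa [LinearIsometryEquiv.piLpCongrLeft_apply, Equiv.piCongrLeft'] using h
  split_ifs with hij
  · subst hij
    have := isProbabilityMeasure_unitSphereMeasure hk
    have h1 : ∑ i' : Fin k, ∫ x, (x : EuclideanSpace ℝ (Fin k)) i' *
        (x : EuclideanSpace ℝ (Fin k)) i' ∂unitSphereMeasure k = 1 := by
      rw [← integral_finsetSum _ fun i' _ => integrable_sphere
        (f := fun x : EuclideanSpace ℝ (Fin k) => x i' * x i') (by fun_prop)]
      have : ∀ x : Metric.sphere (0 : EuclideanSpace ℝ (Fin k)) 1,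
          ∑ i' : Fin k, (x : EuclideanSpace ℝ (Fin k)) i' * (x : EuclideanSpace ℝ (Fin k)) i' = 1 := by
        intro x
        have h2 := EuclideanSpace.real_norm_sq_eq (x : EuclideanSpace ℝ (Fin k))
        rw [mem_sphere_zero_iff_norm.1 x.2] at h2
        simpa [sq] using h2.symm
      simp [this]
    rw [Finset.sum_congr rfl fun i' _ => hdiag i', Finset.sum_const, Finset.card_univ,
      Fintype.card_fin, nsmul_eq_mul] at h1
    exact eq_inv_of_mul_eq_one_right h1
  · have h := integral_sphere_isometry
      (LinearIsometryEquiv.piLpCongrRight 2 fun l : Fin k =>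
        if l = i then LinearIsometryEquiv.neg ℝ else LinearIsometryEquiv.refl ℝ ℝ)
      (f := fun x : EuclideanSpace ℝ (Fin k) => x i * x j) (by fun_prop)
    simp [Ne.symm hij, integral_neg] at h
    linarith

end Sphere

/-! ### Moments of adapted measures on a fibre -/

section Adapted

variable {n k : ℕ} {M : Type*} [TopologicalSpace M]
  [ChartedSpace (EuclideanSpace ℝ (Fin n)) M] [IsManifold (𝓡 n) ∞ M]

instance (q : M) : BorelSpace (CotSpace n q) := ⟨rfl⟩

instance (q : M) : SecondCountableTopology (CotSpace n q) :=
  inferInstanceAs (SecondCountableTopology (EuclideanSpace ℝ (Fin n) →L[ℝ] ℝ))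

theorem continuous_eval_cotSpace {q : M} (u : TangentSpace (𝓡 n) q) :
    Continuous fun l : CotSpace n q => (l u : ℝ) := by
  have : Continuous fun l : EuclideanSpace ℝ (Fin n) →L[ℝ] ℝ => l u := by fun_prop
  exact this

/-- A disintegration of the measure of an adapted family over the fibre at `q`, together with
the linear isometry that an orthonormal basis `b` of the distribution induces. -/
structure FibreData (S : Structure n k M) (V : Π q : M, Submodule ℝ (TangentSpace (𝓡 n) q))
    (q : M) (b : Fin k → S.distr q) (m : Measure (CotSpace n q)) where
  e : EuclideanSpace ℝ (Fin k) →ₗ[ℝ] CotSpace n q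
  ν : Measure (annihilator (S.distr q))
  A : EuclideanSpace ℝ (Fin k) ≃ₗᵢ[ℝ] EuclideanSpace ℝ (Fin k)
  annihilates : ∀ x, e x ∈ annihilator (V q)
  eval_eq : ∀ x i, (e x (b i) : ℝ) = A x i
  prob : IsProbabilityMeasure ν
  memLp : ∀ f : annihilator (S.distr q) →ₗ[ℝ] ℝ, MemLp f 2 ν
  eq_map : m = ((unitSphereMeasure k).prod ν).map
    (fun p => e (p.1 : EuclideanSpace ℝ (Fin k)) + (p.2 : CotSpace n q))

attribute [instance] FibreData.prob

variable {S : Structure n k M} {V : Π q : M, Submodule ℝ (TangentSpace (𝓡 n) q)}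
  {q : M} {b : Fin k → S.distr q}

theorem continuous_linearMap_cotSpace (e : EuclideanSpace ℝ (Fin k) →ₗ[ℝ] CotSpace n q) :
    Continuous e := e.continuous_of_finiteDimensional

/-- The map `x ↦ (⟨e x, b_i⟩)_i` preserves norms, because `2H` is the sum of squares in the basis
`b`. Rotation invariance of the sphere measure later removes the dependence on this isometry. -/
theorem Structure.IsAdapted.nonempty_fibreData {μ : Π q : M, Measure (CotSpace n q)}
    (hμ : S.IsAdapted V μ) (hb : S.IsOrthonormal q b) : Nonempty (FibreData S V q b (μ q)) := by
  obtain ⟨s, ν, ⟨e, he, hH, rfl⟩, hν, hL, hm⟩ := hμ.product q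
  let A₀ : EuclideanSpace ℝ (Fin k) →ₗ[ℝ] EuclideanSpace ℝ (Fin k) :=
    { toFun := fun x => WithLp.toLp 2 fun i => (e x (b i) : ℝ)
      map_add' := fun x y => by ext i; simp
      map_smul' := fun c x => by ext i; simp }
  have hA : ∀ x, ‖A₀ x‖ = ‖x‖ := by
    intro x
    have h := hH x
    rw [S.hamiltonian_eq ⟨q, e x⟩ hb] at h
    rw [← sq_eq_sq₀ (norm_nonneg _) (norm_nonneg _), ← h, EuclideanSpace.real_norm_sq_eq]
    simp [A₀]
  refine ⟨⟨e, ν, LinearIsometry.toLinearIsometryEquiv ⟨A₀, hA⟩ rfl, he, fun x i => rfl, hν, hL, ?_⟩⟩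
  have hec : Continuous fun x : Metric.sphere (0 : EuclideanSpace ℝ (Fin k)) 1 =>
      e (x : EuclideanSpace ℝ (Fin k)) :=
    (continuous_linearMap_cotSpace e).comp continuous_subtype_val
  have h1 := Measure.map_prod_map (unitSphereMeasure k) ν hec.measurable measurable_id
  rw [Measure.map_id] at h1
  rw [hm, h1, Measure.map_map _ (hec.measurable.prodMap measurable_id)]
  · rfl
  · exact measurable_fst.add (measurable_subtype_coe.comp measurable_snd)

namespace FibreData

variable {m : Measure (CotSpace n q)}

theorem measurable_sum (F : FibreData S V q b m) :
    Measurable fun p : Metric.sphere (0 : EuclideanSpace ℝ (Fin k)) 1 × annihilator (S.distr q) =>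
      F.e (p.1 : EuclideanSpace ℝ (Fin k)) + (p.2 : CotSpace n q) := by
  have h : Measurable fun x : Metric.sphere (0 : EuclideanSpace ℝ (Fin k)) 1 =>
      F.e (x : EuclideanSpace ℝ (Fin k)) :=
    ((continuous_linearMap_cotSpace F.e).comp continuous_subtype_val).measurable
  exact (h.comp measurable_fst).add (measurable_subtype_coe.comp measurable_snd)

theorem integral_eq (F : FibreData S V q b m) {f : CotSpace n q → ℝ} (hf : Continuous f) :
    ∫ l, f l ∂m = ∫ p, f (F.e (p.1 : EuclideanSpace ℝ (Fin k)) + (p.2 : CotSpace n q))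
      ∂(unitSphereMeasure k).prod F.ν :=
  (congrArg (fun m' => ∫ l, f l ∂m') F.eq_map).trans
    (integral_map F.measurable_sum.aemeasurable hf.aestronglyMeasurable)

theorem eval_sum (F : FibreData S V q b m) (x : EuclideanSpace ℝ (Fin k))
    (y : annihilator (S.distr q)) (i : Fin k) :
    ((F.e x + (y : CotSpace n q)) (b i) : ℝ) = F.A x i := by
  have h1 : ((y : CotSpace n q) (b i : TangentSpace (𝓡 n) q) : ℝ) = 0 := y.2 _ (b i).2
  have h2 := F.eval_eq x i
  change ((F.e x) (b i) : ℝ) + ((y : CotSpace n q) (b i) : ℝ) = _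
  rw [h1, h2, add_zero]

theorem isProbabilityMeasure (F : FibreData S V q b m) (hk : 0 < k) : IsProbabilityMeasure m := by
  have := isProbabilityMeasure_unitSphereMeasure hk
  rw [F.eq_map]
  exact Measure.isProbabilityMeasure_map F.measurable_sum.aemeasurable

theorem isFiniteMeasure (F : FibreData S V q b m) : IsFiniteMeasure m := by
  rw [F.eq_map]
  infer_instance

theorem mem_cylinder_iff (hb : S.IsOrthonormal q b) (l : CotSpace n q) :
    l ∈ S.cylinder q ↔ ∑ i, (l (b i) : ℝ) ^ 2 = 1 := by
  change 2 * S.hamiltonian ⟨q, l⟩ = 1 ↔ _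
  rw [S.hamiltonian_eq ⟨q, l⟩ hb]
  ring_nf

theorem isClosed_cylinder (hb : S.IsOrthonormal q b) : IsClosed (S.cylinder q) := by
  have : S.cylinder q = {l : CotSpace n q | ∑ i, (l (b i) : ℝ) ^ 2 = 1} :=
    Set.ext (mem_cylinder_iff hb)
  rw [this]
  exact isClosed_eq (continuous_finsetSum _ fun i _ => (continuous_eval_cotSpace _).pow 2)
    continuous_const

theorem ae_mem_cylinder (F : FibreData S V q b m) (hb : S.IsOrthonormal q b) :
    ∀ᵐ l ∂m, l ∈ S.cylinder q := by
  have hm : MeasurableSet {l | l ∈ S.cylinder q} := (isClosed_cylinder hb).measurableSet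
  rw [F.eq_map, ae_map_iff F.measurable_sum.aemeasurable hm]
  refine Eventually.of_forall fun p => ?_
  rw [mem_cylinder_iff hb]
  simp_rw [F.eval_sum]
  rw [← EuclideanSpace.real_norm_sq_eq, F.A.norm_map, norm_eq_of_mem_sphere, one_pow]

/-- Evaluation at a tangent vector, as a linear function on the annihilator. -/
def evalAnnihilator (S : Structure n k M) (u : TangentSpace (𝓡 n) q) :
    annihilator (S.distr q) →ₗ[ℝ] ℝ where
  toFun y := (y : CotSpace n q) u
  map_add' _ _ := rfl
  map_smul' _ _ := rfl

/-- The horizontal part is continuous on a compact sphere; the vertical part is square integrable by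
assumption. -/
theorem memLp_eval (F : FibreData S V q b m) (u : TangentSpace (𝓡 n) q) :
    MemLp (fun l => (l u : ℝ)) 2 m := by
  rw [F.eq_map, memLp_map_measure_iff (continuous_eval_cotSpace u).aestronglyMeasurable
    F.measurable_sum.aemeasurable]
  have h1 : MemLp (fun x : Metric.sphere (0 : EuclideanSpace ℝ (Fin k)) 1 => (F.e x u : ℝ)) 2
      (unitSphereMeasure k) := by
    have hc : Continuous fun x : Metric.sphere (0 : EuclideanSpace ℝ (Fin k)) 1 =>
        (F.e x u : ℝ) :=
      (continuous_eval_cotSpace u).comp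
        ((continuous_linearMap_cotSpace F.e).comp continuous_subtype_val)
    exact hc.memLp_of_hasCompactSupport (HasCompactSupport.of_compactSpace _)
  exact (h1.comp_fst F.ν).add ((F.memLp (evalAnnihilator S u)).comp_snd (unitSphereMeasure k))

theorem integral_eval (F : FibreData S V q b m) (i : Fin k) : ∫ l, (l (b i) : ℝ) ∂m = 0 := by
  rw [F.integral_eq (continuous_eval_cotSpace _)]
  simp_rw [F.eval_sum]
  rw [integral_fun_fst (fun x : Metric.sphere (0 : EuclideanSpace ℝ (Fin k)) 1 => F.A x i),
    integral_sphere_isometry F.A (f := fun x : EuclideanSpace ℝ (Fin k) => x i) (by fun_prop),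
    integral_sphere_apply, smul_zero]

/-- The decisive moment. Here `c` is the component of `w` along `D`, modulo `V`. The vertical part
of the covector sees `w` but not `b j`, and so contributes the product of its mean with the zero
mean of a coordinate on the sphere. -/
theorem integral_eval_mul_eval (F : FibreData S V q b m) (c : Fin k → ℝ)
    {w : TangentSpace (𝓡 n) q} (hw : w - ∑ i, c i • (b i : TangentSpace (𝓡 n) q) ∈ V q)
    (j : Fin k) : ∫ l, (l (b j) : ℝ) * l w ∂m = c j / k := by
  -- The horizontal part kills `w - ∑ c_i b_i`, hence it sees only the coefficients `c`.
  have hev : ∀ (x : EuclideanSpace ℝ (Fin k)) (y : annihilator (S.distr q)),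
      ((F.e x + (y : CotSpace n q)) w : ℝ) = ∑ i, c i * F.A x i + evalAnnihilator S w y := by
    intro x y
    have h0 := F.annihilates x _ hw
    rw [map_sub, sub_eq_zero, map_sum] at h0
    change (F.e x w : ℝ) + _ = _
    congr 1
    rw [h0]
    exact Finset.sum_congr rfl fun i _ => by rw [map_smul, ← F.eval_eq x i]; rfl
  rw [F.integral_eq (f := fun l => (l (b j) : ℝ) * l w)
    ((continuous_eval_cotSpace _).mul (continuous_eval_cotSpace _))]
  simp_rw [F.eval_sum, hev, mul_add, Finset.mul_sum]
  have hA : ∀ i : Fin k, Continuous fun x : EuclideanSpace ℝ (Fin k) => F.A x i := fun i => by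
    have := F.A.continuous
    fun_prop
  have hint1 : ∀ i : Fin k, Integrable (fun p : Metric.sphere (0 : EuclideanSpace ℝ (Fin k)) 1 ×
      annihilator (S.distr q) => F.A p.1 j * (c i * F.A p.1 i))
      ((unitSphereMeasure k).prod F.ν) := fun i =>
    (integrable_sphere (f := fun x => F.A x j * (c i * F.A x i))
      ((hA j).mul (continuous_const.mul (hA i)))).comp_fst F.ν
  have hint2 : Integrable (fun p : Metric.sphere (0 : EuclideanSpace ℝ (Fin k)) 1 ×
      annihilator (S.distr q) => F.A p.1 j * evalAnnihilator S w p.2)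
      ((unitSphereMeasure k).prod F.ν) :=
    (integrable_sphere (hA j)).mul_prod
      ((F.memLp (evalAnnihilator S w)).integrable one_le_two)
  rw [integral_add (integrable_finsetSum _ fun i _ => hint1 i) hint2,
    integral_finsetSum _ fun i _ => hint1 i,
    integral_prod_mul (fun x : Metric.sphere (0 : EuclideanSpace ℝ (Fin k)) 1 => F.A x j)]
  have h1 := integral_sphere_isometry F.A (f := fun x : EuclideanSpace ℝ (Fin k) => x j)
    (by fun_prop)
  rw [h1, integral_sphere_apply, zero_mul, add_zero]
  have h2 : ∀ i : Fin k, ∫ p : Metric.sphere (0 : EuclideanSpace ℝ (Fin k)) 1 ×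
      annihilator (S.distr q), F.A p.1 j * (c i * F.A p.1 i) ∂(unitSphereMeasure k).prod F.ν =
      c i * if j = i then (k : ℝ)⁻¹ else 0 := by
    intro i
    rw [integral_fun_fst (fun x : Metric.sphere (0 : EuclideanSpace ℝ (Fin k)) 1 =>
      F.A x j * (c i * F.A x i)), ← integral_sphere_mul, ← integral_const_mul,
      ← integral_sphere_isometry F.A
        (f := fun x : EuclideanSpace ℝ (Fin k) => c i * (x j * x i)) (by fun_prop)]
    simp only [probReal_univ, one_smul]
    congr 1
    funext x
    ring
  rw [Finset.sum_congr rfl fun i _ => h2 i]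
  simp [div_eq_mul_inv]

end FibreData

end Adapted

/-! ### Locality and cut-off -/

section Germs

variable {E : Type*} [NormedAddCommGroup E] [NormedSpace ℝ E] {k : ℕ}

theorem frameDeriv_eventuallyEq {X Y : Fin k → E → E} {f g : E → ℝ} {x : E}
    (hX : ∀ i, X i =ᶠ[𝓝 x] Y i) (hf : f =ᶠ[𝓝 x] g) (i : Fin k) :
    frameDeriv X i f =ᶠ[𝓝 x] frameDeriv Y i g := by
  filter_upwards [hX i, hf.fderiv (𝕜 := ℝ)] with y h1 h2
  simp [frameDeriv, h1, h2]

theorem hamField_congr {X Y : Fin k → E → E} {z : E × (E →L[ℝ] ℝ)}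
    (hX : ∀ i, X i =ᶠ[𝓝 z.1] Y i) : hamField X z = hamField Y z := by
  simp only [hamField, momentum, fun i => (hX i).eq_of_nhds, fun i => (hX i).fderiv_eq (𝕜 := ℝ)]

theorem firstDeriv_congr {X Y : Fin k → E → E} {f g : E → ℝ} {z : E × (E →L[ℝ] ℝ)}
    (hX : ∀ i, X i =ᶠ[𝓝 z.1] Y i) (hf : f =ᶠ[𝓝 z.1] g) : firstDeriv X f z = firstDeriv Y g z := by
  simp only [firstDeriv, momentum, fun i => (hX i).eq_of_nhds,
    fun i => (frameDeriv_eventuallyEq hX hf i).eq_of_nhds]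

theorem secondDeriv_congr {X Y : Fin k → E → E} {f g : E → ℝ} {z : E × (E →L[ℝ] ℝ)}
    (hX : ∀ i, X i =ᶠ[𝓝 z.1] Y i) (hf : f =ᶠ[𝓝 z.1] g) :
    secondDeriv X f z = secondDeriv Y g z := by
  simp only [secondDeriv, momentum, fun i => (hX i).eq_of_nhds,
    fun i => (frameDeriv_eventuallyEq hX hf i).eq_of_nhds,
    fun i j => (frameDeriv_eventuallyEq hX (frameDeriv_eventuallyEq hX hf i) j).eq_of_nhds,
    fun i j => ((hX j).lieBracket_vectorField_eq (𝕜 := ℝ) (hX i))]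

/-- A function that is smooth on an open set can be cut off. -/
theorem contDiff_bump_smul [FiniteDimensional ℝ E] {x₀ : E} {F : Type*}
    [NormedAddCommGroup F] [NormedSpace ℝ F] [HasContDiffBump E] (χ : ContDiffBump x₀)
    {f : E → F} {G : Set E} (hG : IsOpen G) (hf : ContDiffOn ℝ ∞ f G)
    (hχ : Metric.closedBall x₀ χ.rOut ⊆ G) : ContDiff ℝ ∞ (fun x => χ x • f x) := by
  rw [contDiff_iff_contDiffAt]
  intro x
  by_cases hx : x ∈ G
  · exact χ.contDiff.contDiffAt.smul (hf.contDiffAt (hG.mem_nhds hx))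
  · have hx' : x ∉ tsupport χ := fun h => hx (hχ (by rwa [χ.tsupport_eq] at h))
    have : (fun x => χ x • f x) =ᶠ[𝓝 x] fun _ => 0 := by
      filter_upwards [(isClosed_tsupport _).isOpen_compl.mem_nhds hx'] with y hy
      rw [image_eq_zero_of_notMem_tsupport hy, zero_smul]
    exact contDiffAt_const.congr_of_eventuallyEq this

end Germs

/-! ### The exponential map and uniqueness of extremals -/

namespace Structure

variable {n k : ℕ} {M : Type*} [TopologicalSpace M]
  [ChartedSpace (EuclideanSpace ℝ (Fin n)) M] [IsManifold (𝓡 n) ∞ M]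

/-- The chosen curve and `Λ` solve the same `C¹` equation, as the Hamiltonian field is unique, and
they agree at `0`. They therefore coincide on the intersection of their intervals. -/
theorem exp_eq_of_isExtremalTo [T2Space M] (S : Structure n k M) {q : M} {l : CotSpace n q}
    {t : ℝ} (ht : 0 ≤ t) {Λ : ℝ → CotBundle n M} (h : S.IsExtremalTo q l t Λ) :
    S.exp q t l = (Λ t).proj := by
  have h' : ∃ Λ, S.IsExtremalTo q l t Λ := ⟨Λ, h⟩
  rw [exp, dif_pos h']
  obtain ⟨h0, v, hv, δ, hδ, hΛ⟩ := h
  obtain ⟨h0', v', hv', δ', hδ', hΛ'⟩ := h'.choose_spec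
  obtain rfl := hv.unique S.hasHamiltonianFrames hv'
  have := t2Space_cotBundle (n := n) (M := M)
  have hmin : 0 < min δ δ' := lt_min hδ hδ'
  have heq := isMIntegralCurveOn_Ioo_eqOn_of_contMDiff_boundaryless (I := cotModel n)
    (t₀ := 0) (a := -min δ δ') (b := t + min δ δ') (γ := Λ) (γ' := h'.choose)
    ⟨by linarith, by linarith⟩ (hv.contMDiff S.hasHamiltonianFrames)
    (hΛ.mono (Ioo_subset_Ioo (neg_le_neg (min_le_left _ _)) (by gcongr; exact min_le_left _ _)))
    (hΛ'.mono (Ioo_subset_Ioo (neg_le_neg (min_le_right _ _)) (by gcongr; exact min_le_right _ _)))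
    (h0.trans h0'.symm)
  exact congrArg TotalSpace.proj (heq ⟨by linarith, by linarith⟩).symm

end Structure

/-! ### Local Hamiltonian curves with uniform existence time -/

section LocalFlow

variable {E : Type*} [NormedAddCommGroup E] [NormedSpace ℝ E] {k : ℕ}

/-- The Hamiltonian curves of unit energy of a frame that is smooth on an open set `G` exist for a
uniform time near a point of `G`, depend continuously on the initial covector, and satisfy a Taylor
formula whose error is controlled by the initial momentum. -/
theorem exists_local_hamCurves [FiniteDimensional ℝ E] [HasContDiffBump E] {X : Fin k → E → E}
    {G : Set E} (hG : IsOpen G) (hX : ∀ i, ContDiffOn ℝ ∞ (X i) G) {x₀ : E} (hx₀ : x₀ ∈ G) :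
    ∃ (r ε : ℝ) (Z : E × (E →L[ℝ] ℝ) → ℝ → E × (E →L[ℝ] ℝ)), 0 < r ∧ 0 < ε ∧
      (∀ z₀, z₀.1 ∈ Metric.ball x₀ r → energy X z₀ = 1 → Z z₀ 0 = z₀ ∧ ∀ t ∈ Ico 0 ε, ∃ δ > 0,
        ∀ s ∈ Ioo (-δ) (t + δ), (Z z₀ s).1 ∈ G ∧ HasDerivAt (Z z₀) (hamField X (Z z₀ s)) s) ∧
      (∀ t ∈ Ico 0 ε, ContinuousOn (fun z₀ => Z z₀ t)
        {z₀ | z₀.1 ∈ Metric.ball x₀ r ∧ energy X z₀ = 1}) ∧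
      ∀ f : E → ℝ, ContDiffOn ℝ ∞ f G → ∃ B, 0 ≤ B ∧ ∀ z₀, z₀.1 ∈ Metric.ball x₀ r →
        energy X z₀ = 1 → ∀ t ∈ Ico 0 ε,
          |f (Z z₀ t).1 - f z₀.1 - t * firstDeriv X f z₀ - t ^ 2 / 2 * secondDeriv X f z₀| ≤
            B * (1 + ‖z₀.2‖ ^ 2) * t ^ 3 := by
  obtain ⟨R, hR, hRG⟩ := Metric.nhds_basis_closedBall.mem_iff.1 (hG.mem_nhds hx₀)
  -- Curves start within `r` of `x₀` and travel at most `r`; they stay in the ball of radius `2 *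
  -- r`, where the cut-off `χ` is one.
  set r := R / 3 with hr
  have hr0 : 0 < r := by positivity
  let χ : ContDiffBump x₀ := ⟨2 * r, R, by positivity, by linarith⟩
  set Y : Fin k → E → E := fun i x => χ x • X i x with hY
  have hYs : ∀ i, ContDiff ℝ ∞ (Y i) := fun i => contDiff_bump_smul χ hG (hX i) hRG
  have hYc : ∀ i, HasCompactSupport (Y i) := fun i => χ.hasCompactSupport.smul_right
  have hχ1 : ∀ x ∈ Metric.ball x₀ (2 * r), χ =ᶠ[𝓝 x] 1 := fun x hx => by
    filter_upwards [Metric.isOpen_ball.mem_nhds hx] with y hy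
    exact χ.one_of_mem_closedBall (Metric.ball_subset_closedBall hy)
  have hYX : ∀ x ∈ Metric.ball x₀ (2 * r), ∀ i, Y i =ᶠ[𝓝 x] X i := fun x hx i => by
    filter_upwards [hχ1 x hx] with y hy
    simp [hY, hy]
  have hsub : Metric.ball x₀ (2 * r) ⊆ G := fun x hx =>
    hRG (Metric.closedBall_subset_closedBall (by linarith) (Metric.ball_subset_closedBall hx))
  have hsub' : Metric.ball x₀ r ⊆ Metric.ball x₀ (2 * r) := Metric.ball_subset_ball (by linarith)
  have hen : ∀ z₀ : E × (E →L[ℝ] ℝ), z₀.1 ∈ Metric.ball x₀ r → energy X z₀ = 1 →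
      energy Y z₀ = 1 := fun z₀ h1 h2 => by
    rw [← h2]
    simp only [energy, momentum, fun i => (hYX _ (hsub' h1) i).eq_of_nhds]
  obtain ⟨C, hC⟩ := exists_frameBound hYs hYc
  choose! Z hZ using fun z₀ (h : energy Y z₀ = 1) => exists_isHamCurve hYs hYc hC h
  set D := max C (Real.exp C) with hD
  have hD0 : 0 ≤ D := hC.nonneg.trans (le_max_left _ _)
  -- `D` bounds the speed of the position; `D + 1` avoids a division by zero.
  set ε := min 1 (r / (D + 1)) with hε
  have hε0 : 0 < ε := by positivity
  have hε1 : ∀ t ∈ Ico 0 ε, t ∈ Ico (0 : ℝ) 1 := fun t ht =>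
    ⟨ht.1, ht.2.trans_le (min_le_left _ _)⟩
  have hmem : ∀ z₀ : E × (E →L[ℝ] ℝ), z₀.1 ∈ Metric.ball x₀ r → energy X z₀ = 1 →
      ∀ t ∈ Ico 0 ε, (Z z₀ t).1 ∈ Metric.ball x₀ (2 * r) := by
    intro z₀ h1 h2 t ht
    have h3 := (hZ z₀ (hen z₀ h1 h2)).norm_fst_le t (hε1 t ht)
    have h4 : D * t ≤ r := by
      have h5 : t * (D + 1) ≤ r :=
        (le_div_iff₀ (by positivity)).1 (ht.2.le.trans (min_le_right _ _))
      nlinarith [ht.1]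
    rw [mem_ball_iff_norm] at h1 ⊢
    calc ‖(Z z₀ t).1 - x₀‖ ≤ ‖(Z z₀ t).1 - z₀.1‖ + ‖z₀.1 - x₀‖ := by
          simpa using norm_add_le ((Z z₀ t).1 - z₀.1) (z₀.1 - x₀)
      _ < 2 * r := by linarith
  refine ⟨r, ε, Z, hr0, hε0, fun z₀ h1 h2 => ⟨(hZ z₀ (hen z₀ h1 h2)).init, fun t ht => ?_⟩,
    fun t ht => ?_, fun f hf => ?_⟩
  · have hz := hZ z₀ (hen z₀ h1 h2)
    obtain ⟨δ, hδ, hd⟩ := hz.hasDerivAt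
    have hc0 : ContinuousAt (fun s => (Z z₀ s).1) 0 :=
      continuous_fst.continuousAt.comp (hz.hasDerivAt_of_mem ⟨le_rfl, one_pos⟩).continuousAt
    have hb0 : (Z z₀ 0).1 ∈ Metric.ball x₀ (2 * r) := hmem z₀ h1 h2 0 ⟨le_rfl, hε0⟩
    -- The travel bound concerns nonnegative times; small negative times are handled by continuity
    -- at `0`.
    obtain ⟨δ', hδ', hb⟩ := Metric.eventually_nhds_iff.1
      (hc0.eventually (Metric.isOpen_ball.mem_nhds hb0))
    refine ⟨min (min δ δ') (ε - t), lt_min (lt_min hδ hδ') (sub_pos.2 ht.2), fun s hs => ?_⟩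
    have hs1 : -min (min δ δ') (ε - t) < s := hs.1
    have hs2 : s < ε := by
      have := min_le_right (min δ δ') (ε - t)
      linarith [hs.2]
    have hsδ : -δ < s := by
      have : min (min δ δ') (ε - t) ≤ δ := (min_le_left _ _).trans (min_le_left _ _)
      linarith
    have hsδ' : -δ' < s := by
      have : min (min δ δ') (ε - t) ≤ δ' := (min_le_left _ _).trans (min_le_right _ _)
      linarith
    have hball : (Z z₀ s).1 ∈ Metric.ball x₀ (2 * r) := by
      rcases le_or_gt 0 s with h0 | h0
      · exact hmem z₀ h1 h2 s ⟨h0, hs2⟩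
      · exact hb (by rw [Real.dist_eq, sub_zero, abs_of_neg h0]; linarith)
    refine ⟨hsub hball, ?_⟩
    have h5 := hd s ⟨hsδ, hs2.trans_le (min_le_left _ _)⟩
    rwa [hamField_congr (hYX _ hball)] at h5
  · exact (continuousOn_hamCurve hYs hYc hD0 (A := {z₀ | energy Y z₀ = 1}) (Z := Z)
      (fun z₀ h => hZ z₀ h) (hε1 t ht)).mono fun z₀ h => hen z₀ h.1 h.2
  · set g : E → ℝ := fun x => χ x • f x with hg
    have hgf : ∀ x ∈ Metric.ball x₀ (2 * r), g =ᶠ[𝓝 x] f := fun x hx => by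
      filter_upwards [hχ1 x hx] with y hy
      simp [hg, hy]
    obtain ⟨B, hB⟩ := hamCurve_taylor hYs hYc D hD0 (contDiff_bump_smul χ hG hf hRG)
      (f := g) χ.hasCompactSupport.smul_right
    refine ⟨max B 0, le_max_right _ _, fun z₀ h1 h2 t ht => ?_⟩
    have h3 := hB z₀ _ (hZ z₀ (hen z₀ h1 h2)) t (hε1 t ht)
    rw [(hgf _ (hmem z₀ h1 h2 t ht)).eq_of_nhds, (hgf _ (hsub' h1)).eq_of_nhds,
      firstDeriv_congr (hYX _ (hsub' h1)) (hgf _ (hsub' h1)),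
      secondDeriv_congr (hYX _ (hsub' h1)) (hgf _ (hsub' h1))] at h3
    refine h3.trans ?_
    have := ht.1
    gcongr
    exact le_max_left _ _

end LocalFlow

/-! ### Taylor expansion along geodesics of the manifold -/

namespace Structure

variable {n k : ℕ} {M : Type*} [TopologicalSpace M]
  [ChartedSpace (EuclideanSpace ℝ (Fin n)) M] [IsManifold (𝓡 n) ∞ M]

theorem continuous_coordP (q₀ q : M) :
    Continuous fun l : CotSpace n q => coordP q₀ (⟨q, l⟩ : CotBundle n M) := by
  have h : Continuous fun l : EuclideanSpace ℝ (Fin n) →L[ℝ] ℝ => l.comp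
      ((mfderiv (𝓡 n) 𝓘(ℝ, EuclideanSpace ℝ (Fin n)) (extChartAt (𝓡 n) q₀) q).inverse :
        EuclideanSpace ℝ (Fin n) →L[ℝ] EuclideanSpace ℝ (Fin n)) := by fun_prop
  exact h

/-- The second order Taylor polynomial of a function along the geodesics, in the chart at `q₀`. -/
theorem exists_local_taylor [T2Space M] {S : Structure n k M} {U : Set M}
    {X : Fin k → Π q : M, TangentSpace (𝓡 n) q} (hX : S.IsOrthonormalFrame U X) {q₀ : M}
    (hq₀ : q₀ ∈ U) :
    ∃ ε > 0, ∃ W ∈ 𝓝 q₀, W ⊆ U ∧ W ⊆ (extChartAt (𝓡 n) q₀).source ∧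
      (∀ q ∈ W, ∀ t ∈ Ico 0 ε, (∀ l ∈ S.cylinder q, (t, l) ∈ S.expDomain q) ∧
        ContinuousOn (S.exp q t) (S.cylinder q)) ∧
      ∀ φ : M → ℝ, ContMDiff (𝓡 n) 𝓘(ℝ, ℝ) ∞ φ → ∃ B, 0 ≤ B ∧ ∀ q ∈ W, ∀ l ∈ S.cylinder q,
        ∀ t ∈ Ico 0 ε,
        |φ (S.exp q t l) - φ q -
          t * firstDeriv (fun i => localField q₀ (X i)) (φ ∘ (extChartAt (𝓡 n) q₀).symm)
            (cotChart q₀ ⟨q, l⟩) -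
          t ^ 2 / 2 * secondDeriv (fun i => localField q₀ (X i))
            (φ ∘ (extChartAt (𝓡 n) q₀).symm) (cotChart q₀ ⟨q, l⟩)| ≤
          B * (1 + ‖coordP q₀ (⟨q, l⟩ : CotBundle n M)‖ ^ 2) * t ^ 3 := by
  set G := (extChartAt (𝓡 n) q₀).target ∩ (extChartAt (𝓡 n) q₀).symm ⁻¹' U with hGdef
  have hG : IsOpen G :=
    (continuousOn_extChartAt_symm q₀).isOpen_inter_preimage (isOpen_extChartAt_target q₀) hX.isOpen
  have hx₀ : extChartAt (𝓡 n) q₀ q₀ ∈ G :=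
    ⟨mem_extChartAt_target q₀, by rw [mem_preimage, extChartAt_to_inv]; exact hq₀⟩
  obtain ⟨r, ε, Z, hr, hε, hZ, hZc, hZT⟩ := exists_local_hamCurves hG
    (X := fun i => localField q₀ (X i)) (fun i => contDiffOn_localField hX.isOpen (hX.smooth i)) hx₀
  obtain ⟨v, hv⟩ := exists_isHamiltonianField S.hasHamiltonianFrames
  set W := U ∩ ((extChartAt (𝓡 n) q₀).source ∩
    extChartAt (𝓡 n) q₀ ⁻¹' Metric.ball (extChartAt (𝓡 n) q₀ q₀) r) with hW
  have hWn : W ∈ 𝓝 q₀ := inter_mem (hX.isOpen.mem_nhds hq₀)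
    (inter_mem (extChartAt_source_mem_nhds q₀) ((continuousAt_extChartAt q₀).preimage_mem_nhds
      (Metric.ball_mem_nhds _ hr)))
  have hen : ∀ q ∈ W, ∀ l ∈ S.cylinder q,
      energy (fun i => localField q₀ (X i)) (cotChart q₀ ⟨q, l⟩) = 1 := by
    intro q hq l hl
    rw [FibreData.mem_cylinder_iff (hX.orthonormal q hq.1)] at hl
    rw [← hl, energy]
    exact Finset.sum_congr rfl fun i _ => by rw [momentum_localField hq.2.1]
  have hfst : ∀ q ∈ W, ∀ l : CotSpace n q, (cotChart q₀ ⟨q, l⟩).1 = extChartAt (𝓡 n) q₀ q := by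
    intro q hq l
    rw [cotChart_apply hq.2.1]
    rfl
  have hsnd : ∀ q ∈ W, ∀ l : CotSpace n q, (cotChart q₀ ⟨q, l⟩).2 = coordP q₀ ⟨q, l⟩ := by
    intro q hq l
    rw [cotChart_apply hq.2.1]
  have hball : ∀ q ∈ W, ∀ l : CotSpace n q,
      (cotChart q₀ ⟨q, l⟩).1 ∈ Metric.ball (extChartAt (𝓡 n) q₀ q₀) r := by
    intro q hq l
    rw [hfst q hq]
    exact hq.2.2
  have hext : ∀ q ∈ W, ∀ l ∈ S.cylinder q, ∀ t ∈ Ico 0 ε, S.IsExtremalTo q l t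
      (fun s => (cotChart q₀).symm (Z (cotChart q₀ ⟨q, l⟩) s)) := by
    intro q hq l hl t ht
    obtain ⟨h0, h1⟩ := hZ _ (hball q hq l) (hen q hq l hl)
    obtain ⟨δ, hδ, h2⟩ := h1 t ht
    refine ⟨?_, v, hv, δ, hδ, isMIntegralCurveOn_cotChart_symm hX.isHamiltonianFrame hv
      (fun s hs => (h2 s hs).1.1) (fun s hs => (h2 s hs).1.2) fun s hs => (h2 s hs).2⟩
    beta_reduce
    rw [h0]
    exact (cotChart q₀).left_inv (by rw [cotChart_source]; exact hq.2.1)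
  have hZG : ∀ q ∈ W, ∀ l ∈ S.cylinder q, ∀ t ∈ Ico 0 ε, (Z (cotChart q₀ ⟨q, l⟩) t).1 ∈ G := by
    intro q hq l hl t ht
    obtain ⟨δ, hδ, h2⟩ := (hZ _ (hball q hq l) (hen q hq l hl)).2 t ht
    exact (h2 t ⟨by linarith [ht.1], by linarith⟩).1
  have hexp : ∀ q ∈ W, ∀ l ∈ S.cylinder q, ∀ t ∈ Ico 0 ε, S.exp q t l =
      (extChartAt (𝓡 n) q₀).symm (Z (cotChart q₀ ⟨q, l⟩) t).1 := by
    intro q hq l hl t ht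
    rw [S.exp_eq_of_isExtremalTo ht.1 (hext q hq l hl t ht),
      proj_cotChart_symm (hZG q hq l hl t ht).1]
  refine ⟨ε, hε, W, hWn, inter_subset_left, fun q hq => hq.2.1,
    fun q hq t ht => ⟨fun l hl => ⟨ht.1, _, hext q hq l hl t ht⟩, ?_⟩, fun φ hφ => ?_⟩
  -- Continuity in the covector on the cylinder yields measurability of the integrand.
  · have hc : ContinuousOn (fun l : CotSpace n q => Z (cotChart q₀ ⟨q, l⟩) t) (S.cylinder q) := by
      refine (hZc t ht).comp ?_ fun l hl => ⟨hball q hq l, hen q hq l hl⟩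
      have : (fun l : CotSpace n q => cotChart q₀ (⟨q, l⟩ : CotBundle n M)) =
          fun l => (extChartAt (𝓡 n) q₀ q, coordP q₀ ⟨q, l⟩) := funext fun l => cotChart_apply hq.2.1
      rw [this]
      exact (continuous_const.prodMk (continuous_coordP q₀ q)).continuousOn
    refine ContinuousOn.congr ?_ fun l hl => hexp q hq l hl t ht
    exact (continuousOn_extChartAt_symm q₀).comp (continuous_fst.comp_continuousOn hc)
      fun l hl => (hZG q hq l hl t ht).1
  · have hf : ContDiffOn ℝ ∞ (φ ∘ (extChartAt (𝓡 n) q₀).symm) G := by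
      rw [← contMDiffOn_iff_contDiffOn]
      exact (hφ.comp_contMDiffOn (contMDiffOn_extChartAt_symm q₀)).mono inter_subset_left
    obtain ⟨B, hB0, hB⟩ := hZT _ hf
    refine ⟨B, hB0, fun q hq l hl t ht => ?_⟩
    have h := hB _ (hball q hq l) (hen q hq l hl) t ht
    rw [hsnd q hq] at h
    have e1 : (φ ∘ (extChartAt (𝓡 n) q₀).symm) (Z (cotChart q₀ ⟨q, l⟩) t).1 =
        φ (S.exp q t l) := by
      rw [hexp q hq l hl t ht]; rfl
    have e2 : (φ ∘ (extChartAt (𝓡 n) q₀).symm) (cotChart q₀ (⟨q, l⟩ : CotBundle n M)).1 = φ q := by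
      rw [hfst q hq, Function.comp_apply, (extChartAt (𝓡 n) q₀).left_inv hq.2.1]
    rw [e1, e2] at h
    exact h

end Structure

/-! ### Averages of the Taylor coefficients -/

section Moments

variable {n k : ℕ} {M : Type*} [TopologicalSpace M]
  [ChartedSpace (EuclideanSpace ℝ (Fin n)) M] [IsManifold (𝓡 n) ∞ M]
  {S : Structure n k M} {V : Π q : M, Submodule ℝ (TangentSpace (𝓡 n) q)}

/-- The tangent vector at `q` with components `w` in the chart at `q₀`. -/
def chartVector (q₀ q : M) (w : EuclideanSpace ℝ (Fin n)) : TangentSpace (𝓡 n) q :=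
  (mfderiv (𝓡 n) 𝓘(ℝ, EuclideanSpace ℝ (Fin n)) (extChartAt (𝓡 n) q₀) q).inverse w

theorem coordP_apply (q₀ q : M) (l : CotSpace n q) (w : EuclideanSpace ℝ (Fin n)) :
    coordP q₀ (⟨q, l⟩ : CotBundle n M) w = l (chartVector q₀ q w) := rfl

theorem momentum_cotChart {q₀ q : M} (hq : q ∈ (extChartAt (𝓡 n) q₀).source) (l : CotSpace n q)
    (W : EuclideanSpace ℝ (Fin n) → EuclideanSpace ℝ (Fin n)) :
    momentum W (cotChart q₀ (⟨q, l⟩ : CotBundle n M)) =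
      l (chartVector q₀ q (W (extChartAt (𝓡 n) q₀ q))) := by
  rw [cotChart_apply hq]
  rfl

namespace FibreData

variable {q : M} {b : Fin k → S.distr q} {m : Measure (CotSpace n q)}

theorem integrable_eval_mul_eval (F : FibreData S V q b m) (u w : TangentSpace (𝓡 n) q) :
    Integrable (fun l => (l u : ℝ) * l w) m :=
  (F.memLp_eval u).integrable_mul (F.memLp_eval w)

theorem integrable_eval (F : FibreData S V q b m) (u : TangentSpace (𝓡 n) q) :
    Integrable (fun l => (l u : ℝ)) m :=
  have := F.isFiniteMeasure
  (F.memLp_eval u).integrable one_le_two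

theorem integral_eval_basis (F : FibreData S V q b m) (j i : Fin k) :
    ∫ l, (l (b j) : ℝ) * l (b i) ∂m = if j = i then (k : ℝ)⁻¹ else 0 := by
  rw [F.integral_eval_mul_eval (fun i' => if i' = i then 1 else 0) (by simp) j]
  split_ifs <;> simp

end FibreData

variable {U : Set M} {X : Fin k → Π q : M, TangentSpace (𝓡 n) q}

/-- The orthonormal basis at a point given by an orthonormal frame. -/
def Structure.IsOrthonormalFrame.basis (hX : S.IsOrthonormalFrame U X) {q : M} (hq : q ∈ U) :
    Fin k → S.distr q := fun i => ⟨X i q, hX.mem_distr i q hq⟩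

theorem firstDeriv_cotChart {q₀ q : M} (hs : q ∈ (extChartAt (𝓡 n) q₀).source)
    (f : EuclideanSpace ℝ (Fin n) → ℝ) (l : CotSpace n q) :
    firstDeriv (fun i => localField q₀ (X i)) f (cotChart q₀ ⟨q, l⟩) =
      ∑ i, (l (X i q) : ℝ) *
        frameDeriv (fun i => localField q₀ (X i)) i f (extChartAt (𝓡 n) q₀ q) := by
  refine Finset.sum_congr rfl fun i _ => ?_
  rw [momentum_localField hs, cotChart_apply hs]
  rfl

theorem secondDeriv_cotChart {q₀ q : M} (hs : q ∈ (extChartAt (𝓡 n) q₀).source)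
    (f : EuclideanSpace ℝ (Fin n) → ℝ) (l : CotSpace n q) :
    secondDeriv (fun i => localField q₀ (X i)) f (cotChart q₀ ⟨q, l⟩) =
      ∑ i, ∑ j, ((l (X j q) : ℝ) * l (chartVector q₀ q (VectorField.lieBracket ℝ
          (localField q₀ (X j)) (localField q₀ (X i)) (extChartAt (𝓡 n) q₀ q))) *
          frameDeriv (fun i => localField q₀ (X i)) i f (extChartAt (𝓡 n) q₀ q) +
        (l (X j q) : ℝ) * l (X i q) * frameDeriv (fun i => localField q₀ (X i)) j
          (frameDeriv (fun i => localField q₀ (X i)) i f) (extChartAt (𝓡 n) q₀ q)) := by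
  refine Finset.sum_congr rfl fun i _ => Finset.sum_congr rfl fun j _ => ?_
  rw [momentum_localField hs, momentum_localField hs, momentum_cotChart hs, cotChart_apply hs]
  rfl

theorem integrable_firstDeriv (hX : S.IsOrthonormalFrame U X) {q₀ q : M} (hq : q ∈ U)
    (hs : q ∈ (extChartAt (𝓡 n) q₀).source) {m : Measure (CotSpace n q)}
    (F : FibreData S V q (hX.basis hq) m) (f : EuclideanSpace ℝ (Fin n) → ℝ) :
    Integrable (fun l => firstDeriv (fun i => localField q₀ (X i)) f (cotChart q₀ ⟨q, l⟩)) m := by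
  simp only [firstDeriv_cotChart hs]
  exact integrable_finsetSum _ fun i _ => (F.integrable_eval _).mul_const _

theorem integral_firstDeriv (hX : S.IsOrthonormalFrame U X) {q₀ q : M} (hq : q ∈ U)
    (hs : q ∈ (extChartAt (𝓡 n) q₀).source) {m : Measure (CotSpace n q)}
    (F : FibreData S V q (hX.basis hq) m) (f : EuclideanSpace ℝ (Fin n) → ℝ) :
    ∫ l, firstDeriv (fun i => localField q₀ (X i)) f (cotChart q₀ ⟨q, l⟩) ∂m = 0 := by
  simp only [firstDeriv_cotChart hs]
  rw [integral_finsetSum _ fun i _ => (F.integrable_eval _).mul_const _]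
  refine Finset.sum_eq_zero fun i _ => ?_
  rw [integral_mul_const]
  exact mul_eq_zero_of_left (F.integral_eval i) _

theorem integrable_secondDeriv (hX : S.IsOrthonormalFrame U X) {q₀ q : M} (hq : q ∈ U)
    (hs : q ∈ (extChartAt (𝓡 n) q₀).source) {m : Measure (CotSpace n q)}
    (F : FibreData S V q (hX.basis hq) m) (f : EuclideanSpace ℝ (Fin n) → ℝ) :
    Integrable (fun l => secondDeriv (fun i => localField q₀ (X i)) f (cotChart q₀ ⟨q, l⟩)) m := by
  simp only [secondDeriv_cotChart hs]
  exact integrable_finsetSum _ fun i _ => integrable_finsetSum _ fun j _ =>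
    ((F.integrable_eval_mul_eval _ _).mul_const _).add
      ((F.integrable_eval_mul_eval _ _).mul_const _)

/-- The bracket term is paired with `h_j`, which selects the single coefficient `c i j j / k`; the
Hessian term keeps only its diagonal. The factor `k` cancels the `1 / k` of the sphere moments. -/
theorem integral_secondDeriv (hX : S.IsOrthonormalFrame U X) {q₀ q : M} (hq : q ∈ U)
    (hs : q ∈ (extChartAt (𝓡 n) q₀).source) {m : Measure (CotSpace n q)}
    (F : FibreData S V q (hX.basis hq) m) (f : EuclideanSpace ℝ (Fin n) → ℝ)
    {c : Fin k → Fin k → Fin k → ℝ}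
    (hc : ∀ i j, chartVector q₀ q (VectorField.lieBracket ℝ (localField q₀ (X j))
      (localField q₀ (X i)) (extChartAt (𝓡 n) q₀ q)) - ∑ a, c i j a • X a q ∈ V q) :
    k * ∫ l, secondDeriv (fun i => localField q₀ (X i)) f (cotChart q₀ ⟨q, l⟩) ∂m =
      ∑ i, frameDeriv (fun i => localField q₀ (X i)) i
          (frameDeriv (fun i => localField q₀ (X i)) i f) (extChartAt (𝓡 n) q₀ q) +
      ∑ i, ∑ j, c i j j *
        frameDeriv (fun i => localField q₀ (X i)) i f (extChartAt (𝓡 n) q₀ q) := by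
  rcases Nat.eq_zero_or_pos k with rfl | hk
  · simp
  have hk' : (k : ℝ) ≠ 0 := by positivity
  simp only [secondDeriv_cotChart hs]
  have hi : ∀ (i j : Fin k) (w : TangentSpace (𝓡 n) q) (a d : ℝ), Integrable
      (fun l => (l (X j q) : ℝ) * l w * a + (l (X j q) : ℝ) * l (X i q) * d) m :=
    fun i j w a d => ((F.integrable_eval_mul_eval _ _).mul_const _).add
      ((F.integrable_eval_mul_eval _ _).mul_const _)
  rw [integral_finsetSum _ fun i _ => integrable_finsetSum _ fun j _ => hi i j _ _ _,
    Finset.mul_sum, ← Finset.sum_add_distrib]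
  refine Finset.sum_congr rfl fun i _ => ?_
  rw [integral_finsetSum _ fun j _ => hi i j _ _ _, Finset.mul_sum]
  have h : ∀ j, (k : ℝ) * ∫ l, ((l (X j q) : ℝ) * l (chartVector q₀ q (VectorField.lieBracket ℝ
          (localField q₀ (X j)) (localField q₀ (X i)) (extChartAt (𝓡 n) q₀ q))) *
          frameDeriv (fun i => localField q₀ (X i)) i f (extChartAt (𝓡 n) q₀ q) +
        (l (X j q) : ℝ) * l (X i q) * frameDeriv (fun i => localField q₀ (X i)) j
          (frameDeriv (fun i => localField q₀ (X i)) i f) (extChartAt (𝓡 n) q₀ q)) ∂m =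
      (if j = i then frameDeriv (fun i => localField q₀ (X i)) j
          (frameDeriv (fun i => localField q₀ (X i)) i f) (extChartAt (𝓡 n) q₀ q) else 0) +
      c i j j * frameDeriv (fun i => localField q₀ (X i)) i f (extChartAt (𝓡 n) q₀ q) := by
    intro j
    have h1 := F.integral_eval_mul_eval (c i j) (hc i j) j
    have h2 := F.integral_eval_basis j i
    simp only [Structure.IsOrthonormalFrame.basis] at h1 h2
    rw [integral_add ((F.integrable_eval_mul_eval _ _).mul_const _)
      ((F.integrable_eval_mul_eval _ _).mul_const _), integral_mul_const, integral_mul_const,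
      h1, h2]
    split_ifs <;> field_simp <;> ring
  rw [Finset.sum_congr rfl fun j _ => h j, Finset.sum_add_distrib]
  simp

/-! ### Local bounds of the second moments -/

/-- Cauchy–Schwarz. The norm is replaced by squares of linear functions, to which the continuity
assumption on an adapted family applies. -/
theorem norm_sq_le_sum_sq (p : EuclideanSpace ℝ (Fin n) →L[ℝ] ℝ) :
    ‖p‖ ^ 2 ≤ ∑ i, p (EuclideanSpace.single i 1) ^ 2 := by
  have h0 : 0 ≤ ∑ i, p (EuclideanSpace.single i 1) ^ 2 := Finset.sum_nonneg fun i _ => sq_nonneg _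
  rw [← Real.sqrt_le_sqrt_iff h0, Real.sqrt_sq (norm_nonneg _)]
  refine p.opNorm_le_bound (Real.sqrt_nonneg _) fun x => ?_
  have hx : p x = ∑ i, p (EuclideanSpace.single i 1) * x i := by
    conv_lhs => rw [← (EuclideanSpace.basisFun (Fin n) ℝ).sum_repr x]
    simp [mul_comm]
  rw [hx, Real.norm_eq_abs, EuclideanSpace.norm_eq, ← Real.sqrt_mul h0]
  refine Real.abs_le_sqrt ?_
  simpa using Finset.sum_mul_sq_le_sq_mul_sq Finset.univ
    (fun i => p (EuclideanSpace.single i 1)) (fun i => x i)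

/-- Momentum coordinates exist only over a chart; the bump function extends them to continuous,
fibrewise linear functions on all of `T*M`, as `continuous_sq` demands. -/
theorem continuous_bump_mul_coordP [T2Space M] {q₀ : M} (χ : SmoothBumpFunction (𝓡 n) q₀)
    (w : EuclideanSpace ℝ (Fin n)) :
    Continuous fun z : CotBundle n M => χ z.proj * coordP q₀ z w := by
  have hproj : Continuous fun z : CotBundle n M => z.proj :=
    FiberBundle.continuous_proj (EuclideanSpace ℝ (Fin n) →L[ℝ] ℝ) (fun q : M => CotSpace n q)
  rw [continuous_iff_continuousAt]
  intro z
  by_cases hz : z.proj ∈ (extChartAt (𝓡 n) q₀).source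
  · have h1 : ContinuousAt (fun z' => (cotChart q₀ z').2 w) z :=
      ((contMDiffAt_cotChart hz).continuousAt.snd).clm_apply continuousAt_const
    have h2 : ContinuousAt (fun z' : CotBundle n M => coordP q₀ z' w) z := by
      refine h1.congr ?_
      filter_upwards [eventually_proj_mem (isOpen_extChartAt_source q₀) hz] with z' hz'
      rw [cotChart_apply hz']
    exact (χ.continuous.comp hproj).continuousAt.mul h2
  · have hz' : z.proj ∉ tsupport χ := fun h => hz (by
      rw [extChartAt_source]
      exact χ.tsupport_subset_chartAt_source h)
    have : (fun z : CotBundle n M => χ z.proj * coordP q₀ z w) =ᶠ[𝓝 z] fun _ => 0 := by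
      filter_upwards [eventually_proj_mem (isClosed_tsupport _).isOpen_compl hz'] with z' hz''
      rw [image_eq_zero_of_notMem_tsupport hz'', zero_mul]
    exact continuousAt_const.congr this.symm

theorem Structure.IsAdapted.exists_secondMoment_le [T2Space M]
    {μ : Π q : M, Measure (CotSpace n q)} (hμ : S.IsAdapted V μ) (q₀ : M) :
    ∃ K, 0 ≤ K ∧ ∀ᶠ q in 𝓝 q₀,
      ∫ l, ∑ i, coordP q₀ (⟨q, l⟩ : CotBundle n M) (EuclideanSpace.single i 1) ^ 2 ∂μ q ≤ K := by
  obtain ⟨χ⟩ : Nonempty (SmoothBumpFunction (𝓡 n) q₀) := inferInstance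
  have hc := fun i : Fin n => hμ.continuous_sq _
    (continuous_bump_mul_coordP χ (EuclideanSpace.single i 1)) fun q => by
      constructor
      · intro l l'
        simp only [coordP_apply]
        exact mul_add _ _ _
      · intro a l
        simp only [coordP_apply]
        exact mul_left_comm _ _ _
  set Q : M → ℝ := fun q => ∑ i : Fin n, ∫ l, (χ q *
    coordP q₀ (⟨q, l⟩ : CotBundle n M) (EuclideanSpace.single i 1)) ^ 2 ∂μ q with hQ
  have hQc : Continuous Q := continuous_finsetSum _ fun i _ => hc i
  have hQ0 : 0 ≤ Q q₀ := Finset.sum_nonneg fun i _ => integral_nonneg fun l => sq_nonneg _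
  refine ⟨Q q₀ + 1, by positivity, ?_⟩
  obtain ⟨U, X, hq₀, hX⟩ := S.exists_isOrthonormalFrame q₀
  -- Near `q₀` the bump function is one, and the continuous sum of moments stays below its value at
  -- `q₀` plus one.
  filter_upwards [χ.eventuallyEq_one, hQc.continuousAt.eventually_lt continuousAt_const
    (lt_add_one (Q q₀)), hX.isOpen.mem_nhds hq₀] with q h1 h2 h3
  obtain ⟨F⟩ := hμ.nonempty_fibreData (hX.orthonormal q h3)
  have h4 : ∀ i : Fin n, Integrable (fun l => coordP q₀ (⟨q, l⟩ : CotBundle n M)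
      (EuclideanSpace.single i 1) ^ 2) (μ q) := fun i => by
    simp only [coordP_apply, sq]
    exact F.integrable_eval_mul_eval _ _
  rw [integral_finsetSum _ fun i _ => h4 i]
  have h5 : Q q = ∑ i : Fin n, ∫ l, (coordP q₀ (⟨q, l⟩ : CotBundle n M)
      (EuclideanSpace.single i 1)) ^ 2 ∂μ q := by
    simp only [hQ, h1, Pi.one_apply, one_mul]
  rw [← h5]
  exact h2.le

end Moments

/-! ### The microscopic Laplacian near a point -/

section Laplacian

variable {n k : ℕ} {M : Type*} [TopologicalSpace M]
  [ChartedSpace (EuclideanSpace ℝ (Fin n)) M] [IsManifold (𝓡 n) ∞ M]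
  {S : Structure n k M} {V : Π q : M, Submodule ℝ (TangentSpace (𝓡 n) q)}
  {U : Set M} {X : Fin k → Π q : M, TangentSpace (𝓡 n) q}

theorem abs_average_sub_le {a b I₁ I₂ R t : ℝ} (ht : 0 < t) {κ : ℕ}
    (h : a = b + t * I₁ + t ^ 2 / 2 * I₂) (hI : I₁ = 0) (hb : |b| ≤ R * t ^ 3) :
    |2 * κ / t ^ 2 * a - κ * I₂| ≤ 2 * κ * R * t := by
  have : 2 * κ / t ^ 2 * a - κ * I₂ = 2 * κ / t ^ 2 * b := by
    rw [h, hI]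
    field_simp
    ring
  rw [this, abs_mul, abs_of_nonneg (by positivity)]
  calc 2 * κ / t ^ 2 * |b| ≤ 2 * κ / t ^ 2 * (R * t ^ 3) := by gcongr
    _ = 2 * κ * R * t := by field_simp

/-- Near each point the short geodesics are defined, the averages exist, and they differ from the
mean of the second derivatives along geodesics by an error that is linear in the time. -/
theorem Structure.IsAdapted.exists_local_estimate [T2Space M]
    {μ : Π q : M, Measure (CotSpace n q)} (hμ : S.IsAdapted V μ)
    (hX : S.IsOrthonormalFrame U X) {q₀ : M} (hq₀ : q₀ ∈ U) :
    ∃ ε > 0, ∃ W ∈ 𝓝 q₀,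
      (∀ q ∈ W, ∀ t ∈ Ico 0 ε, ∀ l ∈ S.cylinder q, (t, l) ∈ S.expDomain q) ∧
      (∀ φ : M → ℝ, ContMDiff (𝓡 n) 𝓘(ℝ, ℝ) ∞ φ → ∀ q ∈ W, ∀ t ∈ Ico 0 ε,
        Integrable (fun l => φ (S.exp q t l)) (μ q)) ∧
      ∀ φ : M → ℝ, ContMDiff (𝓡 n) 𝓘(ℝ, ℝ) ∞ φ → ∃ B, ∀ q ∈ W, ∀ t ∈ Ioo 0 ε,
        |S.geodesicAverage μ φ t q - k * ∫ l, secondDeriv (fun i => localField q₀ (X i))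
          (φ ∘ (extChartAt (𝓡 n) q₀).symm) (cotChart q₀ ⟨q, l⟩) ∂μ q| ≤ B * t := by
  obtain ⟨ε, hε, W, hW, hWU, hWs, hdom, hT⟩ := S.exists_local_taylor hX hq₀
  obtain ⟨K, hK, hKq⟩ := hμ.exists_secondMoment_le q₀
  set N : Π q : M, CotSpace n q → ℝ := fun q l =>
    ∑ i, coordP q₀ (⟨q, l⟩ : CotBundle n M) (EuclideanSpace.single i 1) ^ 2 with hN
  have hF : ∀ q (hq : q ∈ U), Nonempty (FibreData S V q (hX.basis hq) (μ q)) :=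
    fun q hq => hμ.nonempty_fibreData (hX.orthonormal q hq)
  have hNi : ∀ q ∈ W, Integrable (N q) (μ q) := fun q hq => by
    obtain ⟨F⟩ := hF q (hWU hq)
    simp only [hN, coordP_apply, sq]
    exact integrable_finsetSum _ fun i _ => F.integrable_eval_mul_eval _ _
  have hfin : ∀ q ∈ W, IsFiniteMeasure (μ q) := fun q hq => by
    obtain ⟨F⟩ := hF q (hWU hq)
    exact F.isFiniteMeasure
  have hae : ∀ q ∈ W, ∀ᵐ l ∂μ q, l ∈ S.cylinder q := fun q hq => by
    obtain ⟨F⟩ := hF q (hWU hq)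
    exact F.ae_mem_cylinder (hX.orthonormal q (hWU hq))
  have hbd : ∀ φ : M → ℝ, ContMDiff (𝓡 n) 𝓘(ℝ, ℝ) ∞ φ → ∃ B, 0 ≤ B ∧ ∀ q ∈ W, ∀ l ∈ S.cylinder q,
        ∀ t ∈ Ico 0 ε,
        |φ (S.exp q t l) - φ q -
          t * firstDeriv (fun i => localField q₀ (X i)) (φ ∘ (extChartAt (𝓡 n) q₀).symm)
            (cotChart q₀ ⟨q, l⟩) -
          t ^ 2 / 2 * secondDeriv (fun i => localField q₀ (X i))
            (φ ∘ (extChartAt (𝓡 n) q₀).symm) (cotChart q₀ ⟨q, l⟩)| ≤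
          B * (1 + N q l) * t ^ 3 := by
    intro φ hφ
    obtain ⟨B, hB0, hB⟩ := hT φ hφ
    refine ⟨B, hB0, fun q hq l hl t ht => (hB q hq l hl t ht).trans ?_⟩
    have := ht.1
    have := norm_sq_le_sum_sq (coordP q₀ (⟨q, l⟩ : CotBundle n M))
    gcongr
  have hmeas : ∀ φ : M → ℝ, ContMDiff (𝓡 n) 𝓘(ℝ, ℝ) ∞ φ → ∀ q ∈ W, ∀ t ∈ Ico 0 ε,
      AEStronglyMeasurable (fun l => φ (S.exp q t l)) (μ q) := by
    intro φ hφ q hq t ht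
    -- The exponential map is known to be continuous only on the cylinder, but the cylinder is
    -- closed and carries the measure.
    rw [← Measure.restrict_eq_self_of_ae_mem (hae q hq)]
    exact (hφ.continuous.comp_continuousOn (hdom q hq t ht).2).aestronglyMeasurable
      (FibreData.isClosed_cylinder (hX.orthonormal q (hWU hq))).measurableSet
  have hres : ∀ φ : M → ℝ, ContMDiff (𝓡 n) 𝓘(ℝ, ℝ) ∞ φ → ∀ q ∈ W, ∀ t ∈ Ico 0 ε,
      Integrable (fun l => φ (S.exp q t l) - φ q -
          t * firstDeriv (fun i => localField q₀ (X i)) (φ ∘ (extChartAt (𝓡 n) q₀).symm)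
            (cotChart q₀ ⟨q, l⟩) -
          t ^ 2 / 2 * secondDeriv (fun i => localField q₀ (X i))
            (φ ∘ (extChartAt (𝓡 n) q₀).symm) (cotChart q₀ ⟨q, l⟩)) (μ q) := by
    intro φ hφ q hq t ht
    obtain ⟨F⟩ := hF q (hWU hq)
    have := hfin q hq
    obtain ⟨B, -, hB⟩ := hbd φ hφ
    refine Integrable.mono' (g := fun l => B * (1 + N q l) * t ^ 3)
      ((((integrable_const 1).add (hNi q hq)).const_mul B).mul_const _) ?_ ?_
    · exact (((hmeas φ hφ q hq t ht).sub aestronglyMeasurable_const).sub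
        ((integrable_firstDeriv hX (hWU hq) (hWs hq) F _).const_mul t).aestronglyMeasurable).sub
        ((integrable_secondDeriv hX (hWU hq) (hWs hq) F _).const_mul _).aestronglyMeasurable
    · filter_upwards [hae q hq] with l hl
      exact hB q hq l hl t ht
  have hdiff : ∀ φ : M → ℝ, ContMDiff (𝓡 n) 𝓘(ℝ, ℝ) ∞ φ → ∀ q ∈ W, ∀ t ∈ Ico 0 ε,
      Integrable (fun l => φ (S.exp q t l) - φ q) (μ q) := by
    intro φ hφ q hq t ht
    obtain ⟨F⟩ := hF q (hWU hq)
    refine (((hres φ hφ q hq t ht).add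
      ((integrable_firstDeriv hX (hWU hq) (hWs hq) F
        (φ ∘ (extChartAt (𝓡 n) q₀).symm)).const_mul t)).add
      ((integrable_secondDeriv hX (hWU hq) (hWs hq) F
        (φ ∘ (extChartAt (𝓡 n) q₀).symm)).const_mul (t ^ 2 / 2))).congr
      (Eventually.of_forall fun l => ?_)
    simp only [Pi.add_apply]
    ring
  -- The neighbourhood is shrunk to make the second moments uniformly bounded, which the constant of
  -- the final estimate requires.
  refine ⟨ε, hε, W ∩ {q | ∫ l, N q l ∂μ q ≤ K}, inter_mem hW hKq,
    fun q hq t ht => (hdom q hq.1 t ht).1, fun φ hφ q hq t ht => ?_, fun φ hφ => ?_⟩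
  · have := hfin q hq.1
    exact ((hdiff φ hφ q hq.1 t ht).add (integrable_const (φ q))).congr
      (Eventually.of_forall fun l => sub_add_cancel _ _)
  obtain ⟨B, hB0, hB⟩ := hbd φ hφ
  refine ⟨2 * k * (B * (1 + K)), fun q hq t ht => ?_⟩
  have ht' : t ∈ Ico 0 ε := ⟨ht.1.le, ht.2⟩
  rcases Nat.eq_zero_or_pos k with rfl | hk
  · simp [Structure.geodesicAverage]
  obtain ⟨F⟩ := hF q (hWU hq.1)
  have := F.isProbabilityMeasure hk
  have h1 := (integrable_firstDeriv hX (hWU hq.1) (hWs hq.1) F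
    (φ ∘ (extChartAt (𝓡 n) q₀).symm)).const_mul t
  have h2 := (integrable_secondDeriv hX (hWU hq.1) (hWs hq.1) F
    (φ ∘ (extChartAt (𝓡 n) q₀).symm)).const_mul (t ^ 2 / 2)
  have h3 := hres φ hφ q hq.1 t ht'
  refine abs_average_sub_le ht.1 (b := ∫ l, (φ (S.exp q t l) - φ q -
      t * firstDeriv (fun i => localField q₀ (X i)) (φ ∘ (extChartAt (𝓡 n) q₀).symm)
        (cotChart q₀ ⟨q, l⟩) -
      t ^ 2 / 2 * secondDeriv (fun i => localField q₀ (X i))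
        (φ ∘ (extChartAt (𝓡 n) q₀).symm) (cotChart q₀ ⟨q, l⟩)) ∂μ q) ?_
    (integral_firstDeriv hX (hWU hq.1) (hWs hq.1) F (φ ∘ (extChartAt (𝓡 n) q₀).symm)) ?_
  · rw [← integral_const_mul, ← integral_const_mul, ← integral_add h3 h1]
    refine Eq.trans ?_ (integral_add (h3.add h1) h2)
    refine integral_congr_ae (Eventually.of_forall fun l => ?_)
    ring
  · have h4 : Integrable (fun l => B * (1 + N q l) * t ^ 3) (μ q) :=
      (((integrable_const 1).add (hNi q hq.1)).const_mul B).mul_const _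
    have h5 := norm_integral_le_of_norm_le h4 (μ := μ q) (f := fun l => (φ (S.exp q t l) - φ q -
      t * firstDeriv (fun i => localField q₀ (X i)) (φ ∘ (extChartAt (𝓡 n) q₀).symm)
        (cotChart q₀ ⟨q, l⟩) -
      t ^ 2 / 2 * secondDeriv (fun i => localField q₀ (X i))
        (φ ∘ (extChartAt (𝓡 n) q₀).symm) (cotChart q₀ ⟨q, l⟩))) (by
        filter_upwards [hae q hq.1] with l hl
        exact hB q hq.1 l hl t ht')
    refine h5.trans ?_
    rw [integral_mul_const, integral_const_mul, integral_add (integrable_const 1) (hNi q hq.1)]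
    have h6 : ∫ l, N q l ∂μ q ≤ K := hq.2
    have := ht.1
    simp only [integral_const, probReal_univ, smul_eq_mul, mul_one]
    gcongr

theorem tendsto_of_abs_sub_le {g : ℝ → ℝ} {L B ε : ℝ} (hε : 0 < ε)
    (h : ∀ t ∈ Ioo 0 ε, |g t - L| ≤ B * t) : Tendsto g (𝓝[>] 0) (𝓝 L) := by
  rw [tendsto_iff_norm_sub_tendsto_zero]
  have h1 : Tendsto (fun t : ℝ => B * t) (𝓝[>] 0) (𝓝 0) := by
    have : Tendsto (fun t : ℝ => B * t) (𝓝 0) (𝓝 (B * 0)) := (continuous_const_mul B).tendsto 0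
    rw [mul_zero] at this
    exact this.mono_left nhdsWithin_le_nhds
  refine squeeze_zero' (Eventually.of_forall fun _ => norm_nonneg _) ?_ h1
  filter_upwards [Ioo_mem_nhdsGT hε] with t ht
  exact h t ht

theorem Structure.IsAdapted.exists_local_estimate_microLaplacian [T2Space M]
    {μ : Π q : M, Measure (CotSpace n q)} (hμ : S.IsAdapted V μ) (q₀ : M) :
    ∃ ε > 0, ∃ W ∈ 𝓝 q₀,
      (∀ q ∈ W, (∀ t ∈ Ico 0 ε, ∀ l ∈ S.cylinder q, (t, l) ∈ S.expDomain q) ∧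
        ∀ t ∈ Ioo 0 ε, ∀ φ : M → ℝ, ContMDiff (𝓡 n) 𝓘(ℝ, ℝ) ∞ φ →
          Integrable (fun l => φ (S.exp q t l)) (μ q)) ∧
      ∀ φ : M → ℝ, ContMDiff (𝓡 n) 𝓘(ℝ, ℝ) ∞ φ → ∃ B, ∀ q ∈ W, ∀ t ∈ Ioo 0 ε,
        |S.geodesicAverage μ φ t q - S.microLaplacian μ φ q| ≤ B * t := by
  obtain ⟨U, X, hq₀, hX⟩ := S.exists_isOrthonormalFrame q₀
  obtain ⟨ε, hε, W, hW, h1, h2, h3⟩ := hμ.exists_local_estimate hX hq₀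
  refine ⟨ε, hε, W, hW, fun q hq => ⟨h1 q hq, fun t ht φ hφ => h2 φ hφ q hq t ⟨ht.1.le, ht.2⟩⟩,
    fun φ hφ => ?_⟩
  obtain ⟨B, hB⟩ := h3 φ hφ
  refine ⟨B, fun q hq t ht => ?_⟩
  have h4 : S.microLaplacian μ φ q = _ :=
    (tendsto_of_abs_sub_le (g := fun t => S.geodesicAverage μ φ t q) hε (hB q hq)).limUnder_eq
  rw [h4]
  exact hB q hq t ht

/-- On compact sets the short geodesics are defined, the averages exist and converge uniformly. -/
theorem Structure.IsAdapted.exists_compact_estimate [T2Space M]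
    {μ : Π q : M, Measure (CotSpace n q)} (hμ : S.IsAdapted V μ) {K : Set M} (hK : IsCompact K) :
    ∃ ε > 0,
      (∀ q ∈ K, (∀ t ∈ Ico 0 ε, ∀ l ∈ S.cylinder q, (t, l) ∈ S.expDomain q) ∧
        ∀ t ∈ Ioo 0 ε, ∀ φ : M → ℝ, ContMDiff (𝓡 n) 𝓘(ℝ, ℝ) ∞ φ →
          Integrable (fun l => φ (S.exp q t l)) (μ q)) ∧
      ∀ φ : M → ℝ, ContMDiff (𝓡 n) 𝓘(ℝ, ℝ) ∞ φ → ∃ B, ∀ q ∈ K, ∀ t ∈ Ioo 0 ε,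
        |S.geodesicAverage μ φ t q - S.microLaplacian μ φ q| ≤ B * t := by
  -- The property passes to subsets and, with the smaller `ε` and the larger `B`, to unions; it
  -- holds near each point, hence on compact sets.
  refine hK.induction_on ⟨1, one_pos, by simp, fun φ _ => ⟨0, by simp⟩⟩ ?_ ?_ ?_
  · rintro s s' hs ⟨ε, hε, h1, h2⟩
    refine ⟨ε, hε, fun q hq => h1 q (hs hq), fun φ hφ => ?_⟩
    obtain ⟨B, hB⟩ := h2 φ hφ
    exact ⟨B, fun q hq => hB q (hs hq)⟩
  · rintro s s' ⟨ε, hε, h1, h2⟩ ⟨ε', hε', h1', h2'⟩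
    have hl := min_le_left ε ε'
    have hr := min_le_right ε ε'
    refine ⟨min ε ε', lt_min hε hε', ?_, fun φ hφ => ?_⟩
    · rintro q (hq | hq)
      · exact ⟨fun t ht => (h1 q hq).1 t ⟨ht.1, ht.2.trans_le hl⟩,
          fun t ht => (h1 q hq).2 t ⟨ht.1, ht.2.trans_le hl⟩⟩
      · exact ⟨fun t ht => (h1' q hq).1 t ⟨ht.1, ht.2.trans_le hr⟩,
          fun t ht => (h1' q hq).2 t ⟨ht.1, ht.2.trans_le hr⟩⟩
    · obtain ⟨B, hB⟩ := h2 φ hφ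
      obtain ⟨B', hB'⟩ := h2' φ hφ
      refine ⟨max B B', ?_⟩
      rintro q (hq | hq) t ht
      · exact (hB q hq t ⟨ht.1, ht.2.trans_le hl⟩).trans
          (mul_le_mul_of_nonneg_right (le_max_left _ _) ht.1.le)
      · exact (hB' q hq t ⟨ht.1, ht.2.trans_le hr⟩).trans
          (mul_le_mul_of_nonneg_right (le_max_right _ _) ht.1.le)
  · intro q _
    obtain ⟨ε, hε, W, hW, h1, h2⟩ := hμ.exists_local_estimate_microLaplacian q
    exact ⟨W, mem_nhdsWithin_of_mem_nhds hW, ε, hε, h1, h2⟩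

theorem tendstoUniformlyOn_of_abs_sub_le {α : Type*} {g : ℝ → α → ℝ} {L : α → ℝ} {B ε : ℝ}
    {K : Set α} (hε : 0 < ε) (h : ∀ x ∈ K, ∀ t ∈ Ioo 0 ε, |g t x - L x| ≤ B * t) :
    TendstoUniformlyOn g L (𝓝[>] 0) K := by
  rw [Metric.tendstoUniformlyOn_iff]
  intro η hη
  have h1 : Tendsto (fun t : ℝ => B * t) (𝓝[>] 0) (𝓝 0) := by
    have : Tendsto (fun t : ℝ => B * t) (𝓝 0) (𝓝 (B * 0)) := (continuous_const_mul B).tendsto 0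
    rw [mul_zero] at this
    exact this.mono_left nhdsWithin_le_nhds
  filter_upwards [Ioo_mem_nhdsGT hε, h1.eventually_lt_const hη] with t ht hlt x hx
  rw [dist_comm, Real.dist_eq]
  exact (h x hx t ht).trans_lt hlt

/-! ### The formula in a frame -/

theorem fieldDeriv_eq {q₀ q : M} (hq : q ∈ (extChartAt (𝓡 n) q₀).source) {g : M → ℝ}
    {ψ : EuclideanSpace ℝ (Fin n) → ℝ} (hg : g =ᶠ[𝓝 q] ψ ∘ extChartAt (𝓡 n) q₀)
    (hψ : DifferentiableAt ℝ ψ (extChartAt (𝓡 n) q₀ q)) (Z : Π q : M, TangentSpace (𝓡 n) q) :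
    fieldDeriv Z g q = fderiv ℝ ψ (extChartAt (𝓡 n) q₀ q)
      (localField q₀ Z (extChartAt (𝓡 n) q₀ q)) := by
  have h1 : MDifferentiableAt (𝓡 n) 𝓘(ℝ, EuclideanSpace ℝ (Fin n)) (extChartAt (𝓡 n) q₀) q :=
    (contMDiffAt_extChartAt' (n := ∞) (by rwa [extChartAt_source] at hq)).mdifferentiableAt (by simp)
  have h2 := (hψ.hasFDerivAt.hasMFDerivAt.comp q h1.hasMFDerivAt).congr_of_eventuallyEq hg
  rw [fieldDeriv, h2.mfderiv, localField_apply hq]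
  rfl

theorem contDiffOn_comp_extChartAt_symm (q₀ : M) {φ : M → ℝ}
    (hφ : ContMDiff (𝓡 n) 𝓘(ℝ, ℝ) ∞ φ) :
    ContDiffOn ℝ ∞ (φ ∘ (extChartAt (𝓡 n) q₀).symm) (extChartAt (𝓡 n) q₀).target := by
  rw [← contMDiffOn_iff_contDiffOn]
  exact hφ.comp_contMDiffOn (contMDiffOn_extChartAt_symm q₀)

theorem frameDeriv_eq_fieldDeriv {q₀ q : M} (hq : q ∈ (extChartAt (𝓡 n) q₀).source) {φ : M → ℝ}
    (hφ : ContMDiff (𝓡 n) 𝓘(ℝ, ℝ) ∞ φ) (i : Fin k) :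
    frameDeriv (fun i => localField q₀ (X i)) i (φ ∘ (extChartAt (𝓡 n) q₀).symm)
      (extChartAt (𝓡 n) q₀ q) = fieldDeriv (X i) φ q := by
  have hg : φ =ᶠ[𝓝 q] (φ ∘ (extChartAt (𝓡 n) q₀).symm) ∘ extChartAt (𝓡 n) q₀ := by
    filter_upwards [(isOpen_extChartAt_source q₀).mem_nhds hq] with q' hq'
    exact (congrArg φ ((extChartAt (𝓡 n) q₀).left_inv hq')).symm
  refine (fieldDeriv_eq hq hg ?_ (X i)).symm
  exact ((contDiffOn_comp_extChartAt_symm q₀ hφ).contDiffAt ((isOpen_extChartAt_target q₀).mem_nhds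
    ((extChartAt (𝓡 n) q₀).map_source hq))).differentiableAt (by simp)

theorem frameDeriv_frameDeriv_eq_fieldDeriv (hX : S.IsOrthonormalFrame U X) {q₀ q : M}
    (hqU : q ∈ U) (hq : q ∈ (extChartAt (𝓡 n) q₀).source) {φ : M → ℝ}
    (hφ : ContMDiff (𝓡 n) 𝓘(ℝ, ℝ) ∞ φ) (i j : Fin k) :
    frameDeriv (fun i => localField q₀ (X i)) j
      (frameDeriv (fun i => localField q₀ (X i)) i (φ ∘ (extChartAt (𝓡 n) q₀).symm))
      (extChartAt (𝓡 n) q₀ q) = fieldDeriv (X j) (fieldDeriv (X i) φ) q := by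
  have ht : (extChartAt (𝓡 n) q₀).target ∈ 𝓝 (extChartAt (𝓡 n) q₀ q) :=
    (isOpen_extChartAt_target q₀).mem_nhds ((extChartAt (𝓡 n) q₀).map_source hq)
  -- The first derivatives agree on a neighbourhood, so they can be differentiated once more.
  have hg : fieldDeriv (X i) φ =ᶠ[𝓝 q] frameDeriv (fun i => localField q₀ (X i)) i
      (φ ∘ (extChartAt (𝓡 n) q₀).symm) ∘ extChartAt (𝓡 n) q₀ := by
    filter_upwards [(isOpen_extChartAt_source q₀).mem_nhds hq] with q' hq'
    exact (frameDeriv_eq_fieldDeriv hq' hφ i).symm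
  refine (fieldDeriv_eq hq hg ?_ (X j)).symm
  have h1 : ContDiffAt ℝ ∞ (localField q₀ (X i)) (extChartAt (𝓡 n) q₀ q) :=
    hX.isHamiltonianFrame.contDiffAt hq hqU i
  have h2 := ((contDiffOn_comp_extChartAt_symm q₀ hφ).contDiffAt ht).fderiv_right (m := ∞) (by simp)
  exact (h2.clm_apply h1).differentiableAt (by simp)

/-- The bracket on the manifold is defined at `q` through the chart at `q`, so the identity unfolds
from the definition when the chart is centred at the point itself. -/
theorem chartVector_lieBracket (q : M) (Z W : Π q : M, TangentSpace (𝓡 n) q) :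
    chartVector q q (VectorField.lieBracket ℝ (localField q Z) (localField q W)
      (extChartAt (𝓡 n) q q)) = VectorField.mlieBracket (𝓡 n) Z W q := by
  have h : (extChartAt (𝓡 n) q).symm ⁻¹' univ ∩ range (𝓡 n) = univ := by simp
  rw [VectorField.mlieBracket, VectorField.mlieBracketWithin, h,
    ← VectorField.lieBracketWithin_univ]
  rfl

/-- The microscopic Laplacian in an orthonormal frame `X`, where `c i j` are the components of the
projection of `[X_j, X_i]` to the distribution along the complement. -/
theorem Structure.IsAdapted.microLaplacian_eq [T2Space M]
    {μ : Π q : M, Measure (CotSpace n q)} (hμ : S.IsAdapted V μ)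
    (hX : S.IsOrthonormalFrame U X) {q : M} (hq : q ∈ U) {c : Fin k → Fin k → Fin k → ℝ}
    (hc : ∀ i j, VectorField.mlieBracket (𝓡 n) (X j) (X i) q - ∑ a, c i j a • X a q ∈ V q)
    {φ : M → ℝ} (hφ : ContMDiff (𝓡 n) 𝓘(ℝ, ℝ) ∞ φ) :
    S.microLaplacian μ φ q = ∑ i, fieldDeriv (X i) (fieldDeriv (X i) φ) q +
      ∑ i, ∑ j, c i j j * fieldDeriv (X i) φ q := by
  obtain ⟨ε, hε, W, hW, -, -, h3⟩ := hμ.exists_local_estimate hX hq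
  obtain ⟨B, hB⟩ := h3 φ hφ
  obtain ⟨F⟩ := hμ.nonempty_fibreData (hX.orthonormal q hq)
  have hs := mem_extChartAt_source (I := 𝓡 n) q
  have h4 : S.microLaplacian μ φ q = _ := (tendsto_of_abs_sub_le
    (g := fun t => S.geodesicAverage μ φ t q) hε (hB q (mem_of_mem_nhds hW))).limUnder_eq
  rw [h4, integral_secondDeriv hX hq hs F _ (c := c)
    (fun i j => by rw [chartVector_lieBracket]; exact hc i j)]
  simp only [frameDeriv_eq_fieldDeriv hs hφ, frameDeriv_frameDeriv_eq_fieldDeriv hX hq hs hφ]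

/-- The splitting `TM = D ⊕ V` supplies coefficients `c` without reference to a measure, and the
frame formula then gives the same value for both families. -/
theorem Structure.IsAdapted.microLaplacian_congr [T2Space M] (hV : S.IsComplement V)
    {μ μ' : Π q : M, Measure (CotSpace n q)} (hμ : S.IsAdapted V μ) (hμ' : S.IsAdapted V μ')
    {φ : M → ℝ} (hφ : ContMDiff (𝓡 n) 𝓘(ℝ, ℝ) ∞ φ) :
    S.microLaplacian μ φ = S.microLaplacian μ' φ := by
  funext q
  obtain ⟨U, X, hq, hX⟩ := S.exists_isOrthonormalFrame q
  have hex : ∀ w : TangentSpace (𝓡 n) q, ∃ c : Fin k → ℝ, w - ∑ a, c a • X a q ∈ V q := by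
    intro w
    obtain ⟨d, hd, v, hv, hdv⟩ := Submodule.mem_sup.1
      ((hV.2 q).sup_eq_top ▸ Submodule.mem_top : w ∈ S.distr q ⊔ V q)
    have := Structure.finiteDimensional_tangentSpace (n := n) q
    have h := eq_sum_of_orthonormal (S.finrank_distr q) (hX.orthonormal q hq) ⟨d, hd⟩
    refine ⟨fun a => S.metric q ⟨d, hd⟩ ⟨X a q, hX.mem_distr a q hq⟩, ?_⟩
    have h' := congrArg (S.distr q).subtype h
    simp only [map_sum, map_smul, Submodule.subtype_apply] at h'
    rw [← h', ← hdv, add_sub_cancel_left]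
    exact hv
  choose c hc using hex
  have h := fun i j => hc (VectorField.mlieBracket (𝓡 n) (X j) (X i) q)
  rw [hμ.microLaplacian_eq hX hq h hφ, hμ'.microLaplacian_eq hX hq h hφ]

theorem Structure.IsAdapted.microLaplacian_eq_structFun [T2Space M]
    {μ : Π q : M, Measure (CotSpace n q)} (hμ : S.IsAdapted V μ) {m : ℕ}
    {Y : Fin m → Π q : M, TangentSpace (𝓡 n) q} (hF : S.IsAdaptedFrame V U X Y) {φ : M → ℝ}
    (hφ : ContMDiff (𝓡 n) 𝓘(ℝ, ℝ) ∞ φ) {q : M} (hq : q ∈ U) :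
    S.microLaplacian μ φ q = ∑ i, fieldDeriv (X i) (fieldDeriv (X i) φ) q +
      ∑ i, ∑ j, structFun hF.isLocalFrame (Sum.inl j) (Sum.inl i) (Sum.inl j) q *
        fieldDeriv (X i) φ q := by
  refine hμ.microLaplacian_eq hF.isOrthonormalFrame hq
    (c := fun i j a => structFun hF.isLocalFrame (Sum.inl j) (Sum.inl i) (Sum.inl a) q)
    (fun i j => ?_) hφ
  have h := hF.isLocalFrame.coeff_sum_eq
    (fun q => VectorField.mlieBracket (𝓡 n) (X j) (X i) q) hq
  rw [Fintype.sum_sum_type, ← sub_eq_iff_eq_add'] at h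
  -- What remains of the bracket after removing its `X` components is a combination of the `Y a`,
  -- hence lies in `V`.
  refine (congrArg (· ∈ V q) h).mpr (Submodule.sum_mem _ fun a _ => Submodule.smul_mem _ _ ?_)
  exact hF.mem_compl a q hq

end Laplacian

end SubRiemannian

end

theorem theorem1 {n k : ℕ} {M : Type*} [TopologicalSpace M]
    [ChartedSpace (EuclideanSpace ℝ (Fin n)) M] [IsManifold (𝓡 n) ∞ M]
    [T2Space M] [SecondCountableTopology M] [ConnectedSpace M]
    (S : SubRiemannian.Structure n k M)
    (V : Π q : M, Submodule ℝ (TangentSpace (𝓡 n) q)) (hV : S.IsComplement V) :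
    -- on compact sets the short geodesics are defined, the averages make sense and converge
    -- uniformly
    (∀ μ : Π q : M, Measure (SubRiemannian.CotSpace n q), S.IsAdapted V μ →
      ∀ K : Set M, IsCompact K →
        (∃ ε > 0, ∀ q ∈ K,
          (∀ t ∈ Ico (0 : ℝ) ε, ∀ l ∈ S.cylinder q, (t, l) ∈ S.expDomain q) ∧
          ∀ t ∈ Ioo (0 : ℝ) ε, ∀ φ : M → ℝ, ContMDiff (𝓡 n) 𝓘(ℝ, ℝ) ∞ φ →
            Integrable (fun l => φ (S.exp q t l)) (μ q)) ∧
        ∀ φ : M → ℝ, ContMDiff (𝓡 n) 𝓘(ℝ, ℝ) ∞ φ →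
          TendstoUniformlyOn (fun t q => S.geodesicAverage μ φ t q) (S.microLaplacian μ φ)
            (𝓝[>] (0 : ℝ)) K) ∧
    -- the operator depends only on the complement
    (∀ μ μ' : Π q : M, Measure (SubRiemannian.CotSpace n q),
      S.IsAdapted V μ → S.IsAdapted V μ' →
      ∀ φ : M → ℝ, ContMDiff (𝓡 n) 𝓘(ℝ, ℝ) ∞ φ → S.microLaplacian μ φ = S.microLaplacian μ' φ) ∧
    -- the formula in local frames
    (∀ μ : Π q : M, Measure (SubRiemannian.CotSpace n q), S.IsAdapted V μ →
      ∀ (m : ℕ) (U : Set M) (X : Fin k → Π q : M, TangentSpace (𝓡 n) q)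
        (Y : Fin m → Π q : M, TangentSpace (𝓡 n) q) (hF : S.IsAdaptedFrame V U X Y)
        (φ : M → ℝ), ContMDiff (𝓡 n) 𝓘(ℝ, ℝ) ∞ φ → ∀ q ∈ U,
        S.microLaplacian μ φ q =
          ∑ i, SubRiemannian.fieldDeriv (X i) (SubRiemannian.fieldDeriv (X i) φ) q +
          ∑ i, ∑ j, SubRiemannian.structFun hF.isLocalFrame (Sum.inl j) (Sum.inl i)
              (Sum.inl j) q * SubRiemannian.fieldDeriv (X i) φ q) := by
  refine ⟨fun μ hμ K hK => ?_, fun μ μ' hμ hμ' φ hφ => hμ.microLaplacian_congr hV hμ' hφ,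
    fun μ hμ m U X Y hF φ hφ q hq => hμ.microLaplacian_eq_structFun hF hφ hq⟩
  obtain ⟨ε, hε, h1, h2⟩ := hμ.exists_compact_estimate hK
  refine ⟨⟨ε, hε, h1⟩, fun φ hφ => ?_⟩
  obtain ⟨B, hB⟩ := h2 φ hφ
  exact SubRiemannian.tendstoUniformlyOn_of_abs_sub_le hε hB
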